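/- Let $\boldsymbol k$ be a field of characteristic zero and let $A=(A,\{m_n\}_{n\ge1})$ be a $\mathbb Z$-graded $A_\infty$-algebra over $\boldsymbol k$ whose cohomology $H^\bullet(A)=\ker m_1/\operatorname{im} m_1$ is finite dimensional. Write $|x|'=|x|-1$ for the shifted degree; all signs are Koszul signs for shifted degrees, and $A^*$ is the graded dual of $A$ with its dual $A_\infty$-bimodule structure. Let $\phi:A\to A^*$ be an $A_\infty$-bimodule homomorphism of some degree $e\in\mathbb Z$, with components $\phi_{p,q}:A^{\otimes p}\otimes A\otimes A^{\otimes q}\to A^*$. Call $\phi$ a strong homotopy inner product (new sense) if, for homogeneous elements, (a) (skew symmetry) $\phi_{p,q}(\vec a,v,\vec b)(w)=-(-1)^{K}\phi_{q,p}(\vec b,w,\vec a)(v)$ with $K=(\sum|a_i|'+|v|')(\sum|b_j|'+|w|')$; (b) (closedness) for every family $(a_1,\dots,a_{n})$ and all $1\le i<j<k\le n$, $$(-1)^{K_j}\phi(\dots,\underline{a_i},\dots)(a_j)+(-1)^{K_k}\phi(\dots,\underline{a_j},\dots)(a_k)+(-1)^{K_i}\phi(\dots,\underline{a_k},\dots)(a_i)=0,$$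 where in each term the arguments are those of the cyclic rotation of $(a_1,\dots,a_n)$ that ends with the element in the last slot, the underlined element is the bimodule argument, and $K_s=(|a_1|'+\dots+|a_s|')(|a_{s+1}|'+\dots+|a_n|')$ is the Koszul sign of that rotation; (c) (homological non-degeneracy) for every non-zero class $[a]\in H^\bullet(A)$ there is a class $[b]\in H^\bullet(A)$ with $\phi_{0,0}(a)(b)\ne0$. A homogeneous bilinear form on a graded vector space is called non-degenerate if it induces an isomorphism onto the graded dual. A cyclic inner product of degree $e$ on an $A_\infty$-algebra $B$ is a non-degenerate bilinear form $\langle\,,\rangle:B\otimes B\to\boldsymbol k$, vanishing on homogeneous $x,y$ unless $|x|'+|y|'+e=0$, with $\langle x,y\rangle=-(-1)^{|x|'|y|'}\langle y,x\rangle$ and $$\langle m_n(x_1,\dots,x_n),x_{n+1}\rangle=(-1)^{|x_1|'(|x_2|'+\dots+|x_{n+1}|')}\langle m_n(x_2,\dots,x_{n+1}),x_1\rangle\qquad(n\ge1);$$ it is identified with the map $\psi:B\to B^*$ with $\psi_{0,0}(x)(y)=\langle x,y\rangle$ and all other components zero. For an $A_\infty$-morphism $f:A\to B$ let $\tilde f:A\to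 B$ be the induced map of $A_\infty$-bimodules over $A$, $\tilde f_{p,q}=f_{p+q+1}$, and $\tilde f^*:B^*\to A^*$ its dual. Call $\phi$ a strong homotopy inner product in the old sense if $\phi=\tilde f^*\circ\psi\circ\tilde f$ (as maps of $A_\infty$-bimodules over $A$) for some $A_\infty$-algebra $B$ with a cyclic inner product $\psi$ of degree $e$ and some $A_\infty$-quasi-isomorphism $f:A\to B$. Then: 1. If $\phi$ is a strong homotopy inner product in the new sense, there exist an $A_\infty$-algebra $B$ with a cyclic inner product $\psi:B\to B^*$ of degree $e$ and an $A_\infty$-quasi-isomorphism $\iota:B\to A$ such that $\psi=\tilde\iota^*\circ\phi\circ\tilde\iota$ as maps of $A_\infty$-bimodules over $B$. 2. If there exist an $A_\infty$-algebra $B$ with a cyclic inner product $\psi:B\to B^*$ of degree $e$ and an $A_\infty$-quasi-isomorphism $f:A\to B$ such that $\phi=\tilde f^*\circ\psi\circ\tilde f$, then $\phi$ is a strong homotopy inner product in the new sense. 3. If $\phi_{0,0}$ is non-degenerate on the chain level, then $\phi$ is a strong homotopy inner product in the old sense if and only if it is one in the new sense. -/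

import Mathlib

universe uk u v

/-! ## Words and sums over their decompositions -/

/-- Sum of `F a b` over all ways to write the word `l` as a concatenation `a ++ b`. -/
def sumSplit {α N : Type*} [AddCommMonoid N] (l : List α) (F : List α → List α → N) : N :=
  ∑ i ∈ Finset.range (l.length + 1), F (l.take i) (l.drop i)

/-- Sum of `F a b c` over all ways to write the word `l` as a concatenation `a ++ b ++ c`. -/
def sumSplit₃ {α N : Type*} [AddCommMonoid N] (l : List α)
    (F : List α → List α → List α → N) : N :=
  sumSplit l fun a l' => sumSplit l' fun b c => F a b c

/-- Sum of `F [b₁, …, b_r]` over all ways to cut the word `l` into nonempty consecutive blocks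
`b₁, …, b_r` (for the empty word there is one way, with `r = 0`). -/
def sumBlocks {α N : Type*} [AddCommMonoid N] (l : List α) (F : List (List α) → N) : N :=
  ∑ c : Composition l.length, F (l.splitWrtComposition c)

/-- Evaluation of a sequence of multilinear maps `g₀, g₁, g₂, …` on a word. -/
def evalWord {k : Type uk} [Field k] {V : Type u} {W : Type v}
    [AddCommGroup V] [Module k V] [AddCommGroup W] [Module k W]
    (g : ∀ n : ℕ, MultilinearMap k (fun _ : Fin n => V) W) (l : List V) : W :=
  g l.length l.get

/-- The homogeneous elements of a graded vector space, each together with a degree. -/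
abbrev Letter {k : Type uk} [Field k] {V : Type u} [AddCommGroup V] [Module k V]
    (gr : ℤ → Submodule k V) : Type u :=
  Σ i : ℤ, gr i

namespace Letter

variable {k : Type uk} [Field k] {V : Type u} [AddCommGroup V] [Module k V]
  {gr : ℤ → Submodule k V}

/-- The underlying vector. -/
def val (x : Letter gr) : V := (x.2 : V)

/-- The shifted degree `|x|' = |x| - 1`. -/
def sdeg (x : Letter gr) : ℤ := x.1 - 1

/-- The underlying word of vectors. -/
def vals (l : List (Letter gr)) : List V := l.map val

/-- The total shifted degree of a word. -/
def wdeg (l : List (Letter gr)) : ℤ := (l.map sdeg).sum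

end Letter

open Letter

/-- The sign `(-1)^n`. -/
abbrev ksign (n : ℤ) : ℤˣ := n.negOnePow

/-! ## A∞-algebras and their morphisms -/

/-- A (`ℤ`-graded, uncurved) A∞-algebra over the field `k`: a graded vector space with operations
`m_n` (`n ≥ 1`) of degree `+1` for the shifted degrees, such that
`∑ (-1)^{|a|'} m(a, m(b), c) = 0`, the sum being over all decompositions `a ++ b ++ c`
of a given word of homogeneous elements. -/
structure AInfAlgebra (k : Type uk) [Field k] where
  carrier : Type u
  [addCommGroup : AddCommGroup carrier]
  [module : Module k carrier]
  gr : ℤ → Submodule k carrier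
  isInternal : DirectSum.IsInternal gr
  m : ∀ n : ℕ, MultilinearMap k (fun _ : Fin n => carrier) carrier
  m_zero : m 0 = 0
  m_degree : ∀ l : List (Letter gr), evalWord m (vals l) ∈ gr (wdeg l + 2)
  m_rel : ∀ l : List (Letter gr),
    sumSplit₃ l (fun a b c =>
      ksign (wdeg a) • evalWord m (vals a ++ evalWord m (vals b) :: vals c)) = 0

namespace AInfAlgebra

variable {k : Type uk} [Field k]

instance : CoeSort (AInfAlgebra.{uk, u} k) (Type u) := ⟨AInfAlgebra.carrier⟩

attribute [instance] AInfAlgebra.addCommGroup AInfAlgebra.module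

/-- The differential `m₁`. -/
def d (A : AInfAlgebra.{uk, u} k) : A →ₗ[k] A :=
  (MultilinearMap.ofSubsingleton k A.carrier A.carrier (0 : Fin 1)).symm (A.m 1)

/-- The cohomology `H(A) = ker m₁ / im m₁`. -/
abbrev Cohomology (A : AInfAlgebra.{uk, u} k) : Type u :=
  LinearMap.ker A.d ⧸ (LinearMap.range A.d).submoduleOf (LinearMap.ker A.d)

end AInfAlgebra

/-- An A∞-morphism `f : A → B`: maps `f_n` (`n ≥ 1`) of degree `0` for the shifted degrees with
`∑ m^B(f(b₁), …, f(b_r)) = ∑ (-1)^{|a|'} f(a, m^A(b), c)` on every word of homogeneous elements. -/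
structure AInfHom {k : Type uk} [Field k]
    (A : AInfAlgebra.{uk, u} k) (B : AInfAlgebra.{uk, v} k) where
  f : ∀ n : ℕ, MultilinearMap k (fun _ : Fin n => A.carrier) B.carrier
  f_zero : f 0 = 0
  f_degree : ∀ l : List (Letter A.gr), evalWord f (vals l) ∈ B.gr (wdeg l + 1)
  f_rel : ∀ l : List (Letter A.gr),
    sumBlocks l (fun L => evalWord B.m (L.map fun b => evalWord f (vals b))) =
      sumSplit₃ l (fun a b c =>
        ksign (wdeg a) • evalWord f (vals a ++ evalWord A.m (vals b) :: vals c))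

namespace AInfHom

variable {k : Type uk} [Field k] {A : AInfAlgebra.{uk, u} k} {B : AInfAlgebra.{uk, v} k}

/-- `f` is an A∞-quasi-isomorphism: the chain map `f₁` induces an injective (first clause) and
surjective (second clause) map on cohomology. -/
def IsQuasiIso (f : AInfHom A B) : Prop :=
  (∀ a : A, A.d a = 0 → (∃ b : B, B.d b = evalWord f.f [a]) → ∃ a' : A, A.d a' = a) ∧
  (∀ b : B, B.d b = 0 → ∃ (a : A) (b' : B), A.d a = 0 ∧ b = evalWord f.f [a] + B.d b')

end AInfHom

/-! ## A∞-bimodule homomorphisms `A → A*` -/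

namespace AInfAlgebra

variable {k : Type uk} [Field k]

/-- Families of multilinear maps `φ_{p,q} : A^{⊗p} ⊗ A ⊗ A^{⊗q} → A*`. -/
abbrev Family (A : AInfAlgebra.{uk, u} k) :=
  ∀ p q : ℕ, MultilinearMap k (fun _ : Fin p => A.carrier)
    (MultilinearMap k (fun _ : Fin q => A.carrier) (A.carrier →ₗ[k] Module.Dual k A.carrier))

/-- `φ_{p,q}(a, v, c) ∈ A*`, where `p`, `q` are the lengths of the words `a`, `c`. -/
def Family.ev {A : AInfAlgebra.{uk, u} k} (φ : A.Family) (a : List A) (v : A) (c : List A) :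
    Module.Dual k A :=
  φ a.length c.length a.get c.get v

/-- The structure maps of the dual A∞-bimodule `A*`: for `ξ ∈ A*` of (shifted) degree `r`,
`b*(a, ξ, c)(x) = -(-1)^{r + |a|'(r + |c|' + |x|')} ξ(m(c, x, a))`.
Here a functional has degree `r` if it vanishes on all `x` with `|x|' ≠ -r`. -/
def dualOp (A : AInfAlgebra.{uk, u} k) (r : ℤ) (a : List (Letter A.gr)) (ξ : Module.Dual k A)
    (c : List (Letter A.gr)) (x : Letter A.gr) : k :=
  -(ksign (r + wdeg a * (r + wdeg c + sdeg x)) • ξ (evalWord A.m (vals c ++ x.val :: vals a)))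

/-- An A∞-bimodule homomorphism `φ : A → A*` of degree `e`:
`φ ∘ b̂_A = (-1)^e b_{A*} ∘ φ̂`, with the Koszul signs for the shifted degrees, evaluated on
`(a, v, c) ∈ A^{⊗p} ⊗ A ⊗ A^{⊗q}` and then on `x ∈ A`. -/
structure DualBimoduleMap (A : AInfAlgebra.{uk, u} k) (e : ℤ) where
  family : A.Family
  degree : ∀ (a : List (Letter A.gr)) (v : Letter A.gr) (c : List (Letter A.gr))
    (x : Letter A.gr), wdeg a + sdeg v + wdeg c + sdeg x + e ≠ 0 →
      family.ev (vals a) v.val (vals c) x.val = 0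
  rel : ∀ (a : List (Letter A.gr)) (v : Letter A.gr) (c : List (Letter A.gr)) (x : Letter A.gr),
    (sumSplit a fun a₁ a₂ => sumSplit c fun c₁ c₂ =>
        ksign (wdeg a₁) •
          family.ev (vals a₁) (evalWord A.m (vals a₂ ++ v.val :: vals c₁)) (vals c₂) x.val) +
    (sumSplit₃ a fun a₁ a₂ a₃ =>
        ksign (wdeg a₁) •
          family.ev (vals a₁ ++ evalWord A.m (vals a₂) :: vals a₃) v.val (vals c) x.val) +
    (sumSplit₃ c fun c₁ c₂ c₃ =>
        ksign (wdeg a + sdeg v + wdeg c₁) •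
          family.ev (vals a) v.val (vals c₁ ++ evalWord A.m (vals c₂) :: vals c₃) x.val) =
    ksign e •
      (sumSplit a fun a₁ a₂ => sumSplit c fun c₁ c₂ =>
        ksign (e * wdeg a₁) •
          A.dualOp (e + wdeg a₂ + sdeg v + wdeg c₁) a₁
            (family.ev (vals a₂) v.val (vals c₁)) c₂ x)

/-- Non-degeneracy of a (homogeneous) bilinear form: the induced map from `A` to its graded dual is
an isomorphism. -/
def FormNondegenerate (A : AInfAlgebra.{uk, u} k) (β : A.carrier → Module.Dual k A.carrier) :
    Prop :=
  (∀ a : A, a ≠ 0 → ∃ b : A, β a b ≠ 0) ∧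
  (∀ (j : ℤ) (ξ : Module.Dual k (A.gr j)), ∃ a : A, ∀ b : A.gr j, β a (b : A) = ξ b)

namespace DualBimoduleMap

variable {A : AInfAlgebra.{uk, u} k} {e : ℤ}

/-- `φ_{k,l}(a, v, b)(w) = -(-1)^K φ_{l,k}(b, w, a)(v)`,
`K = (|a|' + |v|')(|b|' + |w|')`. -/
def SkewSymmetric (φ : A.DualBimoduleMap e) : Prop :=
  ∀ (a : List (Letter A.gr)) (v : Letter A.gr) (b : List (Letter A.gr)) (w : Letter A.gr),
    φ.family.ev (vals a) v.val (vals b) w.val =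
      -(ksign ((wdeg a + sdeg v) * (wdeg b + sdeg w)) •
        φ.family.ev (vals b) w.val (vals a) v.val)

/-- Closedness. The family of homogeneous elements with three chosen members is written
`α, x, β, y, γ, z, δ` with words `α, β, γ, δ`; each summand is a cyclic rotation of it,
with the Koszul sign of that rotation. -/
def Closed (φ : A.DualBimoduleMap e) : Prop :=
  ∀ (α β γ δ : List (Letter A.gr)) (x y z : Letter A.gr),
    ksign ((wdeg α + sdeg x + wdeg β + sdeg y) * (wdeg γ + sdeg z + wdeg δ)) •
        φ.family.ev (vals (γ ++ z :: δ ++ α)) x.val (vals β) y.val +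
      ksign ((wdeg α + sdeg x + wdeg β + sdeg y + wdeg γ + sdeg z) * wdeg δ) •
        φ.family.ev (vals (δ ++ α ++ x :: β)) y.val (vals γ) z.val +
      ksign ((wdeg α + sdeg x) * (wdeg β + sdeg y + wdeg γ + sdeg z + wdeg δ)) •
        φ.family.ev (vals (β ++ y :: γ)) z.val (vals (δ ++ α)) x.val = 0

/-- Homological non-degeneracy: every non-zero class `[a]` pairs non-trivially with some class
`[b]` under `φ_{0,0}`. -/
def HomologicallyNondegenerate (φ : A.DualBimoduleMap e) : Prop :=
  ∀ a : A, A.d a = 0 → a ∉ LinearMap.range A.d →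
    ∃ b : A, A.d b = 0 ∧ φ.family.ev [] a [] b ≠ 0

/-- Strong homotopy inner products (new sense). -/
def IsStrongHomotopyInnerProduct (φ : A.DualBimoduleMap e) : Prop :=
  φ.SkewSymmetric ∧ φ.Closed ∧ φ.HomologicallyNondegenerate

/-- `φ_{0,0}` is non-degenerate on the chain level. -/
def ChainNondegenerate (φ : A.DualBimoduleMap e) : Prop :=
  A.FormNondegenerate fun a => φ.family.ev [] a []

end DualBimoduleMap

/-- A cyclic inner product of degree `e` on an A∞-algebra. -/
structure CyclicInnerProduct (B : AInfAlgebra.{uk, u} k) (e : ℤ) where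
  form : B.carrier →ₗ[k] Module.Dual k B.carrier
  degree : ∀ x y : Letter B.gr, sdeg x + sdeg y + e ≠ 0 → form x.val y.val = 0
  skew : ∀ x y : Letter B.gr, form x.val y.val = -(ksign (sdeg x * sdeg y) • form y.val x.val)
  nondegenerate : B.FormNondegenerate fun a => form a
  /-- `<m_n(x₁, …, x_n), x_{n+1}> = (-1)^K <m_n(x₂, …, x_{n+1}), x₁>`,
  `K = |x₁|'(|x₂|' + ⋯ + |x_{n+1}|')`; here `x = x₁`, `l = (x₂, …, x_n)`, `y = x_{n+1}`. -/
  cyclic : ∀ (x : Letter B.gr) (l : List (Letter B.gr)) (y : Letter B.gr),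
    form (evalWord B.m (x.val :: vals l)) y.val =
      ksign (sdeg x * (wdeg l + sdeg y)) • form (evalWord B.m (vals l ++ [y.val])) x.val

/-- The family `ψ : B → B*` given by a cyclic inner product: `ψ_{0,0}` is the inner product and
all other components vanish. -/
def CyclicInnerProduct.family {B : AInfAlgebra.{uk, u} k} {e : ℤ} (ψ : B.CyclicInnerProduct e) :
    B.Family
  | 0, 0 => MultilinearMap.constOfIsEmpty k _ (MultilinearMap.constOfIsEmpty k _ ψ.form)
  | _, _ => 0

end AInfAlgebra

/-! ## The induced bimodule maps `f̃`, `f̃*`, and commuting diagrams -/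

namespace AInfHom

variable {k : Type uk} [Field k] {A : AInfAlgebra.{uk, u} k} {B : AInfAlgebra.{uk, v} k}

/-- The `A`-bimodule map `f̃ : A → B` induced by `f`: `f̃(a, v, c) = f(a, v, c)`. -/
def tilde (f : AInfHom A B) (a : List (Letter A.gr)) (v : A) (c : List (Letter A.gr)) : B :=
  evalWord f.f (vals a ++ v :: vals c)

/-- The family `ψ : B → B*` regarded as a map of `A`-bimodules via `f`:
`(a, y, c) ↦ ψ(f̂(a), y, f̂(c))`, where `f̂(a) = ∑ f(a₁) ⊗ ⋯ ⊗ f(a_r)` over all ways to cut `a`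
into blocks. -/
def restrict (f : AInfHom A B) (ψ : B.Family) (a : List (Letter A.gr)) (y : B)
    (c : List (Letter A.gr)) : Module.Dual k B :=
  sumBlocks a fun L => sumBlocks c fun R =>
    ψ.ev (L.map fun b => evalWord f.f (vals b)) y (R.map fun b => evalWord f.f (vals b))

/-- The composite `ψ ∘ f̃ : A → B*` of maps of `A`-bimodules. -/
def compTilde (f : AInfHom A B) (ψ : B.Family) (a : List (Letter A.gr)) (v : A)
    (c : List (Letter A.gr)) : Module.Dual k B :=
  sumSplit a fun a₁ a₂ => sumSplit c fun c₁ c₂ => f.restrict ψ a₁ (f.tilde a₂ v c₁) c₂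

/-- The dual `f̃* : B* → A*` of `f̃`: for `ξ ∈ B*` of degree `r`,
`f̃*(a, ξ, c)(x) = (-1)^{|a|'(r + |c|' + |x|')} ξ(f̃(c, x, a))`. -/
def tildeDual (f : AInfHom A B) (r : ℤ) (a : List (Letter A.gr)) (ξ : Module.Dual k B)
    (c : List (Letter A.gr)) (x : Letter A.gr) : k :=
  ksign (wdeg a * (r + wdeg c + sdeg x)) • ξ (f.tilde c x.val a)

/-- The composite `f̃* ∘ ψ ∘ f̃ : A → A*` of maps of `A`-bimodules, for `ψ` of degree `e`,
evaluated on `(a, v, c)` and then on `x`. -/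
def pullback (f : AInfHom A B) (e : ℤ) (ψ : B.Family) (a : List (Letter A.gr))
    (v : Letter A.gr) (c : List (Letter A.gr)) (x : Letter A.gr) : k :=
  sumSplit a fun a₁ a₂ => sumSplit c fun c₁ c₂ =>
    ksign (e * wdeg a₁) •
      f.tildeDual (e + wdeg a₂ + sdeg v + wdeg c₁) a₁ (f.compTilde ψ a₂ v.val c₁) c₂ x

/-- The diagram `φ = f̃* ∘ ψ ∘ f̃` commutes (both sides are multilinear, so that it suffices to
compare them on homogeneous elements). -/
def DiagramCommutes (f : AInfHom A B) (e : ℤ) (φ : A.Family) (ψ : B.Family) : Prop :=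
  ∀ (a : List (Letter A.gr)) (v : Letter A.gr) (c : List (Letter A.gr)) (x : Letter A.gr),
    φ.ev (vals a) v.val (vals c) x.val = f.pullback e ψ a v c x

end AInfHom

/-- Strong homotopy inner products in the old sense: `φ = f̃* ∘ ψ ∘ f̃` for an
A∞-quasi-isomorphism `f : A → B` to an A∞-algebra with a cyclic inner product `ψ`. -/
def AInfAlgebra.DualBimoduleMap.IsOldStrongHomotopyInnerProduct {k : Type uk} [Field k]
    {A : AInfAlgebra.{uk, u} k} {e : ℤ} (φ : A.DualBimoduleMap e) : Prop :=
  ∃ (B : AInfAlgebra.{uk, u} k) (ψ : B.CyclicInnerProduct e) (f : AInfHom A B),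
    f.IsQuasiIso ∧ f.DiagramCommutes e φ.family ψ.family

/-! ## Sums over decompositions of words -/

/-! The proof is noncommutative symplectic geometry in dual form. Words of letters play the role of
monomials, an A∞-structure `m` is an odd vector field of square zero (`insOp`), an A∞-morphism is a
change of variables (`hat`), and a family `φ_{p,q}` evaluated on a last argument is a two-form. In
this language skew symmetry and closedness say that `φ` is a closed two-form, the bimodule equation
says that its Lie derivative along `m` vanishes, `f̃* ∘ ψ ∘ f̃` is a pullback, and a cyclic inner
product is a constant nondegenerate invariant two-form.

The main tool is the Poincaré lemma `dForm_potential`: averaging over positions, which divides by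
word lengths and so uses characteristic zero, writes a closed two-form as the differential of a
one-form. Pullback and Lie derivative commute with the differential (`pullForm₂_dForm`,
`lieForm₂_dForm`) and, along a morphism, with each other (`lieForm_pullForm`); hence pullbacks of
closed forms are closed and pullbacks of invariant closed forms are invariant.

Statement 2: a constant form is closed, hence so is its pullback. For nondegeneracy on cohomology, a
homogeneous cocycle orthogonal to all cocycles of complementary degree is exact
(`mem_range_d_of_orthogonal`), and a quasi-isomorphism carries this back to `A`.

The converses are Darboux theorems. If a pullback of a closed form agrees with a closed target on
words of length up to `n`, the difference is exact; the constant nondegenerate part turns its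
potential into a vector field, which corrects the change of variables at the next length
(`exists_darboux_correction`). For chain-level nondegenerate `φ` this yields a formal diffeomorphism
of `A` that makes `φ` constant, and the A∞-structure is transported along it. For statement 1 the
correction is interleaved with the inductive construction of a minimal model on the cohomology
(`Retract.exists_model`): there `φ_{0,0}` is nondegenerate by finite dimension, and the corrections
take values in the chosen cocycle representatives, exactly the freedom that the minimal model
construction leaves. In all cases invariance of the resulting constant form is cyclicity
(`cyclic_of_lieForm₂_eq_zero`). -/

section Sums

variable {α β N P : Type*} [AddCommMonoid N] [AddCommMonoid P]

theorem sumSplit_nil (F : List α → List α → N) : sumSplit [] F = F [] [] := by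
  simp [sumSplit]

theorem sumSplit_cons (x : α) (l : List α) (F : List α → List α → N) :
    sumSplit (x :: l) F = F [] (x :: l) + sumSplit l fun a b => F (x :: a) b := by
  rw [sumSplit, List.length_cons, Finset.sum_range_succ', add_comm]
  simp [sumSplit]

theorem sumSplit_congr {l : List α} {F G : List α → List α → N}
    (h : ∀ a b, a ++ b = l → F a b = G a b) : sumSplit l F = sumSplit l G :=
  Finset.sum_congr rfl fun _ _ => h _ _ (List.take_append_drop _ _)

theorem sumSplit_eq_zero {l : List α} {F : List α → List α → N}
    (h : ∀ a b, a ++ b = l → F a b = 0) : sumSplit l F = 0 :=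
  Finset.sum_eq_zero fun _ _ => h _ _ (List.take_append_drop _ _)

theorem sumSplit_zero (l : List α) : sumSplit l (fun _ _ => (0 : N)) = 0 :=
  sumSplit_eq_zero fun _ _ _ => rfl

theorem sumSplit_add (l : List α) (F G : List α → List α → N) :
    sumSplit l (fun a b => F a b + G a b) = sumSplit l F + sumSplit l G :=
  Finset.sum_add_distrib

theorem map_sumSplit {M : Type*} [FunLike M N P] [AddMonoidHomClass M N P] (φ : M) (l : List α)
    (F : List α → List α → N) : φ (sumSplit l F) = sumSplit l fun a b => φ (F a b) :=
  map_sum φ _ _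

theorem smul_sumSplit {R : Type*} [DistribSMul R N] (r : R) (l : List α)
    (F : List α → List α → N) : r • sumSplit l F = sumSplit l fun a b => r • F a b :=
  Finset.smul_sum

/-- The cut falls before or after `x`. Multilinearity proofs and cyclic computations below sort
their terms by the position of a distinguished letter in this way. -/
theorem sumSplit_append_cons (u : List α) (x : α) (v : List α) (F : List α → List α → N) :
    sumSplit (u ++ x :: v) F =
      (sumSplit u fun a b => F a (b ++ x :: v)) + sumSplit v fun a b => F (u ++ x :: a) b := by
  induction u generalizing F with
  | nil => simp [sumSplit_nil, sumSplit_cons]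
  | cons y u ih => simp [sumSplit_cons, ih, add_assoc]

theorem sumSplit_comm (l : List α) (l' : List β) (F : List α → List α → List β → List β → N) :
    (sumSplit l fun a b => sumSplit l' fun c d => F a b c d) =
      sumSplit l' fun c d => sumSplit l fun a b => F a b c d :=
  Finset.sum_comm

theorem sumSplit_assoc (l : List α) (F : List α → List α → List α → N) :
    (sumSplit l fun a l' => sumSplit l' fun b c => F a b c) =
      sumSplit l fun l' c => sumSplit l' fun a b => F a b c := by
  induction l generalizing F with
  | nil => simp [sumSplit_nil]
  | cons x l ih =>
    simp only [sumSplit_cons, ih, sumSplit_add, sumSplit_nil, add_assoc]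

theorem sumSplit_ite_left (l : List α) (F : List α → List α → N) [∀ a : List α, Decidable (a = [])] :
    (sumSplit l fun a b => if a = [] then F a b else 0) = F [] l := by
  cases l <;> simp [sumSplit_nil, sumSplit_cons, sumSplit_zero]

theorem sumSplit_ite_right (l : List α) (F : List α → List α → N)
    [∀ a : List α, Decidable (a = [])] :
    (sumSplit l fun a b => if b = [] then F a b else 0) = F l [] := by
  induction l generalizing F with
  | nil => simp [sumSplit_nil]
  | cons x l ih => simp [sumSplit_cons, ih]

theorem sumSplit₃_congr {l : List α} {F G : List α → List α → List α → N}
    (h : ∀ a b c, a ++ (b ++ c) = l → F a b c = G a b c) : sumSplit₃ l F = sumSplit₃ l G :=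
  sumSplit_congr fun _ _ h₁ => sumSplit_congr fun _ _ h₂ => h _ _ _ (by rw [h₂, h₁])

theorem sumSplit₃_eq_zero {l : List α} {F : List α → List α → List α → N}
    (h : ∀ a b c, a ++ (b ++ c) = l → F a b c = 0) : sumSplit₃ l F = 0 :=
  sumSplit_eq_zero fun _ _ h₁ => sumSplit_eq_zero fun _ _ h₂ => h _ _ _ (by rw [h₂, h₁])

theorem sumSplit₃_add (l : List α) (F G : List α → List α → List α → N) :
    sumSplit₃ l (fun a b c => F a b c + G a b c) = sumSplit₃ l F + sumSplit₃ l G := by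
  simp only [sumSplit₃, sumSplit_add]

theorem map_sumSplit₃ {M : Type*} [FunLike M N P] [AddMonoidHomClass M N P] (φ : M) (l : List α)
    (F : List α → List α → List α → N) :
    φ (sumSplit₃ l F) = sumSplit₃ l fun a b c => φ (F a b c) := by
  simp only [sumSplit₃, map_sumSplit]

theorem smul_sumSplit₃ {R : Type*} [DistribSMul R N] (r : R) (l : List α)
    (F : List α → List α → List α → N) :
    r • sumSplit₃ l F = sumSplit₃ l fun a b c => r • F a b c := by
  simp only [sumSplit₃, smul_sumSplit]

theorem sumSplit₃_append_cons (u : List α) (x : α) (v : List α)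
    (F : List α → List α → List α → N) :
    sumSplit₃ (u ++ x :: v) F =
      (sumSplit₃ u fun a b c => F a b (c ++ x :: v)) +
      (sumSplit u fun a b => sumSplit v fun c d => F a (b ++ x :: c) d) +
      sumSplit₃ v fun a b c => F (u ++ x :: a) b c := by
  simp only [sumSplit₃, sumSplit_append_cons, sumSplit_add]

/-- Two ways to cut a word into five pieces. -/
theorem sumSplit₃_sumSplit (l : List α) (F : List α → List α → List α → List α → List α → N) :
    (sumSplit₃ l fun a b c => sumSplit a fun a₁ a₂ => sumSplit c fun c₁ c₂ => F a₁ a₂ b c₁ c₂) =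
      sumSplit₃ l fun a₁ u c₂ => sumSplit₃ u fun a₂ b c₁ => F a₁ a₂ b c₁ c₂ := by
  calc _ = sumSplit l fun a l' => sumSplit a fun a₁ a₂ => sumSplit l' fun b c =>
        sumSplit c fun c₁ c₂ => F a₁ a₂ b c₁ c₂ :=
        sumSplit_congr fun a l' _ => sumSplit_comm l' a _
    _ = sumSplit l fun a₁ l'' => sumSplit l'' fun a₂ l' => sumSplit l' fun b c =>
        sumSplit c fun c₁ c₂ => F a₁ a₂ b c₁ c₂ :=
        (sumSplit_assoc l fun a₁ a₂ l' => _).symm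
    _ = _ := sumSplit_congr fun a₁ l'' _ => by
        refine Eq.trans ?_ (sumSplit_assoc l'' fun a₂ u' c₂ =>
          sumSplit u' fun b c₁ => F a₁ a₂ b c₁ c₂)
        exact sumSplit_congr fun a₂ l' _ => sumSplit_assoc l' _

/-- Both sides choose two disjoint subwords, one starting with the right-hand subword and the other
with the left-hand one. This exchange is behind the cancellation of disjoint insertions. -/
theorem sumSplit₃_sumSplit₃ (l : List α)
    (F : List α → List α → List α → List α → List α → N) :
    (sumSplit₃ l fun a b c => sumSplit₃ a fun a₁ a₂ a₃ => F a₁ a₂ a₃ b c) =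
      sumSplit₃ l fun a₁ a₂ c' => sumSplit₃ c' fun a₃ b c => F a₁ a₂ a₃ b c := by
  calc _ = sumSplit l fun a l' => sumSplit a fun a₁ u => sumSplit u fun a₂ a₃ =>
        sumSplit l' fun b c => F a₁ a₂ a₃ b c :=
        sumSplit_congr fun a l' _ => (sumSplit_comm l' a _).trans
          (sumSplit_congr fun a₁ u _ => sumSplit_comm l' u _)
    _ = sumSplit l fun a₁ l'' => sumSplit l'' fun u l' => sumSplit u fun a₂ a₃ =>
        sumSplit l' fun b c => F a₁ a₂ a₃ b c :=
        (sumSplit_assoc l fun a₁ u l' => _).symm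
    _ = _ := sumSplit_congr fun a₁ l'' _ =>
        (sumSplit_assoc l'' fun a₂ a₃ l' => sumSplit l' fun b c => F a₁ a₂ a₃ b c).symm

theorem sumBlocks_nil (F : List (List α) → N) : sumBlocks [] F = F [] := by
  unfold sumBlocks
  have h0 (c : Composition ([] : List α).length) : c.blocks = [] := by
    rcases h : c.blocks with _ | ⟨b, bs⟩
    · rfl
    · have h1 := c.blocks_sum
      have h2 : 0 < b := c.blocks_pos (by simp [h])
      simp only [h, List.sum_cons, List.length_nil] at h1
      omega
  have : Subsingleton (Composition ([] : List α).length) :=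
    ⟨fun c c' => Composition.ext ((h0 c).trans (h0 c').symm)⟩
  rw [Fintype.sum_subsingleton _ ⟨[], by simp, rfl⟩]
  rfl

/-- The first block is `x` followed by a prefix of `w`; peeling it off replaces compositions by a
recursion on words. -/
theorem sumBlocks_cons (x : α) (w : List α) (F : List (List α) → N) :
    sumBlocks (x :: w) F = sumSplit w fun a b => sumBlocks b fun L => F ((x :: a) :: L) := by
  unfold sumBlocks sumSplit
  rw [Finset.sum_sigma']
  symm
  refine Finset.sum_bij (fun p hp => ⟨(p.1 + 1) :: p.2.blocks, ?_, ?_⟩) ?_ ?_ ?_ ?_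
  · intro i hi
    rcases List.mem_cons.1 hi with rfl | hi
    · exact Nat.succ_pos _
    · exact p.2.blocks_pos hi
  · have h := p.2.blocks_sum
    have h' : p.1 < w.length + 1 := by simpa using hp
    simp only [List.length_drop] at h
    simp only [List.sum_cons, List.length_cons]
    omega
  · simp
  · rintro ⟨i, c⟩ hi ⟨j, c'⟩ hj h
    simp only [Composition.mk.injEq, List.cons.injEq, add_left_inj] at h
    obtain ⟨rfl, h⟩ := h
    rw [Composition.ext h]
  · intro c _
    rcases hc : c.blocks with _ | ⟨b, bs⟩
    · have := c.blocks_sum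
      simp [hc] at this
    · have hs := c.blocks_sum
      have hb : 0 < b := c.blocks_pos (by simp [hc])
      obtain ⟨i, rfl⟩ : ∃ i, b = i + 1 := ⟨b - 1, by omega⟩
      simp only [hc, List.sum_cons, List.length_cons] at hs
      refine ⟨⟨i, ⟨bs, fun {j} hj => c.blocks_pos (by simp [hc, hj]), ?_⟩⟩, ?_, ?_⟩
      · simp only [List.length_drop]
        omega
      · simp only [Finset.mem_sigma, Finset.mem_range, Finset.mem_univ, and_true]
        omega
      · ext1
        simp [hc]
  · rintro ⟨i, c⟩ hi
    simp [List.splitWrtComposition, List.splitWrtCompositionAux_cons]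

theorem sumBlocks_congr {l : List α} {F G : List (List α) → N}
    (h : ∀ L : List (List α), L.flatten = l → (∀ b ∈ L, b ≠ []) → F L = G L) :
    sumBlocks l F = sumBlocks l G :=
  Finset.sum_congr rfl fun c _ => h _ (l.flatten_splitWrtComposition c) fun _ hb h0 => by
    have := List.length_pos_of_mem_splitWrtComposition hb
    simp [h0] at this

/-- Sum of `F [f b₁, …, f b_r]` over all ways to cut a word into nonempty blocks `b₁, …, b_r`. -/
def hat (f : List α → β) (F : List β → N) (w : List α) : N :=
  sumBlocks w fun L => F (L.map f)

variable (f : List α → β)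

theorem hat_nil (F : List β → N) : hat f F [] = F [] := sumBlocks_nil _

theorem hat_cons (F : List β → N) (x : α) (w : List α) :
    hat f F (x :: w) = sumSplit w fun a b => hat f (fun l => F (f (x :: a) :: l)) b :=
  sumBlocks_cons _ _ _

theorem hat_congr {F G : List β → N} {w : List α}
    (h : ∀ L : List (List α), L.flatten = w → (∀ b ∈ L, b ≠ []) → F (L.map f) = G (L.map f)) :
    hat f F w = hat f G w :=
  sumBlocks_congr h

theorem hat_zero (w : List α) : hat f (fun _ => (0 : N)) w = 0 := by simp [hat, sumBlocks]

theorem hat_add (F G : List β → N) (w : List α) :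
    hat f (fun l => F l + G l) w = hat f F w + hat f G w := by
  simp [hat, sumBlocks, Finset.sum_add_distrib]

theorem map_hat {M : Type*} [FunLike M N P] [AddMonoidHomClass M N P] (φ : M)
    (F : List β → N) (w : List α) : φ (hat f F w) = hat f (fun l => φ (F l)) w := by
  unfold hat sumBlocks
  exact map_sum φ _ _

theorem smul_hat {R : Type*} [DistribSMul R N] (r : R) (F : List β → N) (w : List α) :
    r • hat f F w = hat f (fun l => r • F l) w := by
  unfold hat sumBlocks
  exact Finset.smul_sum

theorem hat_sumSplit {γ : Type*} (F : List β → List γ → List γ → N) (w : List α) (l : List γ) :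
    hat f (fun u => sumSplit l fun a b => F u a b) w =
      sumSplit l fun a b => hat f (fun u => F u a b) w := by
  unfold hat sumBlocks sumSplit
  exact Finset.sum_comm

theorem hat_hat_comm {γ δ : Type*} (g : List γ → δ) (F : List β → List δ → N) (w : List α)
    (w' : List γ) :
    hat f (fun u => hat g (fun u' => F u u') w') w =
      hat g (fun u' => hat f (fun u => F u u') w) w' := by
  unfold hat sumBlocks
  exact Finset.sum_comm

/-- A cut of the image word comes from a cut of `w` between two blocks: substitution is a coalgebra
map for deconcatenation. -/
theorem hat_split (F : List β → List β → N) (w : List α) :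
    hat f (fun l => sumSplit l F) w =
      sumSplit w fun a b => hat f (fun l => hat f (fun l' => F l l') b) a := by
  induction h : w.length using Nat.strong_induction_on generalizing w F with
  | _ n ih =>
  rcases w with _ | ⟨x, w⟩
  · simp only [hat_nil, sumSplit_nil]
  · subst h
    simp only [hat_cons, sumSplit_cons, hat_add, hat_nil, sumSplit_add]
    congr 1
    refine Eq.trans (sumSplit_congr fun a b hab => ih b.length ?_ _ b rfl) ?_
    · simp [← hab]
    · exact sumSplit_assoc w _

/-- Exactly one block contains `y`; it takes a suffix of `a` and a prefix of `c`, and what remains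
on either side is cut independently. -/
theorem hat_append_cons (F : List β → N) (a : List α) (y : α) (c : List α) :
    hat f F (a ++ y :: c) = sumSplit a fun a₁ a₂ => sumSplit c fun c₁ c₂ =>
      hat f (fun l => hat f (fun l' => F (l ++ f (a₂ ++ y :: c₁) :: l')) c₂) a₁ := by
  induction h : a.length using Nat.strong_induction_on generalizing a F with
  | _ n ih =>
  rcases a with _ | ⟨x, a⟩
  · simp [hat_nil, sumSplit_nil, hat_cons]
  · subst h
    simp only [List.cons_append, hat_cons, sumSplit_cons, hat_nil, sumSplit_append_cons,
      List.nil_append]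
    rw [add_comm]
    congr 1
    refine Eq.trans (sumSplit_congr fun u v huv => ih v.length ?_ _ v rfl) ?_
    · simp [← huv]
    · simp only [← hat_sumSplit, sumSplit_assoc]
      simp only [sumSplit_comm (l' := c), hat_sumSplit]

end Sums

/-! ## Noncommutative one- and two-forms on words -/

section Forms

variable {X Y N : Type*} [AddCommGroup N]

theorem ksign_smul_smul (p q : ℤ) (x : N) : ksign p • ksign q • x = ksign (p + q) • x := by
  rw [smul_smul, show ksign (p + q) = ksign p * ksign q from Int.negOnePow_add p q]

/-- Only the parity of the exponent matters. Cast to `ZMod 2`, every comparison of Koszul signs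
becomes a polynomial identity over a two-element ring, which `decide` settles once the degrees are
generalized. -/
theorem ksign_smul_congr {p q : ℤ} (h : (p : ZMod 2) = q) (x : N) : ksign p • x = ksign q • x := by
  have : Even (p - q) := by
    rw [← ZMod.intCast_eq_zero_iff_even]
    push_cast
    rw [h, sub_self]
  rw [show ksign p = ksign q from (Int.negOnePow_eq_iff p q).2 this]

theorem neg_ksign_smul (p : ℤ) (x : N) : -(ksign p • x) = ksign (p + 1) • x := by
  rw [show ksign (p + 1) = -ksign p from Int.negOnePow_succ p, Units.neg_smul]

/-- The total degree of a word. -/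
def wd (d : X → ℤ) (w : List X) : ℤ := (w.map d).sum

variable (d : X → ℤ)

@[simp] theorem wd_nil : wd d [] = 0 := rfl

@[simp] theorem wd_cons (x : X) (w : List X) : wd d (x :: w) = d x + wd d w := by simp [wd]

@[simp] theorem wd_append (a b : List X) : wd d (a ++ b) = wd d a + wd d b := by simp [wd]

theorem wd_map_blocks {dy : Y → ℤ} {f : List X → Y} (hf : ∀ w, dy (f w) = wd d w)
    (L : List (List X)) : wd dy (L.map f) = wd d L.flatten := by
  induction L with
  | nil => rfl
  | cons b L ih => simp [ih, hf]

/-- The coderivation `∑ (-1)^{|a|} F(a, m(b), c)` in dual form. -/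
def insOp (m : List X → X) (F : List X → N) (w : List X) : N :=
  sumSplit₃ w fun a b c => ksign (wd d a) • F (a ++ m b :: c)

/-- A morphism relation for single outputs propagates to whole words: cutting an image word cuts `w`
(`hat_split`), and an inserted `m b` ends up inside one block (`hat_append_cons`), so both sides
become sums over the subword that feeds that place. The error term `D` is kept because the
obstruction argument for minimal models applies this to a relation known only on shorter words. -/
theorem hat_insOp {dy : Y → ℤ} {f : List X → Y} (hf : ∀ w, dy (f w) = wd d w)
    (m : List X → X) (mY : List Y → Y) (F : List Y → N) (D : List Y → List X → List Y → N)
    (w : List X)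
    (hrel : ∀ a b c, a ++ (b ++ c) = w → ∀ l l', hat f (fun u => F (l ++ mY u :: l')) b =
      insOp d m (fun u => F (l ++ f u :: l')) b + D l b l') :
    hat f (insOp dy mY F) w = insOp d m (hat f F) w +
      sumSplit₃ w fun a b c =>
        ksign (wd d a) • hat f (fun l => hat f (fun l' => D l b l') c) a := by
  have h1 : hat f (insOp dy mY F) w = sumSplit₃ w fun a b c => ksign (wd d a) •
      hat f (fun l => hat f (fun l' => hat f (fun u => F (l ++ mY u :: l')) b) c) a := by
    unfold insOp sumSplit₃
    rw [hat_split]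
    refine sumSplit_congr fun a bc _ => ?_
    simp only [hat_split, hat_sumSplit]
    refine sumSplit_congr fun b c _ => ?_
    rw [smul_hat]
    refine hat_congr _ fun L hL _ => ?_
    rw [wd_map_blocks d hf, hL, hat_hat_comm, smul_hat]
    refine hat_congr _ fun L' _ _ => ?_
    rw [smul_hat]
  have h2 : insOp d m (hat f F) w = sumSplit₃ w fun a b c => ksign (wd d a) •
      hat f (fun l => hat f (fun l' => insOp d m (fun u => F (l ++ f u :: l')) b) c) a := by
    simp only [insOp, hat_append_cons, smul_sumSplit]
    refine Eq.trans ?_ ((sumSplit₃_sumSplit w fun a₁ a₂ b c₁ c₂ => ksign (wd d a₁ + wd d a₂) •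
      hat f (fun l => hat f (fun l' => F (l ++ f (a₂ ++ m b :: c₁) :: l')) c₂) a₁).trans ?_)
    · refine sumSplit₃_congr fun a b c _ => sumSplit_congr fun a₁ a₂ h => ?_
      rw [← h, wd_append]
    · refine sumSplit₃_congr fun a b c _ => ?_
      simp only [sumSplit₃, hat_sumSplit, smul_sumSplit, smul_hat, ksign_smul_smul]
  rw [h1, h2, ← sumSplit₃_add]
  refine sumSplit₃_congr fun a b c h => ?_
  simp only [hrel a b c h, hat_add, smul_add]

/-- Two insertions are either disjoint or nested. As `m` is odd, the disjoint ones cancel in pairs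
(`h1`); the nested ones assemble to `m ∘ m` on a subword (`h4`). -/
theorem insOp_insOp {m : List X → X} (hm : ∀ w, d (m w) = wd d w + 1) (F : List X → N)
    (w : List X) : insOp d m (insOp d m F) w =
      sumSplit₃ w fun a b c => insOp d m (fun u => F (a ++ m u :: c)) b := by
  have h1 : (sumSplit₃ w fun a b c => ksign (wd d a) • sumSplit₃ a fun p q r =>
      ksign (wd d p) • F (p ++ m q :: (r ++ m b :: c))) + 
      (sumSplit₃ w fun a b c => ksign (wd d a) • sumSplit₃ c fun p q r =>
      ksign (wd d (a ++ m b :: p)) • F (a ++ m b :: p ++ m q :: r)) = 0 := by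
    have h2 := sumSplit₃_sumSplit₃ w fun p q r b c => ksign (wd d q + wd d r) •
      F (p ++ m q :: (r ++ m b :: c))
    have h3 : (sumSplit₃ w fun a b c => ksign (wd d a) • sumSplit₃ a fun p q r =>
        ksign (wd d p) • F (p ++ m q :: (r ++ m b :: c))) = sumSplit₃ w fun a b c =>
        sumSplit₃ a fun p q r => ksign (wd d q + wd d r) • F (p ++ m q :: (r ++ m b :: c)) := by
      refine sumSplit₃_congr fun a b c _ => ?_
      rw [smul_sumSplit₃]
      refine sumSplit₃_congr fun p q r h => ?_
      rw [ksign_smul_smul, ← h]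
      simp only [wd_append]
      refine ksign_smul_congr ?_ _
      push_cast
      generalize (wd d p : ZMod 2) = A
      generalize (wd d q : ZMod 2) = B
      generalize (wd d r : ZMod 2) = C
      decide +revert
    rw [h3, h2, ← sumSplit₃_add]
    refine sumSplit₃_eq_zero fun a b c _ => ?_
    rw [smul_sumSplit₃, ← sumSplit₃_add]
    refine sumSplit₃_eq_zero fun p q r _ => ?_
    rw [ksign_smul_smul, add_eq_zero_iff_eq_neg, neg_ksign_smul, List.append_assoc,
      List.cons_append]
    simp only [wd_append, wd_cons, hm]
    refine ksign_smul_congr ?_ _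
    push_cast
    generalize (wd d a : ZMod 2) = A
    generalize (wd d b : ZMod 2) = B
    generalize (wd d p : ZMod 2) = C
    decide +revert
  have h4 : (sumSplit₃ w fun a b c => ksign (wd d a) • sumSplit a fun p q => sumSplit c fun r s =>
      ksign (wd d p) • F (p ++ m (q ++ m b :: r) :: s)) =
      sumSplit₃ w fun a b c => insOp d m (fun u => F (a ++ m u :: c)) b := by
    refine Eq.trans ?_ (sumSplit₃_sumSplit w fun a₁ a₂ b c₁ c₂ => ksign (wd d a₂) •
      F (a₁ ++ m (a₂ ++ m b :: c₁) :: c₂))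
    refine sumSplit₃_congr fun a b c _ => ?_
    rw [smul_sumSplit]
    refine sumSplit_congr fun p q h => ?_
    rw [smul_sumSplit]
    refine sumSplit_congr fun r s _ => ?_
    rw [ksign_smul_smul, ← h]
    simp only [wd_append]
    refine ksign_smul_congr ?_ _
    push_cast
    generalize (wd d p : ZMod 2) = A
    generalize (wd d q : ZMod 2) = B
    decide +revert
  unfold insOp at h4 ⊢
  simp only [sumSplit₃_append_cons, smul_add, sumSplit₃_add]
  rw [h4, add_right_comm, h1, zero_add]

/-- The differential of a one-form: the two-form `(a, v, c, x) ↦ G(a, v, c; x) ∓ G(c, x, a; v)`. -/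
def dForm (G : List X → X → N) (a : List X) (v : X) (c : List X) (x : X) : N :=
  G (a ++ v :: c) x - ksign ((wd d a + d v) * (wd d c + d x)) • G (c ++ x :: a) v

/-- The pullback of a one-form along a sequence of maps. -/
def pullForm (f : List X → Y) (G : List Y → Y → N) (w : List X) (x : X) : N :=
  sumSplit₃ w fun a b c => ksign (wd d a * (wd d b + wd d c + d x)) •
    hat f (fun l => G l (f (c ++ x :: a))) b

/-- The pullback of a two-form along a sequence of maps. -/
def pullForm₂ (f : List X → Y) (Ω : List Y → Y → List Y → Y → N)
    (a : List X) (v : X) (c : List X) (x : X) : N :=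
  sumSplit₃ a fun a₁ a₂ a₃ => sumSplit₃ c fun c₁ c₂ c₃ =>
    ksign (wd d a₁ * (wd d a₂ + wd d a₃ + d v + wd d c + d x)) •
      hat f (fun l => hat f (fun l' => Ω l (f (a₃ ++ v :: c₁)) l' (f (c₃ ++ x :: a₁))) c₂) a₂

/-- The Lie derivative of a one-form along `m`. -/
def lieForm (m : List X → X) (G : List X → X → N) (w : List X) (x : X) : N :=
  sumSplit₃ w fun a b c => ksign (wd d a) • G (a ++ m b :: c) x +
    ksign (wd d b + wd d a * (wd d b + wd d c + d x)) • G b (m (c ++ x :: a))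

/-- The Lie derivative of a two-form along `m`. -/
def lieForm₂ (m : List X → X) (Ω : List X → X → List X → X → N)
    (a : List X) (v : X) (c : List X) (x : X) : N :=
  (sumSplit a fun a₁ a₂ => sumSplit c fun c₁ c₂ =>
      ksign (wd d a₁) • Ω a₁ (m (a₂ ++ v :: c₁)) c₂ x) +
    (sumSplit₃ a fun a₁ a₂ a₃ => ksign (wd d a₁) • Ω (a₁ ++ m a₂ :: a₃) v c x) +
    (sumSplit₃ c fun c₁ c₂ c₃ =>
      ksign (wd d a + d v + wd d c₁) • Ω a v (c₁ ++ m c₂ :: c₃) x) +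
    sumSplit a fun a₁ a₂ => sumSplit c fun c₁ c₂ =>
      ksign (wd d a₂ + d v + wd d c₁ + wd d a₁ * (wd d a₂ + d v + wd d c + d x)) •
        Ω a₂ v c₁ (m (c₂ ++ x :: a₁))

/-- The pullback of one-forms commutes with the Lie derivative. -/
theorem lieForm_pullForm {dy : Y → ℤ} {f : List X → Y} (hf : ∀ w, dy (f w) = wd d w)
    {m : List X → X} (hm : ∀ w, d (m w) = wd d w + 1) (mY : List Y → Y) (G : List Y → Y → N)
    (h₁ : ∀ w l l' y, hat f (fun u => G (l ++ mY u :: l') y) w =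
      insOp d m (fun u => G (l ++ f u :: l') y) w)
    (h₂ : ∀ w l, hat f (fun u => G l (mY u)) w = insOp d m (fun u => G l (f u)) w)
    (w : List X) (x : X) :
    pullForm d f (lieForm dy mY G) w x = lieForm d m (pullForm d f G) w x := by
  -- Insertions among the unmarked blocks, moved through `f` by the morphism relation.
  have e1 : (sumSplit₃ w fun a b c => ksign (wd d a * (wd d b + wd d c + d x)) •
      hat f (fun l => sumSplit₃ l fun l₁ l₂ l₃ =>
        ksign (wd dy l₁) • G (l₁ ++ mY l₂ :: l₃) (f (c ++ x :: a))) b) =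
      sumSplit₃ w fun a b c => ksign (wd d a * (wd d b + wd d c + d x)) •
        sumSplit₃ b fun p q r => ksign (wd d p) •
          hat f (fun l => G l (f (c ++ x :: a))) (p ++ m q :: r) := by
    refine sumSplit₃_congr fun a b c _ => ?_
    congr 1
    refine (hat_insOp d hf m mY (fun l => G l (f (c ++ x :: a))) (fun _ _ _ => 0) b
      fun _ _ _ _ l l' => by rw [h₁, add_zero]).trans ?_
    simp only [hat_zero, smul_zero]
    rw [sumSplit₃_eq_zero (F := fun _ _ _ => (0 : N)) fun _ _ _ _ => rfl, add_zero]
    rfl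
  -- Here the outer operation contains the marked block. Its inputs are the images of the pieces of
  -- the cyclic word around `x`, so `h₂` turns it into an insertion into `c ++ x :: a` followed by
  -- `f`.
  have e2 : (sumSplit₃ w fun a b c => ksign (wd d a * (wd d b + wd d c + d x)) •
      hat f (fun l => sumSplit₃ l fun l₁ l₂ l₃ =>
        ksign (wd dy l₂ + wd dy l₁ * (wd dy l₂ + wd dy l₃ + dy (f (c ++ x :: a)))) •
          G l₂ (mY (l₃ ++ f (c ++ x :: a) :: l₁))) b) =
      sumSplit₃ w fun a b c => ksign (wd d b + wd d a * (wd d b + wd d c + d x)) •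
        hat f (fun l => insOp d m (fun u => G l (f u)) (c ++ x :: a)) b := by
    have : ∀ a b c, hat f (fun l => insOp d m (fun u => G l (f u)) (c ++ x :: a)) b =
        sumSplit a fun a₁ a₂ => sumSplit c fun c₁ c₂ => 
          hat f (fun l₁ => hat f (fun l₂ => hat f (fun l₃ =>
            G l₂ (mY (l₃ ++ f (c₂ ++ x :: a₁) :: l₁))) c₁) b) a₂ := by
      intro a b c
      simp only [← h₂]
      simp only [hat_append_cons, hat_sumSplit]
      rw [sumSplit_comm]
      refine sumSplit_congr fun a₁ a₂ _ => sumSplit_congr fun c₁ c₂ _ => ?_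
      rw [hat_hat_comm f f _ a₂ b]
      refine hat_congr _ fun L _ _ => ?_
      rw [hat_hat_comm]
    simp only [this, smul_sumSplit]
    refine Eq.trans ?_ (sumSplit₃_sumSplit w fun a₁ a₂ b c₁ c₂ => 
      ksign (wd d b + (wd d a₁ + wd d a₂) * (wd d b + (wd d c₁ + wd d c₂) + d x)) •
          hat f (fun l₁ => hat f (fun l₂ => hat f (fun l₃ =>
            G l₂ (mY (l₃ ++ f (c₂ ++ x :: a₁) :: l₁))) c₁) b) a₂).symm |>.trans ?_
    · refine sumSplit₃_congr fun a b c _ => ?_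
      simp only [sumSplit₃, hat_split, hat_sumSplit, smul_sumSplit]
      refine sumSplit_congr fun b₁ b' h' => sumSplit_congr fun b₂ b₃ h => ?_
      rw [smul_hat, smul_hat]
      refine hat_congr _ fun L₁ hL₁ _ => ?_
      rw [smul_hat, smul_hat]
      refine hat_congr _ fun L₂ hL₂ _ => ?_
      rw [smul_hat, smul_hat]
      refine hat_congr _ fun L₃ hL₃ _ => ?_
      rw [wd_map_blocks d hf, wd_map_blocks d hf, wd_map_blocks d hf, hL₁, hL₂, hL₃, hf,
        ksign_smul_smul, ← h', ← h]
      simp only [wd_append, wd_cons]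
      refine ksign_smul_congr ?_ _
      push_cast
      generalize (wd d a : ZMod 2) = A
      generalize (wd d b₁ : ZMod 2) = B
      generalize (wd d b₂ : ZMod 2) = C
      generalize (wd d b₃ : ZMod 2) = D
      generalize (wd d c : ZMod 2) = E
      generalize (d x : ZMod 2) = F
      decide +revert
    · refine sumSplit₃_congr fun a b c _ => ?_
      refine sumSplit_congr fun a₁ a₂ h => sumSplit_congr fun c₁ c₂ h' => ?_
      rw [← h, ← h', wd_append, wd_append]
  have e3 : pullForm d f (lieForm dy mY G) w x = 
      (sumSplit₃ w fun a b c => ksign (wd d a * (wd d b + wd d c + d x)) •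
        sumSplit₃ b fun p q r => ksign (wd d p) •
          hat f (fun l => G l (f (c ++ x :: a))) (p ++ m q :: r)) +
      sumSplit₃ w fun a b c => ksign (wd d b + wd d a * (wd d b + wd d c + d x)) •
        hat f (fun l => insOp d m (fun u => G l (f u)) (c ++ x :: a)) b := by
    rw [← e1, ← e2, ← sumSplit₃_add]
    simp only [pullForm, lieForm, sumSplit₃_add, hat_add, smul_add]
  -- The insertion into `c ++ x :: a` hits `c` (`r1`), a subword containing `x` (`r2`), or `a`
  -- (`r3`); `r4` treats insertions into the middle word. In the Lie derivative of the pullback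
  -- these are the cases where the inserted letter lies after the middle word, is the marked letter,
  -- lies before the middle word, or lies inside it.
  have r1 : (sumSplit₃ w fun a b c => ksign (wd d b + wd d a * (wd d b + wd d c + d x)) •
        hat f (fun l => sumSplit₃ c fun p q r => ksign (wd d p) •
          G l (f (p ++ m q :: (r ++ x :: a)))) b) =
      sumSplit₃ w fun a b c => ksign (wd d a) • sumSplit₃ a fun p q r =>
        ksign (wd d p * (wd d q + wd d (r ++ m b :: c) + d x)) •
          hat f (fun l => G l (f ((r ++ m b :: c) ++ x :: p))) q := by
    simp only [sumSplit₃, hat_sumSplit, smul_sumSplit]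
    refine Eq.trans ?_ (sumSplit₃_sumSplit₃ w fun a₁ a₂ a₃ b c => ksign (wd d a₂ + wd d a₃ +
      wd d a₁ * (wd d a₂ + wd d a₃ + wd d b + wd d c + d x)) •
        hat f (fun l => G l (f ((a₃ ++ m b :: c) ++ x :: a₁))) a₂).symm |>.trans ?_
    · refine sumSplit₃_congr fun a b c _ => sumSplit₃_congr fun p q r h => ?_
      rw [smul_hat, smul_hat]
      refine hat_congr _ fun L _ _ => ?_
      rw [ksign_smul_smul, ← h, List.append_assoc, List.cons_append]
      simp only [wd_append]
      refine ksign_smul_congr ?_ _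
      push_cast
      generalize (wd d a : ZMod 2) = A
      generalize (wd d b : ZMod 2) = B
      generalize (wd d p : ZMod 2) = C
      generalize (wd d q : ZMod 2) = D
      generalize (wd d r : ZMod 2) = E
      generalize (d x : ZMod 2) = F
      decide +revert
    · refine sumSplit₃_congr fun a b c _ => sumSplit₃_congr fun p q r h => ?_
      rw [ksign_smul_smul, ← h]
      simp only [wd_append, wd_cons, hm]
      refine ksign_smul_congr ?_ _
      push_cast
      generalize (wd d b : ZMod 2) = A
      generalize (wd d c : ZMod 2) = B
      generalize (wd d p : ZMod 2) = C
      generalize (wd d q : ZMod 2) = D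
      generalize (wd d r : ZMod 2) = E
      generalize (d x : ZMod 2) = F
      decide +revert
  have r3 : (sumSplit₃ w fun a b c => ksign (wd d b + wd d a * (wd d b + wd d c + d x)) •
        hat f (fun l => sumSplit₃ a fun p q r => ksign (wd d (c ++ x :: p)) •
          G l (f (c ++ x :: p ++ m q :: r))) b) =
      sumSplit₃ w fun a b c => ksign (wd d a) • sumSplit₃ c fun p q r =>
        ksign (wd d (a ++ m b :: p) * (wd d q + wd d r + d x)) •
          hat f (fun l => G l (f (r ++ x :: (a ++ m b :: p)))) q := by
    simp only [sumSplit₃, hat_sumSplit, smul_sumSplit]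
    refine Eq.trans ?_ (sumSplit₃_sumSplit₃ w fun a b c₁ c₂ c₃ => ksign (wd d a + 
      (wd d a + wd d b + 1 + wd d c₁) * (wd d c₂ + wd d c₃ + d x)) •
        hat f (fun l => G l (f (c₃ ++ x :: (a ++ m b :: c₁)))) c₂) |>.trans ?_
    · refine sumSplit₃_congr fun a b c _ => sumSplit₃_congr fun p q r h => ?_
      rw [smul_hat, smul_hat]
      refine hat_congr _ fun L _ _ => ?_
      rw [ksign_smul_smul, ← h, List.append_assoc, List.cons_append]
      simp only [wd_append, wd_cons]
      refine ksign_smul_congr ?_ _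
      push_cast
      generalize (wd d b : ZMod 2) = A
      generalize (wd d c : ZMod 2) = B
      generalize (wd d p : ZMod 2) = C
      generalize (wd d q : ZMod 2) = D
      generalize (wd d r : ZMod 2) = E
      generalize (d x : ZMod 2) = F
      decide +revert
    · refine sumSplit₃_congr fun a b c _ => sumSplit₃_congr fun p q r h => ?_
      rw [ksign_smul_smul]
      simp only [wd_append, wd_cons, hm]
      refine ksign_smul_congr ?_ _
      push_cast
      generalize (wd d a : ZMod 2) = A
      generalize (wd d b : ZMod 2) = B
      generalize (wd d p : ZMod 2) = C
      generalize (wd d q : ZMod 2) = D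
      generalize (wd d r : ZMod 2) = E
      generalize (d x : ZMod 2) = F
      decide +revert
  have r2 : (sumSplit₃ w fun a b c => ksign (wd d b + wd d a * (wd d b + wd d c + d x)) •
        hat f (fun l => sumSplit c fun c₁ c₂ => sumSplit a fun a₁ a₂ => ksign (wd d c₁) •
          G l (f (c₁ ++ m (c₂ ++ x :: a₁) :: a₂))) b) =
      sumSplit₃ w fun a b c => ksign (wd d b + wd d a * (wd d b + wd d c + d x)) •
        sumSplit₃ b fun p q r => ksign (wd d p * (wd d q + wd d r + d (m (c ++ x :: a)))) •
          hat f (fun l => G l (f (r ++ m (c ++ x :: a) :: p))) q := by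
    simp only [smul_sumSplit₃, hat_sumSplit, smul_sumSplit]
    refine Eq.trans ?_ ((sumSplit₃_sumSplit w fun a₁ a₂ b c₁ c₂ => 
      ksign (wd d b + wd d c₁ + (wd d a₁ + wd d a₂) * (wd d b + (wd d c₁ + wd d c₂) + d x)) •
        hat f (fun l => G l (f (c₁ ++ m (c₂ ++ x :: a₁) :: a₂))) b) |>.trans ?_)
    · refine sumSplit₃_congr fun a b c _ => ?_
      rw [sumSplit_comm]
      refine sumSplit_congr fun a₁ a₂ ha => sumSplit_congr fun c₁ c₂ hc => ?_
      rw [smul_hat, smul_hat]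
      refine hat_congr _ fun L _ _ => ?_
      rw [ksign_smul_smul, ← ha, ← hc]
      simp only [wd_append]
      refine ksign_smul_congr ?_ _
      push_cast
      generalize (wd d a₁ : ZMod 2) = A
      generalize (wd d a₂ : ZMod 2) = B
      generalize (wd d b : ZMod 2) = C
      generalize (wd d c₁ : ZMod 2) = D
      generalize (wd d c₂ : ZMod 2) = E
      generalize (d x : ZMod 2) = F
      decide +revert
    · refine sumSplit₃_congr fun a b c _ => sumSplit₃_congr fun p q r h => ?_
      rw [ksign_smul_smul, ← h]
      simp only [wd_append, wd_cons, hm]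
      refine ksign_smul_congr ?_ _
      push_cast
      generalize (wd d a : ZMod 2) = A
      generalize (wd d c : ZMod 2) = B
      generalize (wd d p : ZMod 2) = C
      generalize (wd d q : ZMod 2) = D
      generalize (wd d r : ZMod 2) = E
      generalize (d x : ZMod 2) = F
      decide +revert
  have r4 : (sumSplit₃ w fun a b c => ksign (wd d a * (wd d b + wd d c + d x)) •
        sumSplit₃ b fun p q r => ksign (wd d p) •
          hat f (fun l => G l (f (c ++ x :: a))) (p ++ m q :: r)) =
      sumSplit₃ w fun a b c => ksign (wd d a) • sumSplit a fun a₁ a₂ => sumSplit c fun c₁ c₂ =>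
        ksign (wd d a₁ * (wd d (a₂ ++ m b :: c₁) + wd d c₂ + d x)) •
          hat f (fun l => G l (f (c₂ ++ x :: a₁))) (a₂ ++ m b :: c₁) := by
    simp only [smul_sumSplit₃, smul_sumSplit]
    refine Eq.trans ?_ ((sumSplit₃_sumSplit w fun a₁ a₂ b c₁ c₂ => 
      ksign (wd d a₂ + wd d a₁ * (wd d a₂ + wd d b + wd d c₁ + wd d c₂ + d x)) •
        hat f (fun l => G l (f (c₂ ++ x :: a₁))) (a₂ ++ m b :: c₁)).symm |>.trans ?_)
    · refine sumSplit₃_congr fun a b c _ => sumSplit₃_congr fun p q r h => ?_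
      rw [ksign_smul_smul, ← h]
      simp only [wd_append]
      refine ksign_smul_congr ?_ _
      push_cast
      generalize (wd d a : ZMod 2) = A
      generalize (wd d c : ZMod 2) = B
      generalize (wd d p : ZMod 2) = C
      generalize (wd d q : ZMod 2) = D
      generalize (wd d r : ZMod 2) = E
      generalize (d x : ZMod 2) = F
      decide +revert
    · refine sumSplit₃_congr fun a b c _ => ?_
      refine sumSplit_congr fun a₁ a₂ ha => sumSplit_congr fun c₁ c₂ hc => ?_
      rw [ksign_smul_smul, ← ha]
      simp only [wd_append, wd_cons, hm]
      refine ksign_smul_congr ?_ _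
      push_cast
      generalize (wd d a₁ : ZMod 2) = A
      generalize (wd d a₂ : ZMod 2) = B
      generalize (wd d b : ZMod 2) = C
      generalize (wd d c₁ : ZMod 2) = D
      generalize (wd d c₂ : ZMod 2) = E
      generalize (d x : ZMod 2) = F
      decide +revert
  rw [e3]
  simp only [lieForm, pullForm, insOp, sumSplit₃_append_cons, smul_add, sumSplit₃_add, hat_add]
  rw [← r1, ← r2, ← r3, ← r4]
  abel

end Forms

section Forms

variable {X Y N : Type*} [AddCommGroup N] (d : X → ℤ)

/-- The pullback of forms commutes with the differential. -/
theorem pullForm₂_dForm {dy : Y → ℤ} {f : List X → Y} (hf : ∀ w, dy (f w) = wd d w)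
    (G : List Y → Y → N) (a : List X) (v : X) (c : List X) (x : X) :
    pullForm₂ d f (dForm dy G) a v c x = dForm d (pullForm d f G) a v c x := by
  -- Terms in which `v` and `x` share a block occur in both halves of the differential and cancel
  -- (`t1`, `t2`). Terms with two distinct blocks (`m1`, `m2`) form the pulled back two-form.
  have t1 : (sumSplit₃ a fun p q r => ksign (wd d p * (wd d q + wd d (r ++ v :: c) + d x)) •
        hat f (fun l => G l (f (r ++ v :: c ++ x :: p))) q) =
      ksign ((wd d a + d v) * (wd d c + d x)) • sumSplit₃ a fun p q r =>
        ksign (wd d (c ++ x :: p) * (wd d q + wd d r + d v)) •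
        hat f (fun l => G l (f (r ++ v :: (c ++ x :: p)))) q := by
    rw [smul_sumSplit₃]
    refine sumSplit₃_congr fun p q r h => ?_
    rw [ksign_smul_smul, ← h, List.append_assoc, List.cons_append]
    simp only [wd_append, wd_cons]
    refine ksign_smul_congr ?_ _
    push_cast
    generalize (wd d p : ZMod 2) = A
    generalize (wd d q : ZMod 2) = B
    generalize (wd d r : ZMod 2) = C
    generalize (d v : ZMod 2) = D
    generalize (wd d c : ZMod 2) = E
    generalize (d x : ZMod 2) = F
    decide +revert
  have t2 : (sumSplit₃ c fun p q r => ksign (wd d (a ++ v :: p) * (wd d q + wd d r + d x)) •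
        hat f (fun l => G l (f (r ++ x :: (a ++ v :: p)))) q) =
      ksign ((wd d a + d v) * (wd d c + d x)) • sumSplit₃ c fun p q r =>
        ksign (wd d p * (wd d q + wd d (r ++ x :: a) + d v)) •
        hat f (fun l => G l (f (r ++ x :: a ++ v :: p))) q := by
    rw [smul_sumSplit₃]
    refine sumSplit₃_congr fun p q r h => ?_
    rw [ksign_smul_smul, ← h, List.append_assoc, List.cons_append]
    simp only [wd_append, wd_cons]
    refine ksign_smul_congr ?_ _
    push_cast
    generalize (wd d p : ZMod 2) = A
    generalize (wd d q : ZMod 2) = B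
    generalize (wd d r : ZMod 2) = C
    generalize (d v : ZMod 2) = D
    generalize (wd d a : ZMod 2) = E
    generalize (d x : ZMod 2) = F
    decide +revert
  have m1 : (sumSplit a fun a₁ a' => sumSplit c fun c' c₃ =>
        ksign (wd d a₁ * (wd d (a' ++ v :: c') + wd d c₃ + d x)) •
          hat f (fun l => G l (f (c₃ ++ x :: a₁))) (a' ++ v :: c')) =
      sumSplit₃ a fun a₁ a₂ a₃ => sumSplit₃ c fun c₁ c₂ c₃ =>
        ksign (wd d a₁ * (wd d a₂ + wd d a₃ + d v + wd d c + d x)) •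
        hat f (fun l => hat f (fun l' => G (l ++ f (a₃ ++ v :: c₁) :: l') (f (c₃ ++ x :: a₁))) c₂)
          a₂ := by
    simp only [sumSplit₃, sumSplit_assoc (l := c)]
    refine sumSplit_congr fun a₁ a' _ => ?_
    rw [sumSplit_comm a' c]
    refine sumSplit_congr fun c' c₃ hc => ?_
    rw [hat_append_cons, smul_sumSplit]
    refine sumSplit_congr fun a₂ a₃ ha => ?_
    rw [smul_sumSplit]
    refine sumSplit_congr fun c₁ c₂ hc' => ?_
    rw [← hc, ← hc', ← ha]
    simp only [wd_append, wd_cons]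
    congr 2
    ring
  have m2 : (ksign ((wd d a + d v) * (wd d c + d x)) •
        sumSplit c fun c₁ c' => sumSplit a fun a' a₃ =>
          ksign (wd d c₁ * (wd d (c' ++ x :: a') + wd d a₃ + d v)) •
          hat f (fun l => G l (f (a₃ ++ v :: c₁))) (c' ++ x :: a')) =
      sumSplit₃ a fun a₁ a₂ a₃ => sumSplit₃ c fun c₁ c₂ c₃ =>
        ksign (wd d a₁ * (wd d a₂ + wd d a₃ + d v + wd d c + d x)) •
        hat f (fun l => hat f (fun l' =>
          ksign ((wd dy l + dy (f (a₃ ++ v :: c₁))) * (wd dy l' + dy (f (c₃ ++ x :: a₁)))) •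
          G (l' ++ f (c₃ ++ x :: a₁) :: l) (f (a₃ ++ v :: c₁))) c₂) a₂ := by
    simp only [sumSplit₃, sumSplit_assoc (l := a), smul_sumSplit]
    rw [sumSplit_comm]
    refine sumSplit_congr fun a' a₃ ha => ?_
    rw [sumSplit_comm a' c]
    refine sumSplit_congr fun c₁ c' hc => ?_
    simp only [hat_append_cons, smul_sumSplit]
    rw [sumSplit_comm]
    refine sumSplit_congr fun a₁ a₂ ha' => ?_
    refine sumSplit_congr fun c₂ c₃ hc' => ?_
    rw [ksign_smul_smul, hat_hat_comm, smul_hat, smul_hat]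
    refine hat_congr _ fun L hL _ => ?_
    rw [smul_hat, smul_hat]
    refine hat_congr _ fun L' hL' _ => ?_
    rw [ksign_smul_smul, wd_map_blocks d hf, wd_map_blocks d hf, hL, hL', hf, hf,
      ← ha, ← ha', ← hc, ← hc']
    simp only [wd_append, wd_cons]
    refine ksign_smul_congr ?_ _
    push_cast
    generalize (wd d a₁ : ZMod 2) = A
    generalize (wd d a₂ : ZMod 2) = B
    generalize (wd d a₃ : ZMod 2) = C
    generalize (d v : ZMod 2) = D
    generalize (wd d c₁ : ZMod 2) = E
    generalize (wd d c₂ : ZMod 2) = F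
    generalize (wd d c₃ : ZMod 2) = G
    generalize (d x : ZMod 2) = H
    decide +revert
  have e : pullForm₂ d f (dForm dy G) a v c x =
      (sumSplit₃ a fun a₁ a₂ a₃ => sumSplit₃ c fun c₁ c₂ c₃ =>
        ksign (wd d a₁ * (wd d a₂ + wd d a₃ + d v + wd d c + d x)) •
        hat f (fun l => hat f (fun l' => G (l ++ f (a₃ ++ v :: c₁) :: l') (f (c₃ ++ x :: a₁))) c₂)
          a₂) -
      sumSplit₃ a fun a₁ a₂ a₃ => sumSplit₃ c fun c₁ c₂ c₃ =>
        ksign (wd d a₁ * (wd d a₂ + wd d a₃ + d v + wd d c + d x)) •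
        hat f (fun l => hat f (fun l' =>
          ksign ((wd dy l + dy (f (a₃ ++ v :: c₁))) * (wd dy l' + dy (f (c₃ ++ x :: a₁)))) •
          G (l' ++ f (c₃ ++ x :: a₁) :: l) (f (a₃ ++ v :: c₁))) c₂) a₂ := by
    rw [eq_sub_iff_add_eq]
    simp only [pullForm₂, dForm, ← sumSplit₃_add, ← smul_add, ← hat_add, sub_add_cancel]
  rw [e, ← m1, ← m2]
  simp only [dForm, pullForm, sumSplit₃_append_cons, smul_add]
  rw [t1, t2]
  abel

/-- The Lie derivative of forms commutes with the differential. -/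
theorem lieForm₂_dForm {m : List X → X} (hm : ∀ w, d (m w) = wd d w + 1)
    (G : List X → X → N) (a : List X) (v : X) (c : List X) (x : X) :
    lieForm₂ d m (dForm d G) a v c x = dForm d (lieForm d m G) a v c x := by
  -- Terms in which one operation absorbs both `v` and `x` cancel (`t1`, `t2`); `k1` to `k4` expand
  -- the four sums of `lieForm₂`, which account for all other terms.
  have t1 : (sumSplit₃ a fun p q r =>
        ksign (wd d q + wd d p * (wd d q + wd d (r ++ v :: c) + d x)) •
          G q (m (r ++ v :: c ++ x :: p))) =
      ksign ((wd d a + d v) * (wd d c + d x)) • sumSplit₃ a fun p q r =>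
        ksign (wd d q + wd d (c ++ x :: p) * (wd d q + wd d r + d v)) •
          G q (m (r ++ v :: (c ++ x :: p))) := by
    rw [smul_sumSplit₃]
    refine sumSplit₃_congr fun p q r h => ?_
    rw [ksign_smul_smul, ← h, List.append_assoc, List.cons_append]
    simp only [wd_append, wd_cons]
    refine ksign_smul_congr ?_ _
    push_cast
    generalize (wd d p : ZMod 2) = A
    generalize (wd d q : ZMod 2) = B
    generalize (wd d r : ZMod 2) = C
    generalize (d v : ZMod 2) = D
    generalize (wd d c : ZMod 2) = E
    generalize (d x : ZMod 2) = F
    decide +revert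
  have t2 : (sumSplit₃ c fun p q r =>
        ksign (wd d q + wd d (a ++ v :: p) * (wd d q + wd d r + d x)) •
          G q (m (r ++ x :: (a ++ v :: p)))) =
      ksign ((wd d a + d v) * (wd d c + d x)) • sumSplit₃ c fun p q r =>
        ksign (wd d q + wd d p * (wd d q + wd d (r ++ x :: a) + d v)) •
          G q (m (r ++ x :: a ++ v :: p)) := by
    rw [smul_sumSplit₃]
    refine sumSplit₃_congr fun p q r h => ?_
    rw [ksign_smul_smul, ← h, List.append_assoc, List.cons_append]
    simp only [wd_append, wd_cons]
    refine ksign_smul_congr ?_ _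
    push_cast
    generalize (wd d p : ZMod 2) = A
    generalize (wd d q : ZMod 2) = B
    generalize (wd d r : ZMod 2) = C
    generalize (d v : ZMod 2) = D
    generalize (wd d a : ZMod 2) = E
    generalize (d x : ZMod 2) = F
    decide +revert
  have k1 : (sumSplit a fun a₁ a₂ => sumSplit c fun c₁ c₂ => ksign (wd d a₁) •
        dForm d G a₁ (m (a₂ ++ v :: c₁)) c₂ x) =
      (sumSplit a fun a₁ a₂ => sumSplit c fun c₁ c₂ => ksign (wd d a₁) •
        G (a₁ ++ m (a₂ ++ v :: c₁) :: c₂) x) -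
      ksign ((wd d a + d v) * (wd d c + d x)) • sumSplit c fun c₁ c₂ => sumSplit a fun a₁ a₂ =>
        ksign (wd d (c₂ ++ x :: a₁) + wd d c₁ * (wd d (c₂ ++ x :: a₁) + wd d a₂ + d v)) •
          G (c₂ ++ x :: a₁) (m (a₂ ++ v :: c₁)) := by
    rw [eq_sub_iff_add_eq, sumSplit_comm c a, smul_sumSplit, ← sumSplit_add]
    refine sumSplit_congr fun a₁ a₂ ha => ?_
    rw [smul_sumSplit, ← sumSplit_add]
    refine sumSplit_congr fun c₁ c₂ hc => ?_
    rw [dForm, smul_sub, sub_add_eq_add_sub, sub_eq_iff_eq_add, add_right_inj, ksign_smul_smul,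
      ksign_smul_smul, ← ha, ← hc]
    simp only [wd_append, wd_cons, hm]
    refine ksign_smul_congr ?_ _
    push_cast
    generalize (wd d a₁ : ZMod 2) = A
    generalize (wd d a₂ : ZMod 2) = B
    generalize (d v : ZMod 2) = C
    generalize (wd d c₁ : ZMod 2) = D
    generalize (wd d c₂ : ZMod 2) = E
    generalize (d x : ZMod 2) = F
    decide +revert
  have k2 : (sumSplit₃ a fun a₁ a₂ a₃ => ksign (wd d a₁) • dForm d G (a₁ ++ m a₂ :: a₃) v c x) =
      (sumSplit₃ a fun a₁ a₂ a₃ => ksign (wd d a₁) • G (a₁ ++ m a₂ :: (a₃ ++ v :: c)) x) -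
      ksign ((wd d a + d v) * (wd d c + d x)) • sumSplit₃ a fun a₁ a₂ a₃ =>
        ksign (wd d (c ++ x :: a₁)) • G (c ++ x :: a₁ ++ m a₂ :: a₃) v := by
    rw [eq_sub_iff_add_eq, smul_sumSplit₃, ← sumSplit₃_add]
    refine sumSplit₃_congr fun a₁ a₂ a₃ ha => ?_
    rw [dForm, smul_sub, sub_add_eq_add_sub, sub_eq_iff_eq_add, List.append_assoc,
      List.cons_append, add_right_inj, ksign_smul_smul, ksign_smul_smul, ← ha]
    simp only [wd_append, wd_cons, hm, List.append_assoc, List.cons_append]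
    refine ksign_smul_congr ?_ _
    push_cast
    generalize (wd d a₁ : ZMod 2) = A
    generalize (wd d a₂ : ZMod 2) = B
    generalize (wd d a₃ : ZMod 2) = C
    generalize (d v : ZMod 2) = D
    generalize (wd d c : ZMod 2) = E
    generalize (d x : ZMod 2) = F
    decide +revert
  have k3 : (sumSplit₃ c fun c₁ c₂ c₃ => ksign (wd d a + d v + wd d c₁) •
        dForm d G a v (c₁ ++ m c₂ :: c₃) x) =
      (sumSplit₃ c fun c₁ c₂ c₃ => ksign (wd d (a ++ v :: c₁)) •
        G (a ++ v :: c₁ ++ m c₂ :: c₃) x) -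
      ksign ((wd d a + d v) * (wd d c + d x)) • sumSplit₃ c fun c₁ c₂ c₃ =>
        ksign (wd d c₁) • G (c₁ ++ m c₂ :: (c₃ ++ x :: a)) v := by
    rw [eq_sub_iff_add_eq, smul_sumSplit₃, ← sumSplit₃_add]
    refine sumSplit₃_congr fun c₁ c₂ c₃ hc => ?_
    rw [dForm, smul_sub, sub_add_eq_add_sub, sub_eq_iff_eq_add, List.append_assoc,
      List.cons_append, ksign_smul_smul, ksign_smul_smul, ← hc]
    simp only [wd_append, wd_cons, hm, List.append_assoc, List.cons_append, ← add_assoc]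
    rw [add_right_inj]
    refine ksign_smul_congr ?_ _
    push_cast
    generalize (wd d c₁ : ZMod 2) = A
    generalize (wd d c₂ : ZMod 2) = B
    generalize (wd d c₃ : ZMod 2) = C
    generalize (d v : ZMod 2) = D
    generalize (wd d a : ZMod 2) = E
    generalize (d x : ZMod 2) = F
    decide +revert
  have k4 : (sumSplit a fun a₁ a₂ => sumSplit c fun c₁ c₂ =>
        ksign (wd d a₂ + d v + wd d c₁ + wd d a₁ * (wd d a₂ + d v + wd d c + d x)) •
        dForm d G a₂ v c₁ (m (c₂ ++ x :: a₁))) =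
      (sumSplit a fun a₁ a₂ => sumSplit c fun c₁ c₂ =>
        ksign (wd d (a₂ ++ v :: c₁) + wd d a₁ * (wd d (a₂ ++ v :: c₁) + wd d c₂ + d x)) •
          G (a₂ ++ v :: c₁) (m (c₂ ++ x :: a₁))) -
      ksign ((wd d a + d v) * (wd d c + d x)) • sumSplit c fun c₁ c₂ => sumSplit a fun a₁ a₂ =>
        ksign (wd d c₁) • G (c₁ ++ m (c₂ ++ x :: a₁) :: a₂) v := by
    rw [eq_sub_iff_add_eq, sumSplit_comm c a, smul_sumSplit, ← sumSplit_add]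
    refine sumSplit_congr fun a₁ a₂ ha => ?_
    rw [smul_sumSplit, ← sumSplit_add]
    refine sumSplit_congr fun c₁ c₂ hc => ?_
    rw [dForm, smul_sub, sub_add_eq_add_sub, sub_eq_iff_eq_add, ksign_smul_smul,
      ksign_smul_smul, ← ha, ← hc]
    simp only [wd_append, wd_cons, hm]
    congr 1
    · congr 2
      ring
    · refine ksign_smul_congr ?_ _
      push_cast
      generalize (wd d a₁ : ZMod 2) = A
      generalize (wd d a₂ : ZMod 2) = B
      generalize (d v : ZMod 2) = C
      generalize (wd d c₁ : ZMod 2) = D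
      generalize (wd d c₂ : ZMod 2) = E
      generalize (d x : ZMod 2) = F
      decide +revert
  rw [lieForm₂, k1, k2, k3, k4]
  simp only [dForm, lieForm, sumSplit₃_append_cons, smul_add, sumSplit₃_add]
  rw [t1, t2]
  abel

/-- The pullback of exact two-forms commutes with the Lie derivative. -/
theorem lieForm₂_pullForm₂ {dy : Y → ℤ} {f : List X → Y} (hf : ∀ w, dy (f w) = wd d w)
    {m : List X → X} (hm : ∀ w, d (m w) = wd d w + 1)
    {mY : List Y → Y} (hmY : ∀ w, dy (mY w) = wd dy w + 1) (G : List Y → Y → N)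
    (h₁ : ∀ w l l' y, hat f (fun u => G (l ++ mY u :: l') y) w =
      insOp d m (fun u => G (l ++ f u :: l') y) w)
    (h₂ : ∀ w l, hat f (fun u => G l (mY u)) w = insOp d m (fun u => G l (f u)) w)
    (a : List X) (v : X) (c : List X) (x : X) :
    pullForm₂ d f (lieForm₂ dy mY (dForm dy G)) a v c x =
      lieForm₂ d m (pullForm₂ d f (dForm dy G)) a v c x := by
  have e1 : lieForm₂ dy mY (dForm dy G) = dForm dy (lieForm dy mY G) := by
    funext a v c x
    exact lieForm₂_dForm dy hmY G a v c x
  have e2 : pullForm₂ d f (dForm dy G) = dForm d (pullForm d f G) := by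
    funext a v c x
    exact pullForm₂_dForm d hf G a v c x
  have e3 : pullForm d f (lieForm dy mY G) = lieForm d m (pullForm d f G) := by
    funext w x
    exact lieForm_pullForm d hf hm mY G h₁ h₂ w x
  rw [e1, e2, pullForm₂_dForm d hf, e3, lieForm₂_dForm d hm]

end Forms

/-! ### Closed two-forms and the Poincaré lemma -/

section Closed

variable {X N : Type*} [AddCommGroup N] (d : X → ℤ)

theorem ksign_smul_eq_self {p : ℤ} (h : (p : ZMod 2) = 0) (x : N) : ksign p • x = x :=
  (ksign_smul_congr (q := 0) (by rw [h, Int.cast_zero]) x).trans (one_smul ℤˣ x)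

/-- Skew symmetry of a two-form on words. -/
def SkewForm (Ω : List X → X → List X → X → N) : Prop :=
  ∀ a v b w, Ω a v b w = -(ksign ((wd d a + d v) * (wd d b + d w)) • Ω b w a v)

/-- Closedness of a two-form on words. -/
def ClosedForm (Ω : List X → X → List X → X → N) : Prop :=
  ∀ (α β γ δ : List X) (x y z : X),
    ksign ((wd d α + d x + wd d β + d y) * (wd d γ + d z + wd d δ)) • Ω (γ ++ z :: δ ++ α) x β y +
      ksign ((wd d α + d x + wd d β + d y + wd d γ + d z) * wd d δ) •
        Ω (δ ++ α ++ x :: β) y γ z +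
      ksign ((wd d α + d x) * (wd d β + d y + wd d γ + d z + wd d δ)) •
        Ω (β ++ y :: γ) z (δ ++ α) x = 0

theorem skewForm_dForm (G : List X → X → N) : SkewForm d (dForm d G) := by
  intro a v b w
  rw [dForm, dForm, smul_sub, neg_sub, ksign_smul_smul, sub_left_inj]
  refine (ksign_smul_eq_self ?_ _).symm
  push_cast
  generalize (wd d a : ZMod 2) = A
  generalize (wd d b : ZMod 2) = B
  generalize (d v : ZMod 2) = C
  generalize (d w : ZMod 2) = D
  decide +revert

/-- This is `d² = 0`: each term is a difference of two of the three values of `G` obtained by ending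
the cyclic word at `x`, `y` or `z`, and the sum telescopes. -/
theorem closedForm_dForm (G : List X → X → N) : ClosedForm d (dForm d G) := by
  intro α β γ δ x y z
  have h1 : ksign ((wd d α + d x + wd d β + d y) * (wd d γ + d z + wd d δ)) •
        dForm d G (γ ++ z :: δ ++ α) x β y =
      ksign ((wd d α + d x + wd d β + d y) * (wd d γ + d z + wd d δ)) •
        G (γ ++ z :: δ ++ α ++ x :: β) y -
      ksign ((wd d α + d x) * (wd d β + d y + wd d γ + d z + wd d δ)) •
        G (β ++ y :: (γ ++ z :: δ ++ α)) x := by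
    rw [dForm, smul_sub, ksign_smul_smul, sub_right_inj]
    simp only [wd_append, wd_cons]
    refine ksign_smul_congr ?_ _
    push_cast
    generalize (wd d α : ZMod 2) = A
    generalize (wd d β : ZMod 2) = B
    generalize (wd d γ : ZMod 2) = C
    generalize (wd d δ : ZMod 2) = D
    generalize (d x : ZMod 2) = E
    generalize (d y : ZMod 2) = F
    generalize (d z : ZMod 2) = G
    decide +revert
  have h2 : ksign ((wd d α + d x + wd d β + d y + wd d γ + d z) * wd d δ) •
        dForm d G (δ ++ α ++ x :: β) y γ z =
      ksign ((wd d α + d x + wd d β + d y + wd d γ + d z) * wd d δ) •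
        G (δ ++ α ++ x :: β ++ y :: γ) z -
      ksign ((wd d α + d x + wd d β + d y) * (wd d γ + d z + wd d δ)) •
        G (γ ++ z :: (δ ++ α ++ x :: β)) y := by
    rw [dForm, smul_sub, ksign_smul_smul, sub_right_inj]
    simp only [wd_append, wd_cons]
    refine ksign_smul_congr ?_ _
    push_cast
    generalize (wd d α : ZMod 2) = A
    generalize (wd d β : ZMod 2) = B
    generalize (wd d γ : ZMod 2) = C
    generalize (wd d δ : ZMod 2) = D
    generalize (d x : ZMod 2) = E
    generalize (d y : ZMod 2) = F
    generalize (d z : ZMod 2) = G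
    decide +revert
  have h3 : ksign ((wd d α + d x) * (wd d β + d y + wd d γ + d z + wd d δ)) •
        dForm d G (β ++ y :: γ) z (δ ++ α) x =
      ksign ((wd d α + d x) * (wd d β + d y + wd d γ + d z + wd d δ)) •
        G (β ++ y :: γ ++ z :: (δ ++ α)) x -
      ksign ((wd d α + d x + wd d β + d y + wd d γ + d z) * wd d δ) •
        G (δ ++ α ++ x :: (β ++ y :: γ)) z := by
    rw [dForm, smul_sub, ksign_smul_smul, sub_right_inj]
    simp only [wd_append, wd_cons]
    refine ksign_smul_congr ?_ _
    push_cast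
    generalize (wd d α : ZMod 2) = A
    generalize (wd d β : ZMod 2) = B
    generalize (wd d γ : ZMod 2) = C
    generalize (wd d δ : ZMod 2) = D
    generalize (d x : ZMod 2) = E
    generalize (d y : ZMod 2) = F
    generalize (d z : ZMod 2) = G
    decide +revert
  rw [h1, h2, h3]
  simp only [List.append_assoc, List.cons_append]
  abel

/-- Sum of `F a x b` over all ways to write a word as `a ++ x :: b`. -/
def sumPos : List X → (List X → X → List X → N) → N
  | [], _ => 0
  | x :: w, F => F [] x w + sumPos w fun a y b => F (x :: a) y b

theorem sumPos_congr {w : List X} {F G : List X → X → List X → N}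
    (h : ∀ a x b, a ++ x :: b = w → F a x b = G a x b) : sumPos w F = sumPos w G := by
  induction w generalizing F G with
  | nil => rfl
  | cons x w ih =>
    rw [sumPos, sumPos, h [] x w rfl, ih fun a y b hab => h (x :: a) y b (by simp [← hab])]

theorem sumPos_add (w : List X) (F G : List X → X → List X → N) :
    (sumPos w fun a x b => F a x b + G a x b) = sumPos w F + sumPos w G := by
  induction w generalizing F G with
  | nil => simp [sumPos]
  | cons x w ih => simp only [sumPos, ih]; abel

theorem smul_sumPos {R : Type*} [DistribSMul R N] (r : R) (w : List X)
    (F : List X → X → List X → N) : r • sumPos w F = sumPos w fun a x b => r • F a x b := by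
  induction w generalizing F with
  | nil => simp [sumPos]
  | cons x w ih => simp only [sumPos, smul_add, ih]

theorem sumPos_const (w : List X) (z : N) : (sumPos w fun _ _ _ => z) = w.length • z := by
  induction w with
  | nil => simp [sumPos]
  | cons x w ih => rw [sumPos, ih, List.length_cons, succ_nsmul, add_comm]

theorem sumPos_append_cons (u : List X) (x : X) (v : List X) (F : List X → X → List X → N) :
    sumPos (u ++ x :: v) F = (sumPos u fun a y b => F a y (b ++ x :: v)) + F u x v +
      sumPos v fun a y b => F (u ++ x :: a) y b := by
  induction u generalizing F with
  | nil => simp [sumPos]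
  | cons y u ih => simp [sumPos, ih, add_assoc]

/-- The potential of a closed two-form, obtained by averaging over the positions. -/
def potential {k : Type*} [Field k] (Ω : List X → X → List X → X → k) (w : List X) (x : X) : k :=
  ((w.length : k) + 1)⁻¹ * sumPos w fun a v c => Ω a v c x

/-- The Poincaré lemma for closed two-forms on words. -/
theorem dForm_potential {k : Type*} [Field k] [CharZero k] {Ω : List X → X → List X → X → k}
    (hs : SkewForm d Ω) (hc : ClosedForm d Ω) (a : List X) (v : X) (c : List X) (x : X) :
    dForm d (potential Ω) a v c x = Ω a v c x := by
  -- Closedness with marked letters `y`, `v`, `x` shows that each letter of `a` contributes one copy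
  -- of `Ω a v c x` to the differential of the unnormalized potential; `h2` is the same for the
  -- letters of `c`.
  have h1 : ∀ p y q, p ++ y :: q = a → Ω p y (q ++ v :: c) x +
      -(ksign ((wd d a + d v) * (wd d c + d x)) • Ω (c ++ x :: p) y q v) = Ω a v c x := by
    rintro p y q rfl
    have h := hc p q c [] y v x
    have h' : ksign ((wd d p + d y) * (wd d q + d v + wd d c + d x)) •
        Ω (q ++ v :: c) x p y = -Ω p y (q ++ v :: c) x := by
      rw [hs p y, neg_neg]
      simp only [wd_append, wd_cons]
      refine ksign_smul_congr ?_ _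
      push_cast
      generalize (wd d p : ZMod 2) = A
      generalize (wd d q : ZMod 2) = B
      generalize (wd d c : ZMod 2) = C
      generalize (d x : ZMod 2) = D
      generalize (d y : ZMod 2) = E
      generalize (d v : ZMod 2) = F
      decide +revert
    simp only [wd_nil, mul_zero, add_zero, List.nil_append, List.append_assoc,
      List.cons_append, h'] at h
    have h0 : ksign 0 • Ω (p ++ y :: q) v c x = Ω (p ++ y :: q) v c x := one_smul ℤˣ _
    rw [h0] at h
    have h2 : ksign ((wd d (p ++ y :: q) + d v) * (wd d c + d x)) • Ω (c ++ x :: p) y q v =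
        ksign ((wd d p + d y + wd d q + d v) * (wd d c + d x)) • Ω (c ++ x :: p) y q v := by
      simp only [wd_append, wd_cons, add_assoc]
    rw [h2]
    linear_combination -h
  have h2 : ∀ p y q, p ++ y :: q = c → Ω (a ++ v :: p) y q x +
      -(ksign ((wd d a + d v) * (wd d c + d x)) • Ω p y (q ++ x :: a) v) = Ω a v c x := by
    rintro p y q rfl
    have h := hc a p q [] v y x
    have h' : ksign ((wd d a + d v) * (wd d p + d y + wd d q + d x)) •
        Ω (p ++ y :: q) x a v = -Ω a v (p ++ y :: q) x := by
      rw [hs a v, neg_neg]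
      simp only [wd_append, wd_cons]
      refine ksign_smul_congr ?_ _
      push_cast
      generalize (wd d p : ZMod 2) = A
      generalize (wd d q : ZMod 2) = B
      generalize (wd d a : ZMod 2) = C
      generalize (d x : ZMod 2) = D
      generalize (d y : ZMod 2) = E
      generalize (d v : ZMod 2) = F
      decide +revert
    have h3 : ksign ((wd d a + d v) * (wd d (p ++ y :: q) + d x)) • Ω p y (q ++ x :: a) v =
        -(ksign ((wd d a + d v + wd d p + d y) * (wd d q + d x)) • Ω (q ++ x :: a) v p y) := by
      rw [hs p y, smul_neg, ksign_smul_smul, neg_inj]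
      simp only [wd_append, wd_cons]
      refine ksign_smul_congr ?_ _
      push_cast
      generalize (wd d p : ZMod 2) = A
      generalize (wd d q : ZMod 2) = B
      generalize (wd d a : ZMod 2) = C
      generalize (d x : ZMod 2) = D
      generalize (d y : ZMod 2) = E
      generalize (d v : ZMod 2) = F
      decide +revert
    simp only [wd_nil, mul_zero, add_zero, List.nil_append, List.append_assoc,
      List.cons_append, h'] at h
    have h0 : ksign 0 • Ω (a ++ v :: p) y q x = Ω (a ++ v :: p) y q x := one_smul ℤˣ _
    rw [h0] at h
    rw [h3]
    linear_combination h
  have hl : ((c ++ x :: a).length : k) = (a ++ v :: c).length := by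
    simp only [List.length_append, List.length_cons]
    push_cast
    ring
  -- Besides the letters of `a` and `c`, the position `v` in the first sum and, by skew symmetry,
  -- the position `x` in the second give one copy each. The total `|a| + |c| + 2` is the length plus
  -- one, whence the normalization of `potential`.
  have e : (sumPos (a ++ v :: c) fun p y q => Ω p y q x) -
      ksign ((wd d a + d v) * (wd d c + d x)) • (sumPos (c ++ x :: a) fun p y q => Ω p y q v) =
      (((a ++ v :: c).length : k) + 1) * Ω a v c x := by
    have e1 := sumPos_congr h1
    have e2 := sumPos_congr h2
    rw [sumPos_const, sumPos_add] at e1 e2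
    simp only [neg_ksign_smul, ← smul_sumPos] at e1 e2
    simp only [← neg_ksign_smul] at e1 e2
    have e3 := hs a v c x
    rw [sumPos_append_cons, sumPos_append_cons, smul_add, smul_add]
    simp only [nsmul_eq_mul] at e1 e2
    simp only [List.length_append, List.length_cons]
    push_cast
    linear_combination e1 + e2 - e3
  have hne : ((a ++ v :: c).length : k) + 1 ≠ 0 := Nat.cast_add_one_ne_zero _
  rw [dForm, potential, potential, hl, ← mul_smul_comm, ← mul_sub, e, inv_mul_cancel_left₀ hne]

end Closed

/-! ## Multilinear functions of homogeneous letters -/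

section LinearMaps

variable {k : Type*} [Field k] {V W N : Type*} [AddCommGroup V] [Module k V] [AddCommGroup W]
  [Module k W] [AddCommGroup N] [Module k N]

theorem IsLinearMap.zero_fun : IsLinearMap k fun _ : V => (0 : N) :=
  (0 : V →ₗ[k] N).isLinear

theorem IsLinearMap.add_fun {f g : V → N} (hf : IsLinearMap k f) (hg : IsLinearMap k g) :
    IsLinearMap k fun y => f y + g y :=
  (hf.mk' f + hg.mk' g).isLinear

theorem IsLinearMap.sub_fun {f g : V → N} (hf : IsLinearMap k f) (hg : IsLinearMap k g) :
    IsLinearMap k fun y => f y - g y :=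
  (hf.mk' f - hg.mk' g).isLinear

theorem IsLinearMap.sum_fun {ι : Type*} (s : Finset ι) {f : ι → V → N}
    (hf : ∀ i ∈ s, IsLinearMap k (f i)) : IsLinearMap k fun y => ∑ i ∈ s, f i y where
  map_add x y := by
    rw [← Finset.sum_add_distrib]
    exact Finset.sum_congr rfl fun i hi => (hf i hi).map_add x y
  map_smul c x := by
    rw [Finset.smul_sum]
    exact Finset.sum_congr rfl fun i hi => (hf i hi).map_smul c x

theorem IsLinearMap.ksign_smul {f : V → N} (n : ℤ) (hf : IsLinearMap k f) :
    IsLinearMap k fun y => ksign n • f y where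
  map_add x y := by rw [hf.map_add, smul_add]
  map_smul c x := by rw [hf.map_smul, smul_comm]

theorem IsLinearMap.comp_linear {f : V → W} (g : W →ₗ[k] N) (hf : IsLinearMap k f) :
    IsLinearMap k fun y => g (f y) :=
  (g ∘ₗ hf.mk' f).isLinear

variable {α β : Type*}

theorem IsLinearMap.sumSplit {l : List α} {F : V → List α → List α → N}
    (hF : ∀ a b, a ++ b = l → IsLinearMap k fun y => F y a b) :
    IsLinearMap k fun y => sumSplit l (F y) :=
  IsLinearMap.sum_fun _ fun _ _ => hF _ _ (List.take_append_drop _ _)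

theorem IsLinearMap.sumSplit₃ {l : List α} {F : V → List α → List α → List α → N}
    (hF : ∀ a b c, a ++ (b ++ c) = l → IsLinearMap k fun y => F y a b c) :
    IsLinearMap k fun y => sumSplit₃ l (F y) :=
  IsLinearMap.sumSplit fun a b h => IsLinearMap.sumSplit fun c d h' => hF a c d (by rw [h', h])

theorem IsLinearMap.hat (f : List α → β) {F : V → List β → N} {w : List α}
    (hF : ∀ l, IsLinearMap k fun y => F y l) : IsLinearMap k fun y => hat f (F y) w := by
  unfold _root_.hat sumBlocks
  exact IsLinearMap.sum_fun _ fun _ _ => hF _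

theorem evalWord_eq {n : ℕ} (g : ∀ n : ℕ, MultilinearMap k (fun _ : Fin n => V) W) {l : List V}
    (h : l.length = n) : evalWord g l = g n fun i => l[(i : ℕ)] := by
  subst h
  rfl

theorem isLinearMap_evalWord (g : ∀ n : ℕ, MultilinearMap k (fun _ : Fin n => V) W)
    (a b : List V) : IsLinearMap k fun y => evalWord g (a ++ y :: b) := by
  have hlt : a.length < a.length + (b.length + 1) := by omega
  have key (y : V) : evalWord g (a ++ y :: b) = g (a.length + (b.length + 1))
      (Function.update (fun i => (a ++ 0 :: b)[(i : ℕ)]'(by simp)) ⟨a.length, hlt⟩ y) := by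
    rw [evalWord_eq g (n := a.length + (b.length + 1)) (by simp)]
    congr 1
    funext ⟨i, hi⟩
    by_cases h : i = a.length
    · subst h
      simp
    · rw [Function.update_of_ne (by simpa using h)]
      simp only [List.getElem_append, List.getElem_cons]
      split_ifs <;> first | rfl | omega
  simp only [key]
  exact ((g _).toLinearMap _ _).isLinear

end LinearMaps

section LM

variable {k : Type*} [Field k] {V W N : Type*} [AddCommGroup V] [Module k V] [AddCommGroup W]
  [Module k W] [AddCommGroup N] [Module k N] {gr : ℤ → Submodule k V} {gr' : ℤ → Submodule k W}

@[simp] theorem sdeg_mk (i : ℤ) (y : gr i) : sdeg (⟨i, y⟩ : Letter gr) = i - 1 := rfl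

@[simp] theorem val_mk (i : ℤ) (y : gr i) : val (⟨i, y⟩ : Letter gr) = y := rfl

theorem vals_append (a b : List (Letter gr)) : vals (a ++ b) = vals a ++ vals b :=
  List.map_append

theorem vals_cons (x : Letter gr) (b : List (Letter gr)) : vals (x :: b) = x.val :: vals b := rfl

variable (k) in
/-- Linearity of a function of one letter. -/
def IsLin (g : Letter gr → N) : Prop := ∀ i, IsLinearMap k fun y : gr i => g ⟨i, y⟩

variable (k) in
/-- Multilinearity of a function of words of letters. -/
def IsMultilin (F : List (Letter gr) → N) : Prop := ∀ a b, IsLin k fun y => F (a ++ y :: b)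

/-- The projections onto the homogeneous components, as one isomorphism. -/
noncomputable def decomp (h : DirectSum.IsInternal gr) : V ≃ₗ[k] DirectSum ℤ fun i => gr i :=
  (LinearEquiv.ofBijective (DirectSum.coeLinearMap gr) h).symm

theorem decomp_coe (h : DirectSum.IsInternal gr) {i : ℤ} (y : gr i) :
    decomp h (y : V) = DirectSum.lof k ℤ (fun i => gr i) i y := by
  rw [decomp, LinearEquiv.symm_apply_eq]
  exact (DirectSum.coeLinearMap_lof gr i y).symm

/-- A letter records a degree even when its vector is zero, so letters with equal vectors may
differ. Linearity in each degree makes the recorded degree irrelevant: the function factors through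
the underlying vector. This is what allows an inserted zero letter to be discarded. -/
theorem exists_linear_of_isLin (h : DirectSum.IsInternal gr) {g : Letter gr → N}
    (hg : IsLin k g) : ∃ L : V →ₗ[k] N, ∀ y, g y = L y.val := by
  refine ⟨DirectSum.toModule k ℤ N (fun i => (hg i).mk' _) ∘ₗ (decomp h).toLinearMap, ?_⟩
  rintro ⟨i, y⟩
  simp [decomp_coe, DirectSum.toModule_lof]

theorem isLin_of_linear (L : V →ₗ[k] N) : IsLin k fun y : Letter gr => L y.val :=
  fun i => (L ∘ₗ (gr i).subtype).isLinear

theorem linear_ext_letter (h : DirectSum.IsInternal gr) {L L' : V →ₗ[k] N}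
    (hL : ∀ y : Letter gr, L y.val = L' y.val) : L = L' := by
  have : L ∘ₗ (decomp h).symm.toLinearMap = L' ∘ₗ (decomp h).symm.toLinearMap := by
    ext i y
    have := hL ⟨i, y⟩
    simp only [LinearMap.comp_apply, LinearEquiv.coe_coe, ← decomp_coe h,
      LinearEquiv.symm_apply_apply]
    exact this
  ext x
  simpa using LinearMap.congr_fun this (decomp h x)

/-- Multilinear functions of letters extend to multilinear maps. -/
theorem exists_multilinear (h : DirectSum.IsInternal gr) {F : List (Letter gr) → N}
    (hF : IsMultilin k F) : ∃ g : ∀ n : ℕ, MultilinearMap k (fun _ : Fin n => V) N,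
      ∀ l, evalWord g (vals l) = F l := by
  classical
  have hset (n : ℕ) (p : Fin n → ℤ) (y : ∀ i, gr (p i)) (j : Fin n) (x : gr (p j)) :
      (List.ofFn fun i => (⟨p i, Function.update y j x i⟩ : Letter gr)) =
        (List.ofFn fun i => (⟨p i, y i⟩ : Letter gr)).take j ++ ⟨p j, x⟩ ::
          (List.ofFn fun i => (⟨p i, y i⟩ : Letter gr)).drop (j + 1) := by
    have hs := List.set_eq_take_append_cons_drop (i := j) (a := (⟨p j, x⟩ : Letter gr))
      (l := List.ofFn fun i => (⟨p i, y i⟩ : Letter gr))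
    rw [if_pos (by simp)] at hs
    rw [← hs]
    refine List.ext_getElem (by simp) fun i h₁ h₂ => ?_
    rw [List.getElem_set]
    split_ifs with hij
    · subst hij
      simp
    · have : (⟨i, by simpa using h₁⟩ : Fin n) ≠ j := fun h => hij (by rw [← h])
      simp [Function.update_of_ne this]
  let M (n : ℕ) (p : Fin n → ℤ) : MultilinearMap k (fun i => gr (p i)) N :=
    { toFun := fun y => F (List.ofFn fun i => ⟨p i, y i⟩)
      map_update_add' := by
        intro inst y j x x'
        rw [Subsingleton.elim inst (instDecidableEqFin n)]
        simp only [hset]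
        exact (hF _ _ _).map_add x x'
      map_update_smul' := by
        intro inst y j c x
        rw [Subsingleton.elim inst (instDecidableEqFin n)]
        simp only [hset]
        exact (hF _ _ _).map_smul c x }
  refine ⟨fun n => (MultilinearMap.fromDirectSumEquiv (M n)).compLinearMap
    fun _ => (decomp h).toLinearMap, fun l => ?_⟩
  rw [evalWord_eq _ (n := l.length) (by simp [vals])]
  have e : ∀ i : Fin l.length, decomp h ((vals l)[(i : ℕ)]'(by simp [vals])) =
      DirectSum.lof k ℤ (fun i => gr i) (l.get i).1 (l.get i).2 := by
    intro i
    rw [← decomp_coe h]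
    simp [vals, val]
  simp only [MultilinearMap.compLinearMap_apply, LinearEquiv.coe_coe, e]
  rw [MultilinearMap.fromDirectSumEquiv_lof]
  exact congrArg F (List.ofFn_get l)

end LM

section Closure

variable {k : Type*} [Field k] {V W N : Type*} [AddCommGroup V] [Module k V] [AddCommGroup W]
  [Module k W] [AddCommGroup N] [Module k N] {gr : ℤ → Submodule k V} {gr' : ℤ → Submodule k W}

theorem map_ksign_smul (L : W →ₗ[k] N) (n : ℤ) (x : W) : L (ksign n • x) = ksign n • L x := by
  rw [Units.smul_def, Units.smul_def, map_zsmul]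

theorem isMultilin_evalWord (g : ∀ n : ℕ, MultilinearMap k (fun _ : Fin n => V) N) :
    IsMultilin k fun w : List (Letter gr) => evalWord g (vals w) := by
  intro a b i
  simp only [vals_append, vals_cons, val_mk]
  exact (((isLinearMap_evalWord g (vals a) (vals b)).mk' _) ∘ₗ (gr i).subtype).isLinear

theorem IsLin.comp (h : DirectSum.IsInternal gr') {g : Letter gr' → N} (hg : IsLin k g)
    {f : V → Letter gr'} (hf : IsLinearMap k fun y => (f y).val) :
    IsLinearMap k fun y => g (f y) := by
  obtain ⟨L, hL⟩ := exists_linear_of_isLin h hg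
  simp only [hL]
  exact hf.comp_linear L

theorem IsLin.eq_zero (h : DirectSum.IsInternal gr) {g : Letter gr → N} (hg : IsLin k g)
    {y : Letter gr} (hy : y.val = 0) : g y = 0 := by
  obtain ⟨L, hL⟩ := exists_linear_of_isLin h hg
  rw [hL, hy, map_zero]

theorem isMultilin_hat (h' : DirectSum.IsInternal gr') {f : List (Letter gr) → Letter gr'}
    (hf : IsMultilin k fun w => (f w).val) {F : List (Letter gr') → N} (hF : IsMultilin k F) :
    IsMultilin k (hat f F) := by
  intro a b i
  simp only [hat_append_cons]
  refine IsLinearMap.sumSplit fun a₁ a₂ _ => IsLinearMap.sumSplit fun b₁ b₂ _ =>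
    IsLinearMap.hat _ fun l => IsLinearMap.hat _ fun l' => ?_
  exact (hF l l').comp h' (hf a₂ b₁ i)

theorem isMultilin_insOp (h : DirectSum.IsInternal gr) {m : List (Letter gr) → Letter gr}
    (hm : IsMultilin k fun w => (m w).val) {F : List (Letter gr) → N} (hF : IsMultilin k F) :
    IsMultilin k (insOp sdeg m F) := by
  intro a b i
  simp only [insOp, sumSplit₃_append_cons, wd_append, wd_cons, sdeg_mk]
  refine ((IsLinearMap.sumSplit₃ fun p q r _ => ?_).add_fun
    (IsLinearMap.sumSplit fun p q _ => IsLinearMap.sumSplit fun r s _ => ?_)).add_fun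
    (IsLinearMap.sumSplit₃ fun p q r _ => ?_)
  · refine IsLinearMap.ksign_smul _ ?_
    simpa only [List.append_assoc, List.cons_append] using hF (p ++ m q :: r) b i
  · exact IsLinearMap.ksign_smul _ ((hF p s).comp h (hm q r i))
  · refine IsLinearMap.ksign_smul _ ?_
    simpa only [List.append_assoc, List.cons_append] using hF a (p ++ m q :: r) i

/-- A linear functional may be applied to an identity between sums over the blocks and over the
subwords of a word. -/
theorem hat_eq_insOp_of_val (h' : DirectSum.IsInternal gr') {f : List (Letter gr) → Letter gr'}
    {m : List (Letter gr) → Letter gr} {mY : List (Letter gr') → Letter gr'}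
    {w : List (Letter gr)} {E : Letter gr'}
    (hrel : hat f (fun u => (mY u).val) w = insOp sdeg m (fun u => (f u).val) w + E.val)
    {g : Letter gr' → N} (hg : IsLin k g) :
    hat f (fun u => g (mY u)) w = insOp sdeg m (fun u => g (f u)) w + g E := by
  obtain ⟨L, hL⟩ := exists_linear_of_isLin h' hg
  simp only [hL, insOp, ← map_hat, hrel, map_add, map_sumSplit₃, map_ksign_smul]

variable (k) in
/-- Multilinearity of one-forms. -/
structure IsForm (G : List (Letter gr) → Letter gr → N) : Prop where
  word : ∀ x, IsMultilin k fun w => G w x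
  last : ∀ w, IsLin k fun x => G w x

variable (k) in
/-- Multilinearity of two-forms. -/
structure IsForm₂ (Ω : List (Letter gr) → Letter gr → List (Letter gr) → Letter gr → N) :
    Prop where
  left : ∀ v c x, IsMultilin k fun a => Ω a v c x
  mid : ∀ a c x, IsLin k fun v => Ω a v c x
  right : ∀ a v x, IsMultilin k fun c => Ω a v c x
  last : ∀ a v c, IsLin k fun x => Ω a v c x

theorem IsLinearMap.neg_fun {f : V → N} (hf : IsLinearMap k f) : IsLinearMap k fun y => -f y :=
  (-hf.mk' f).isLinear

/-- Skew symmetry exchanges the two words and the two single letters, so half of the slots determine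
the rest. -/
theorem isForm₂_of_skewForm {Ω : List (Letter gr) → Letter gr → List (Letter gr) → Letter gr → N}
    (hs : SkewForm sdeg Ω) (h₁ : ∀ v c x, IsMultilin k fun a => Ω a v c x)
    (h₂ : ∀ a c x, IsLin k fun v => Ω a v c x) : IsForm₂ k Ω where
  left := h₁
  mid := h₂
  right a v x := by
    intro p q i
    simp only [hs a v, wd_append, wd_cons, sdeg_mk]
    exact ((h₁ x a v p q i).ksign_smul _).neg_fun
  last a v c := by
    intro i
    simp only [hs a v, sdeg_mk]
    exact ((h₂ c a v i).ksign_smul _).neg_fun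

theorem IsLinearMap.sumPos {α : Type*} {l : List α} {F : V → List α → α → List α → N}
    (hF : ∀ a x b, a ++ x :: b = l → IsLinearMap k fun y => F y a x b) :
    IsLinearMap k fun y => sumPos l (F y) := by
  induction l generalizing F with
  | nil => exact IsLinearMap.zero_fun
  | cons x l ih =>
    exact (hF [] x l rfl).add_fun (ih fun a z b h => hF (x :: a) z b (by simp [h]))

theorem isForm_potential {Ω : List (Letter gr) → Letter gr → List (Letter gr) → Letter gr → k}
    (hΩ : IsForm₂ k Ω) : IsForm k (potential Ω) where
  word x := by
    intro a b i
    simp only [potential, sumPos_append_cons, List.length_append, List.length_cons]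
    refine IsLinearMap.comp_linear (LinearMap.mulLeft k _)
      (((IsLinearMap.sumPos fun p y q _ => ?_).add_fun (hΩ.mid _ _ _ i)).add_fun
      (IsLinearMap.sumPos fun p y q _ => ?_))
    · exact hΩ.right p y x q b i
    · simpa only [List.append_assoc, List.cons_append] using hΩ.left y q x a p i
  last w := by
    intro i
    exact IsLinearMap.comp_linear (LinearMap.mulLeft k _)
      (IsLinearMap.sumPos fun a v c _ => hΩ.last a v c i)

theorem isForm₂_pullForm₂ (h' : DirectSum.IsInternal gr') {f : List (Letter gr) → Letter gr'}
    (hf : IsMultilin k fun w => (f w).val)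
    {Ω : List (Letter gr') → Letter gr' → List (Letter gr') → Letter gr' → N} (hΩ : IsForm₂ k Ω)
    (hs : SkewForm sdeg (pullForm₂ sdeg f Ω)) : IsForm₂ k (pullForm₂ sdeg f Ω) := by
  refine isForm₂_of_skewForm hs (fun v c x => ?_) (fun a c x => ?_)
  · intro a b i
    simp only [pullForm₂, sumSplit₃_append_cons, wd_append, wd_cons, sdeg_mk]
    refine ((IsLinearMap.sumSplit₃ fun p q r _ => ?_).add_fun
      (IsLinearMap.sumSplit fun p q _ => IsLinearMap.sumSplit fun r s _ => ?_)).add_fun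
      (IsLinearMap.sumSplit₃ fun p q r _ => ?_) <;>
    refine IsLinearMap.sumSplit₃ fun c₁ c₂ c₃ _ => IsLinearMap.ksign_smul _ ?_
    · refine IsLinearMap.hat _ fun l => IsLinearMap.hat _ fun l' => (hΩ.mid _ _ _).comp h' ?_
      simpa only [List.append_assoc, List.cons_append] using hf r (b ++ v :: c₁) i
    · refine isMultilin_hat h' hf (F := fun l => hat f (fun l' => _) _) ?_ q r i
      exact fun l₁ l₂ j => IsLinearMap.hat _ fun l' => hΩ.left _ _ _ l₁ l₂ j
    · refine IsLinearMap.hat _ fun l => IsLinearMap.hat _ fun l' => (hΩ.last _ _ _).comp h' ?_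
      simpa only [List.append_assoc, List.cons_append] using hf (c₃ ++ x :: a) p i
  · intro i
    simp only [pullForm₂, sdeg_mk]
    refine IsLinearMap.sumSplit₃ fun a₁ a₂ a₃ _ => IsLinearMap.sumSplit₃ fun c₁ c₂ c₃ _ =>
      IsLinearMap.ksign_smul _ (IsLinearMap.hat _ fun l => IsLinearMap.hat _ fun l' =>
        (hΩ.mid _ _ _).comp h' (hf a₃ c₁ i))

end Closure

/-! ### Homogeneous multilinear operations on letters -/

section Ops

variable {k : Type*} [Field k] {V W : Type*} [AddCommGroup V] [Module k V] [AddCommGroup W]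
  [Module k W]

/-- A sequence of multilinear operations, shifting the degree by a constant, on homogeneous
letters. -/
@[ext]
structure Op (gr : ℤ → Submodule k V) (gr' : ℤ → Submodule k W) (s : ℤ) where
  toFun : List (Letter gr) → W
  mem : ∀ l, toFun l ∈ gr' (wd sdeg l + s)
  multilin : IsMultilin k toFun

namespace Op

variable {gr : ℤ → Submodule k V} {gr' : ℤ → Submodule k W} {s : ℤ}

/-- The value of an operation, as a letter. -/
def letter (f : Op gr gr' s) (l : List (Letter gr)) : Letter gr' :=
  ⟨wd sdeg l + s, f.toFun l, f.mem l⟩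

@[simp] theorem val_letter (f : Op gr gr' s) (l : List (Letter gr)) :
    (f.letter l).val = f.toFun l := rfl

/-- Offset `1` in unshifted degrees is degree zero after the shift, the case of morphisms; offset
`2` is the odd shifted degree of the structure maps. -/
theorem sdeg_letter_one (f : Op gr gr' 1) (l : List (Letter gr)) :
    sdeg (f.letter l) = wd sdeg l := by
  simp [letter]

theorem sdeg_letter_two (f : Op gr gr' 2) (l : List (Letter gr)) :
    sdeg (f.letter l) = wd sdeg l + 1 := by
  simp only [letter, sdeg_mk]
  ring

/-- Restriction of an operation to the words satisfying a condition on the length. -/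
def restrictLength (f : Op gr gr' s) (P : ℕ → Prop) [DecidablePred P] : Op gr gr' s where
  toFun l := if P l.length then f.toFun l else 0
  mem l := by
    split_ifs
    · exact f.mem l
    · exact zero_mem _
  multilin a b i := by
    simp only [List.length_append, List.length_cons]
    split_ifs
    · exact f.multilin a b i
    · exact IsLinearMap.zero_fun

theorem restrictLength_toFun (f : Op gr gr' s) (P : ℕ → Prop) [DecidablePred P]
    (l : List (Letter gr)) : (f.restrictLength P).toFun l = if P l.length then f.toFun l else 0 :=
  rfl

/-- The sum of two operations. -/
def add (f g : Op gr gr' s) : Op gr gr' s where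
  toFun l := f.toFun l + g.toFun l
  mem l := add_mem (f.mem l) (g.mem l)
  multilin a b i := (f.multilin a b i).add_fun (g.multilin a b i)

end Op

end Ops

/-! ## A∞-structures as operations on letters -/

theorem wdeg_eq {k V : Type*} [Field k] [AddCommGroup V] [Module k V] {gr : ℤ → Submodule k V}
    (l : List (Letter gr)) : wdeg l = wd sdeg l := rfl

theorem sumSplit_apply {k V N α : Type*} [Field k] [AddCommGroup V] [Module k V]
    [AddCommGroup N] [Module k N] (l : List α) (F : List α → List α → V →ₗ[k] N) (y : V) :
    sumSplit l F y = sumSplit l fun a b => F a b y :=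
  LinearMap.sum_apply _ _ _

theorem sumBlocks_apply {k V N α : Type*} [Field k] [AddCommGroup V] [Module k V]
    [AddCommGroup N] [Module k N] (l : List α) (F : List (List α) → V →ₗ[k] N) (y : V) :
    sumBlocks l F y = sumBlocks l fun L => F L y :=
  LinearMap.sum_apply _ _ _

namespace AInfAlgebra

variable {k : Type uk} [Field k]

/-- The operations of an A∞-algebra. -/
def op (A : AInfAlgebra.{uk, u} k) : Op A.gr A.gr 2 where
  toFun l := evalWord A.m (vals l)
  mem l := A.m_degree l
  multilin := isMultilin_evalWord A.m

theorem op_nil (A : AInfAlgebra.{uk, u} k) : A.op.toFun [] = 0 := by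
  change A.m 0 _ = 0
  rw [A.m_zero]
  rfl

theorem insOp_op (A : AInfAlgebra.{uk, u} k) (w : List (Letter A.gr)) :
    insOp sdeg A.op.letter A.op.toFun w = 0 := by
  refine Eq.trans (sumSplit₃_congr fun a b c _ => ?_) (A.m_rel w)
  simp [op, vals_append, vals_cons, wdeg, wd]

/-- An A∞-algebra from operations on letters. -/
theorem exists_of_op {V : Type u} [AddCommGroup V] [Module k V] {gr : ℤ → Submodule k V}
    (h : DirectSum.IsInternal gr) (m : Op gr gr 2) (h0 : m.toFun [] = 0)
    (hm : ∀ w, insOp sdeg m.letter m.toFun w = 0) :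
    ∃ g : ∀ n : ℕ, MultilinearMap k (fun _ : Fin n => V) V,
      (∀ l, evalWord g (vals l) = m.toFun l) ∧ g 0 = 0 ∧
      (∀ l : List (Letter gr), evalWord g (vals l) ∈ gr (wdeg l + 2)) ∧
      ∀ l : List (Letter gr), sumSplit₃ l (fun a b c =>
        ksign (wdeg a) • evalWord g (vals a ++ evalWord g (vals b) :: vals c)) = 0 := by
  obtain ⟨g, hg⟩ := exists_multilinear h m.multilin
  refine ⟨g, hg, ?_, fun l => ?_, fun l => ?_⟩
  · ext x
    rw [zero_apply, ← h0, ← hg]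
    exact congrArg (g 0) (Subsingleton.elim _ _)
  · rw [hg]
    exact m.mem l
  · rw [← hm l]
    refine sumSplit₃_congr fun a b c _ => ?_
    rw [← hg (a ++ m.letter b :: c), vals_append, vals_cons, Op.val_letter, hg b]
    rfl

theorem d_apply (A : AInfAlgebra.{uk, u} k) (x : A) : A.d x = evalWord A.m [x] := by
  change A.m 1 _ = A.m 1 _
  congr 1
  funext i
  have : i = 0 := Subsingleton.elim _ _
  subst this
  rfl

theorem d_val (A : AInfAlgebra.{uk, u} k) (x : Letter A.gr) : A.d x.val = A.op.toFun [x] :=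
  A.d_apply _

theorem d_mem (A : AInfAlgebra.{uk, u} k) {i : ℤ} {x : A} (hx : x ∈ A.gr i) :
    A.d x ∈ A.gr (i + 1) := by
  have := A.op.mem [⟨i, x, hx⟩]
  rw [← d_val] at this
  rwa [wd_cons, wd_nil, sdeg_mk, show i - 1 + 0 + 2 = i + 1 by ring] at this

/-- The components of a family, on letters. -/
def Family.form {A : AInfAlgebra.{uk, u} k} (φ : A.Family) (a : List (Letter A.gr))
    (v : Letter A.gr) (c : List (Letter A.gr)) (x : Letter A.gr) : k :=
  φ.ev (vals a) v.val (vals c) x.val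

theorem Family.isForm₂_form {A : AInfAlgebra.{uk, u} k} (φ : A.Family) : IsForm₂ k φ.form where
  left v c x := isMultilin_evalWord fun p =>
    { toFun := fun a => φ p (vals c).length a (vals c).get v.val x.val
      map_update_add' := fun a i y y' => by rw [(φ p _).map_update_add]; rfl
      map_update_smul' := fun a i r y => by rw [(φ p _).map_update_smul]; rfl }
  mid a c x := isLin_of_linear (((φ (vals a).length (vals c).length (vals a).get
    (vals c).get)).flip x.val)
  right a v x := isMultilin_evalWord fun q =>
    { toFun := fun c => φ (vals a).length q (vals a).get c v.val x.val
      map_update_add' := fun c i y y' => by rw [(φ _ q _).map_update_add]; rfl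
      map_update_smul' := fun c i r y => by rw [(φ _ q _).map_update_smul]; rfl }
  last a v c := isLin_of_linear (φ.ev (vals a) v.val (vals c))

/-- The bilinear form `φ_{0,0}`. -/
def Family.form₀ {A : AInfAlgebra.{uk, u} k} (φ : A.Family) : A →ₗ[k] Module.Dual k A :=
  φ 0 0 ([] : List A).get ([] : List A).get

theorem Family.form₀_apply {A : AInfAlgebra.{uk, u} k} (φ : A.Family) (a b : A) :
    φ.form₀ a b = φ.ev [] a [] b := rfl

/-- The bimodule equation is invariance of the two-form under the vector field `m`. -/
theorem DualBimoduleMap.lieForm₂_eq_zero {A : AInfAlgebra.{uk, u} k} {e : ℤ}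
    (φ : A.DualBimoduleMap e) (a : List (Letter A.gr)) (v : Letter A.gr)
    (c : List (Letter A.gr)) (x : Letter A.gr) :
    lieForm₂ sdeg A.op.letter φ.family.form a v c x = 0 := by
  have h := φ.rel a v c x
  rw [← sub_eq_zero] at h
  rw [← h, lieForm₂, sub_eq_add_neg]
  congr 1
  · refine congrArg₂ _ (congrArg₂ _ ?_ ?_) ?_
    · refine sumSplit_congr fun a₁ a₂ _ => sumSplit_congr fun c₁ c₂ _ => ?_
      simp only [Family.form, Op.val_letter, op, vals_append, vals_cons]
      rfl
    · refine sumSplit₃_congr fun a₁ a₂ a₃ _ => ?_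
      simp only [Family.form, Op.val_letter, op, vals_append, vals_cons]
      rfl
    · refine sumSplit₃_congr fun a₁ a₂ a₃ _ => ?_
      simp only [Family.form, Op.val_letter, op, vals_append, vals_cons]
      rfl
  -- The operation of the dual bimodule, brought to the left-hand side, is the fourth sum of
  -- `lieForm₂`: it applies `m` to a cyclic subword around `x`.
  · rw [eq_neg_iff_add_eq_zero, smul_sumSplit, ← sumSplit_add]
    refine sumSplit_eq_zero fun a₁ a₂ ha => ?_
    rw [smul_sumSplit, ← sumSplit_add]
    refine sumSplit_eq_zero fun c₁ c₂ hc => ?_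
    have h1 : φ.family.form a₂ v c₁ (A.op.letter (c₂ ++ x :: a₁)) =
        φ.family.ev (vals a₂) v.val (vals c₁) (evalWord A.m (vals c₂ ++ x.val :: vals a₁)) := by
      simp only [Family.form, Op.val_letter, op, vals_append, vals_cons]
    rw [h1, dualOp, smul_neg, smul_neg, ← sub_eq_add_neg, sub_eq_zero, ksign_smul_smul,
      ksign_smul_smul, ← hc]
    simp only [wdeg_eq, wd_append]
    refine ksign_smul_congr ?_ _
    push_cast
    generalize (wd sdeg a₁ : ZMod 2) = A
    generalize (wd sdeg a₂ : ZMod 2) = B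
    generalize (sdeg v : ZMod 2) = C
    generalize (wd sdeg c₁ : ZMod 2) = D
    generalize (wd sdeg c₂ : ZMod 2) = E
    generalize (sdeg x : ZMod 2) = F
    generalize (e : ZMod 2) = G
    decide +revert

/-- The form of a cyclic inner product, on letters. -/
def constForm {V : Type*} [AddCommGroup V] [Module k V] {gr : ℤ → Submodule k V}
    (β : V →ₗ[k] Module.Dual k V) :
    List (Letter gr) → Letter gr → List (Letter gr) → Letter gr → k
  | [], v, [], x => β v.val x.val
  | _, _, _, _ => 0

theorem CyclicInnerProduct.form_family {B : AInfAlgebra.{uk, u} k} {e : ℤ}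
    (ψ : B.CyclicInnerProduct e) : ψ.family.form = constForm ψ.form := by
  funext a v c x
  rcases a with _ | ⟨_, a⟩ <;> rcases c with _ | ⟨_, c⟩ <;> rfl

end AInfAlgebra

namespace AInfHom

variable {k : Type uk} [Field k] {A : AInfAlgebra.{uk, u} k} {B : AInfAlgebra.{uk, v} k}

/-- The components of an A∞-morphism. -/
def op (f : AInfHom A B) : Op A.gr B.gr 1 where
  toFun l := evalWord f.f (vals l)
  mem l := f.f_degree l
  multilin := isMultilin_evalWord f.f

theorem hat_op (f : AInfHom A B) (w : List (Letter A.gr)) :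
    hat f.op.letter B.op.toFun w = insOp sdeg A.op.letter f.op.toFun w := by
  refine Eq.trans ?_ ((f.f_rel w).trans (sumSplit₃_congr fun a b c _ => ?_))
  · refine sumBlocks_congr fun L _ _ => ?_
    simp only [AInfAlgebra.op, vals, List.map_map]
    rfl
  · simp [AInfAlgebra.op, op, vals_append, vals_cons, wdeg, wd]

/-- The composite cuts both words into three parts: the parts next to `v` enter `f̃`, the middle
parts are cut into blocks, and the outer parts enter `f̃*` together with `x`. -/
theorem pullback_eq (f : AInfHom A B) (e : ℤ) (ψ : B.Family) (a : List (Letter A.gr))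
    (v : Letter A.gr) (c : List (Letter A.gr)) (x : Letter A.gr) :
    f.pullback e ψ a v c x = pullForm₂ sdeg f.op.letter ψ.form a v c x := by
  simp only [pullForm₂, sumSplit₃, sumSplit_assoc (l := c)]
  refine sumSplit_congr fun a₁ a' _ => ?_
  rw [sumSplit_comm a' c]
  refine sumSplit_congr fun c' c₃ hc => ?_
  rw [tildeDual, ksign_smul_smul, compTilde, sumSplit_apply, smul_sumSplit]
  refine sumSplit_congr fun a₂ a₃ ha => ?_
  rw [sumSplit_apply, smul_sumSplit]
  refine sumSplit_congr fun c₁ c₂ hc' => ?_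
  rw [restrict, sumBlocks_apply, ← hc, ← hc', ← ha]
  have h1 : (sumBlocks a₂ fun L => (sumBlocks c₂ fun R =>
        ψ.ev (L.map fun b => evalWord f.f (vals b)) (f.tilde a₃ v.val c₁)
          (R.map fun b => evalWord f.f (vals b))) (f.tilde c₃ x.val a₁)) =
      hat f.op.letter (fun l => hat f.op.letter (fun l' =>
        ψ.form l (f.op.letter (a₃ ++ v :: c₁)) l' (f.op.letter (c₃ ++ x :: a₁))) c₂) a₂ := by
    refine sumBlocks_congr fun L _ _ => ?_
    rw [sumBlocks_apply]
    refine sumBlocks_congr fun R _ _ => ?_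
    simp only [AInfAlgebra.Family.form, Op.val_letter, op, vals, List.map_map, tilde,
      List.map_append, List.map_cons]
    rfl
  rw [h1]
  simp only [wdeg_eq, wd_append]
  refine ksign_smul_congr ?_ _
  push_cast
  generalize (wd sdeg a₁ : ZMod 2) = A
  generalize (wd sdeg a₂ : ZMod 2) = B
  generalize (wd sdeg a₃ : ZMod 2) = C
  generalize (sdeg v : ZMod 2) = D
  generalize (wd sdeg c₁ : ZMod 2) = E
  generalize (wd sdeg c₂ : ZMod 2) = F
  generalize (wd sdeg c₃ : ZMod 2) = G
  generalize (sdeg x : ZMod 2) = H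
  generalize (e : ZMod 2) = I
  decide +revert

theorem exists_of_op (hA : DirectSum.IsInternal A.gr) (f : Op A.gr B.gr 1) (h0 : f.toFun [] = 0)
    (hf : ∀ w, hat f.letter B.op.toFun w = insOp sdeg A.op.letter f.toFun w) :
    ∃ F : AInfHom A B, F.op = f := by
  obtain ⟨g, hg⟩ := exists_multilinear hA f.multilin
  refine ⟨⟨g, ?_, fun l => ?_, fun l => ?_⟩, ?_⟩
  · ext x
    rw [zero_apply, ← h0, ← hg]
    exact congrArg (g 0) (Subsingleton.elim _ _)
  · rw [hg]
    exact f.mem l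
  · refine Eq.trans ?_ ((hf l).trans (sumSplit₃_congr fun a b c _ => ?_))
    · refine sumBlocks_congr fun L _ _ => ?_
      simp only [AInfAlgebra.op, vals, List.map_map]
      congr 1
      refine List.map_congr_left fun b _ => hg b
    · rw [← hg (a ++ A.op.letter b :: c), vals_append, vals_cons]
      rfl
  · ext l
    exact hg l

end AInfHom

/-! ### Homogeneous components and bilinear forms of fixed degree -/

section Components

variable {k : Type*} [Field k] {V W : Type*} [AddCommGroup V] [Module k V] [AddCommGroup W]
  [Module k W] {gr : ℤ → Submodule k V} {gr' : ℤ → Submodule k W}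

theorem IsMultilin.eq_zero (h : DirectSum.IsInternal gr) {F : List (Letter gr) → W}
    (hF : IsMultilin k F) {y : Letter gr} (hy : y.val = 0) (l l' : List (Letter gr)) :
    F (l ++ y :: l') = 0 :=
  (hF l l').eq_zero h hy

theorem insOp_singleton (h : DirectSum.IsInternal gr) {m : List (Letter gr) → Letter gr}
    (hm : (m []).val = 0) {F : List (Letter gr) → W} (hF : IsMultilin k F) (y : Letter gr) :
    insOp sdeg m F [y] = F [m [y]] := by
  have h1 : F [m [], y] = 0 := hF.eq_zero h hm [] [y]
  have h2 : F [y, m []] = 0 := hF.eq_zero h hm [y] []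
  simp [insOp, sumSplit₃, sumSplit_cons, sumSplit_nil, h1, h2]

theorem hat_singleton {X Y N : Type*} [AddCommMonoid N] (f : List X → Y) (F : List Y → N) (x : X) :
    hat f F [x] = F [f [x]] := by
  rw [hat_cons, sumSplit_nil, hat_nil]

/-- The projection to a homogeneous component. -/
noncomputable def homComp (h : DirectSum.IsInternal gr) (i : ℤ) : V →ₗ[k] V :=
  (gr i).subtype ∘ₗ DirectSum.component k ℤ (fun i => gr i) i ∘ₗ (decomp h).toLinearMap

theorem homComp_mem (h : DirectSum.IsInternal gr) (i : ℤ) (x : V) : homComp h i x ∈ gr i :=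
  Subtype.property _

theorem homComp_of_mem (h : DirectSum.IsInternal gr) {i : ℤ} {x : V} (hx : x ∈ gr i) :
    homComp h i x = x := by
  have := decomp_coe h ⟨x, hx⟩
  simp only at this
  simp [homComp, this, DirectSum.component.lof_self]

theorem homComp_of_ne (h : DirectSum.IsInternal gr) {i j : ℤ} {x : V} (hx : x ∈ gr j)
    (hij : j ≠ i) : homComp h i x = 0 := by
  have := decomp_coe h ⟨x, hx⟩
  simp only at this
  simp [homComp, this, DirectSum.component.of, hij]

theorem mem_of_homComp_mem (h : DirectSum.IsInternal gr) {S : Submodule k V} {x : V}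
    (hx : ∀ i, homComp h i x ∈ S) : x ∈ S := by
  classical
  have h1 : x = DirectSum.coeLinearMap gr (decomp h x) := ((decomp h).symm_apply_apply x).symm
  rw [h1, DirectSum.coeLinearMap_eq_dfinsuppSum, DFinsupp.sum]
  exact S.sum_mem fun i _ => hx i

theorem homComp_map (h : DirectSum.IsInternal gr) (h' : DirectSum.IsInternal gr')
    {L : V →ₗ[k] W} {s : ℤ} (hL : ∀ i x, x ∈ gr i → L x ∈ gr' (i + s)) (i : ℤ) (x : V) :
    homComp h' (i + s) (L x) = L (homComp h i x) := by
  have : homComp h' (i + s) ∘ₗ L = L ∘ₗ homComp h i := by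
    refine linear_ext_letter h fun ⟨j, y⟩ => ?_
    by_cases hij : j = i
    · subst hij
      simp [homComp_of_mem h y.2, homComp_of_mem h' (hL _ _ y.2)]
    · have : j + s ≠ i + s := fun h => hij (by linarith)
      simp [homComp_of_ne h y.2 hij, homComp_of_ne h' (hL _ _ y.2) this]
  exact LinearMap.congr_fun this x

/-- A bilinear form of degree `e` for the shifted degrees. -/
def FormDegree (gr : ℤ → Submodule k V) (e : ℤ) (β : V →ₗ[k] Module.Dual k V) : Prop :=
  ∀ x y : Letter gr, sdeg x + sdeg y + e ≠ 0 → β x.val y.val = 0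

/-- A nonzero pairing of degrees `i` and `j` needs `(i - 1) + (j - 1) + e = 0`; hence the
complementary degree `2 - e - j` here and below. -/
theorem FormDegree.apply_right (h : DirectSum.IsInternal gr) {e : ℤ}
    {β : V →ₗ[k] Module.Dual k V} (hβ : FormDegree gr e β) {j : ℤ} (x : V) {y : V}
    (hy : y ∈ gr j) : β x y = β (homComp h (2 - e - j) x) y := by
  have : β.flip y = β.flip y ∘ₗ homComp h (2 - e - j) := by
    refine linear_ext_letter h fun ⟨i, z⟩ => ?_
    by_cases hij : i = 2 - e - j
    · subst hij
      simp [homComp_of_mem h z.2]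
    · have := hβ ⟨i, z⟩ ⟨j, y, hy⟩ (by simp only [sdeg_mk]; omega)
      simp only [val_mk] at this
      simp [homComp_of_ne h z.2 hij, this]
  exact LinearMap.congr_fun this x

theorem FormDegree.apply_left (h : DirectSum.IsInternal gr) {e : ℤ}
    {β : V →ₗ[k] Module.Dual k V} (hβ : FormDegree gr e β) {j : ℤ} {x : V} (y : V)
    (hx : x ∈ gr j) : β x y = β x (homComp h (2 - e - j) y) := by
  have : FormDegree gr e β.flip := fun z w hzw => hβ w z (by rwa [add_comm (sdeg w)])
  exact this.apply_right h y hx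

end Components

/-! ### Constant two-forms, and cyclic inner products on cohomology -/

namespace AInfAlgebra

variable {k : Type uk} [Field k]

section ConstForm

variable {V : Type*} [AddCommGroup V] [Module k V] {gr : ℤ → Submodule k V}

theorem skewForm_constForm {β : V →ₗ[k] Module.Dual k V}
    (hβ : ∀ x y : Letter gr, β x.val y.val = -(ksign (sdeg x * sdeg y) • β y.val x.val)) :
    SkewForm sdeg (constForm (gr := gr) β) := by
  intro a v b w
  rcases a with _ | ⟨_, a⟩ <;> rcases b with _ | ⟨_, b⟩
  · simpa [constForm] using hβ v w
  all_goals simp [constForm]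

/-- Each of the three terms has one of the marked letters inside its left word, where a constant
form vanishes. -/
theorem closedForm_constForm (β : V →ₗ[k] Module.Dual k V) :
    ClosedForm sdeg (constForm (gr := gr) β) := by
  intro α β' γ δ x y z
  have h1 : ∀ (p q : List (Letter gr)) (u v w : Letter gr) (r : List (Letter gr)),
      constForm β (p ++ u :: q) v r w = 0 := by
    intro p q u v w r
    rcases p with _ | ⟨_, p⟩ <;> rfl
  rw [List.append_assoc, List.cons_append, h1, h1, h1]
  simp

theorem isForm₂_constForm {β : V →ₗ[k] Module.Dual k V}
    (hβ : SkewForm sdeg (constForm (gr := gr) β)) : IsForm₂ k (constForm (gr := gr) β) := by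
  refine isForm₂_of_skewForm hβ (fun v c x a b i => ?_) fun a c x => ?_
  · have : (fun y : gr i => constForm β (a ++ ⟨i, y⟩ :: b) v c x) = fun _ => 0 := by
      funext y
      rcases a with _ | ⟨_, a⟩ <;> rfl
    rw [this]
    exact IsLinearMap.zero_fun
  · rcases a with _ | ⟨_, a⟩ <;> rcases c with _ | ⟨_, c⟩
    · exact isLin_of_linear (β.flip x.val)
    all_goals exact fun i => IsLinearMap.zero_fun

end ConstForm

theorem DualBimoduleMap.skewSymmetric_iff {A : AInfAlgebra.{uk, u} k} {e : ℤ}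
    (φ : A.DualBimoduleMap e) : φ.SkewSymmetric ↔ SkewForm sdeg φ.family.form := Iff.rfl

theorem DualBimoduleMap.closed_iff {A : AInfAlgebra.{uk, u} k} {e : ℤ}
    (φ : A.DualBimoduleMap e) : φ.Closed ↔ ClosedForm sdeg φ.family.form := Iff.rfl

theorem DualBimoduleMap.formDegree {A : AInfAlgebra.{uk, u} k} {e : ℤ}
    (φ : A.DualBimoduleMap e) : FormDegree A.gr e φ.family.form₀ := by
  intro x y h
  exact φ.degree [] x [] y (by simpa [wdeg] using h)

theorem d_d (A : AInfAlgebra.{uk, u} k) (x : A) : A.d (A.d x) = 0 := by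
  have : A.d ∘ₗ A.d = 0 := by
    refine linear_ext_letter A.isInternal fun y => ?_
    have h := A.insOp_op [y]
    rw [insOp_singleton (m := A.op.letter) A.isInternal A.op_nil A.op.multilin, ← d_val, Op.val_letter, ← d_val] at h
    exact h
  exact LinearMap.congr_fun this x

theorem exists_homComp_notMem_range (A : AInfAlgebra.{uk, u} k) {a : A} (ha : A.d a = 0)
    (ha' : a ∉ LinearMap.range A.d) : ∃ i, A.d (homComp A.isInternal i a) = 0 ∧
      homComp A.isInternal i a ∉ LinearMap.range A.d := by
  by_contra! hcon
  refine ha' (mem_of_homComp_mem A.isInternal fun i => hcon i ?_)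
  rw [← homComp_map A.isInternal A.isInternal fun i x hx => A.d_mem hx, ha, map_zero]

namespace CyclicInnerProduct

variable {B : AInfAlgebra.{uk, u} k} {e : ℤ} (ψ : B.CyclicInnerProduct e)

theorem form_d_letter (x y : Letter B.gr) :
    ψ.form (B.d x.val) y.val = ksign (sdeg x * sdeg y) • ψ.form (B.d y.val) x.val := by
  have h := ψ.cyclic x [] y
  simpa [d_apply, vals, wdeg] using h

theorem skew_mem {i j : ℤ} {x y : B} (hx : x ∈ B.gr i) (hy : y ∈ B.gr j) :
    ψ.form x y = -(ksign ((i - 1) * (j - 1)) • ψ.form y x) :=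
  ψ.skew ⟨i, x, hx⟩ ⟨j, y, hy⟩

/-- Cyclicity for `n = 1`, combined with skew symmetry, moves the differential from `y` to the
cocycle `z`. -/
theorem form_d_eq_zero {i : ℤ} {z : B} (hz : z ∈ B.gr i) (hd : B.d z = 0) (y : B) :
    ψ.form z (B.d y) = 0 := by
  have : ψ.form z ∘ₗ B.d = 0 := by
    refine linear_ext_letter B.isInternal fun y => ?_
    have h := ψ.form_d_letter y ⟨i, z, hz⟩
    simp only [val_mk, hd, map_zero, LinearMap.zero_apply, smul_zero] at h
    simp only [LinearMap.comp_apply, LinearMap.zero_apply]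
    rw [ψ.skew_mem (y := B.d y.val) hz (B.d_mem y.2.2), h, smul_zero, neg_zero]
  exact LinearMap.congr_fun this y

/-- A homogeneous cocycle orthogonal to all homogeneous cocycles is exact. -/
theorem mem_range_d_of_orthogonal {i : ℤ} {z : B} (hz : z ∈ B.gr i)
    (h : ∀ y ∈ B.gr (2 - e - i), B.d y = 0 → ψ.form z y = 0) : z ∈ LinearMap.range B.d := by
  set j := 2 - e - i with hj
  let D : B.gr j →ₗ[k] B.gr (j + 1) := B.d.restrict fun x hx => B.d_mem hx
  -- The functional `⟨z, ·⟩` kills the cocycles of the complementary degree `j`, hence factors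
  -- through `D`, and the factor extends from the range of `D` to all of `B.gr (j + 1)`.
  obtain ⟨ξ, hξ⟩ : ∃ ξ : Module.Dual k (B.gr (j + 1)), ξ ∘ₗ D = ψ.form z ∘ₗ (B.gr j).subtype := by
    have hmem : ψ.form z ∘ₗ (B.gr j).subtype ∈ LinearMap.range D.dualMap := by
      rw [LinearMap.range_dualMap_eq_dualAnnihilator_ker, Submodule.mem_dualAnnihilator]
      intro y hy
      exact h y y.2 (congrArg Subtype.val (LinearMap.mem_ker.1 hy))
    obtain ⟨ξ, hξ⟩ := hmem
    exact ⟨ξ, hξ⟩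
  -- Nondegeneracy represents `ξ` by `w`, whose component of the right degree is, up to sign, the
  -- primitive of `z`.
  obtain ⟨w, hw⟩ := ψ.nondegenerate.2 (j + 1) ξ
  have hdeg : FormDegree B.gr e ψ.form := ψ.degree
  set w' := homComp B.isInternal (2 - e - (j + 1)) w with hw'
  have hwm : w' ∈ B.gr (2 - e - (j + 1)) := homComp_mem _ _ _
  have hw2 : ∀ y ∈ B.gr j, ψ.form w' (B.d y) = ψ.form z y := by
    intro y hy
    have h1 := hw (D ⟨y, hy⟩)
    rw [hdeg.apply_right B.isInternal w (D ⟨y, hy⟩).2] at h1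
    have h2 := LinearMap.congr_fun hξ ⟨y, hy⟩
    exact h1.trans h2
  have hdw : B.d w' ∈ B.gr i := by
    have := B.d_mem hwm
    rwa [show 2 - e - (j + 1) + 1 = i by omega] at this
  obtain ⟨n, hn⟩ : ∃ n : ℤ, ∀ y ∈ B.gr j, ψ.form (z - ksign n • B.d w') y = 0 := by
    -- The summands are the minus sign and the exponent of skew symmetry for `w'` and `d y`, then
    -- the exponent of cyclicity for `y` and `w'`.
    refine ⟨1 + (2 - e - (j + 1) - 1) * (j + 1 - 1) + (j - 1) * (2 - e - (j + 1) - 1),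
      fun y hy => ?_⟩
    have h1 := hw2 y hy
    rw [ψ.skew_mem hwm (B.d_mem hy)] at h1
    have h2 := ψ.form_d_letter ⟨j, y, hy⟩ ⟨_, w', hwm⟩
    simp only [val_mk, sdeg_mk] at h2
    rw [h2, ksign_smul_smul, neg_ksign_smul] at h1
    rw [map_sub, LinearMap.sub_apply, ← h1, sub_eq_zero, ← LinearMap.flip_apply ψ.form,
      ← LinearMap.flip_apply ψ.form, map_ksign_smul]
    congr 2
    ring
  have hz0 : z - ksign n • B.d w' = 0 := by
    by_contra hne
    obtain ⟨b, hb⟩ := ψ.nondegenerate.1 _ hne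
    have hm : z - ksign n • B.d w' ∈ B.gr i := by
      refine sub_mem hz ?_
      rw [Units.smul_def]
      exact zsmul_mem hdw _
    rw [hdeg.apply_left B.isInternal b hm] at hb
    exact hb (hn _ (homComp_mem _ _ _))
  rw [sub_eq_zero.1 hz0, Units.smul_def]
  exact zsmul_mem (LinearMap.mem_range_self _ _) _

end CyclicInnerProduct

end AInfAlgebra

/-! ### Pullbacks of cyclic inner products (statement 2) -/

namespace AInfHom

variable {k : Type uk} [Field k] {A : AInfAlgebra.{uk, u} k} {B : AInfAlgebra.{uk, v} k}

/-- The linear part `f₁` of an A∞-morphism. -/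
def linear (f : AInfHom A B) : A →ₗ[k] B := (isLinearMap_evalWord f.f [] []).mk' _

theorem linear_apply (f : AInfHom A B) (x : A) : f.linear x = evalWord f.f [x] := rfl

theorem linear_mem (f : AInfHom A B) {i : ℤ} {x : A} (hx : x ∈ A.gr i) :
    f.linear x ∈ B.gr i := by
  have := f.op.mem [⟨i, x, hx⟩]
  rwa [wd_cons, wd_nil, sdeg_mk, show i - 1 + 0 + 1 = i by ring] at this

theorem linear_d (f : AInfHom A B) (x : A) : f.linear (A.d x) = B.d (f.linear x) := by
  have : f.linear ∘ₗ A.d = B.d ∘ₗ f.linear := by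
    refine linear_ext_letter A.isInternal fun y => ?_
    have h := f.hat_op [y]
    rw [insOp_singleton (m := A.op.letter) A.isInternal A.op_nil f.op.multilin, hat_singleton,
      ← AInfAlgebra.d_val, Op.val_letter] at h
    rw [LinearMap.comp_apply, AInfAlgebra.d_val]
    exact h.symm
  exact LinearMap.congr_fun this x

theorem pullForm₂_nil {X Y N : Type*} [AddCommGroup N] (d : X → ℤ) (f : List X → Y)
    (Ω : List Y → Y → List Y → Y → N) (v x : X) :
    pullForm₂ d f Ω [] v [] x = Ω [] (f [v]) [] (f [x]) := by
  simp [pullForm₂, sumSplit₃, sumSplit_nil, hat_nil]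

/-- Pullbacks of cyclic inner products along quasi-isomorphisms are strong homotopy inner
products. -/
theorem isStrongHomotopyInnerProduct_of_diagramCommutes [CharZero k] {e : ℤ}
    (φ : A.DualBimoduleMap e) (ψ : B.CyclicInnerProduct e) (f : AInfHom A B) (hf : f.IsQuasiIso)
    (hd : f.DiagramCommutes e φ.family ψ.family) : φ.IsStrongHomotopyInnerProduct := by
  have hφ : φ.family.form = pullForm₂ sdeg f.op.letter (AInfAlgebra.constForm ψ.form) := by
    funext a v c x
    rw [← ψ.form_family, ← f.pullback_eq e]
    exact hd a v c x
  have hψ : AInfAlgebra.constForm ψ.form =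
      dForm sdeg (potential (AInfAlgebra.constForm (gr := B.gr) ψ.form)) := by
    funext a v c x
    exact (dForm_potential _ (AInfAlgebra.skewForm_constForm ψ.skew)
      (AInfAlgebra.closedForm_constForm _) a v c x).symm
  -- The pullback of the exact form is the differential of the pulled back potential, so skew
  -- symmetry and closedness come for free.
  have hφ' : φ.family.form = dForm sdeg (pullForm sdeg f.op.letter
      (potential (AInfAlgebra.constForm (gr := B.gr) ψ.form))) := by
    funext a v c x
    rw [hφ, hψ]
    rw [pullForm₂_dForm sdeg f.op.sdeg_letter_one, ← hψ]
  refine ⟨?_, ?_, fun a ha ha' => ?_⟩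
  · rw [φ.skewSymmetric_iff, hφ']
    exact skewForm_dForm _ _
  · rw [φ.closed_iff, hφ']
    exact closedForm_dForm _ _
  · have h00 : ∀ x y : A, φ.family.form₀ x y = ψ.form (f.linear x) (f.linear y) := by
      have : φ.family.form₀ = ψ.form.compl₁₂ f.linear f.linear := by
        refine linear_ext_letter A.isInternal fun x => ?_
        refine linear_ext_letter A.isInternal fun y => ?_
        have := congrFun (congrFun (congrFun (congrFun hφ []) x) []) y
        rw [pullForm₂_nil] at this
        exact this
      intro x y
      rw [this]
      rfl
    obtain ⟨i, hi, hi'⟩ := A.exists_homComp_notMem_range ha ha'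
    set a' := homComp A.isInternal i a
    have hai : a' ∈ A.gr i := homComp_mem _ _ _
    have hfd : B.d (f.linear a') = 0 := by rw [← f.linear_d, hi, map_zero]
    have hfn : f.linear a' ∉ LinearMap.range B.d := by
      rintro ⟨b, hb⟩
      exact hi' (hf.1 a' hi ⟨b, hb⟩)
    obtain ⟨y, hy, hdy, hne⟩ : ∃ y ∈ B.gr (2 - e - i), B.d y = 0 ∧ ψ.form (f.linear a') y ≠ 0 := by
      by_contra! hcon
      exact hfn (ψ.mem_range_d_of_orthogonal (f.linear_mem hai) hcon)
    -- The cocycle `y` is replaced by the image of a cocycle of `A`; the exact remainder pairs to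
    -- zero with the cocycle `f₁ a'`.
    obtain ⟨b, b', hb, hyb⟩ := hf.2 y hdy
    have h1 : φ.family.form₀ a' b ≠ 0 := by
      rw [hyb, map_add, ψ.form_d_eq_zero (f.linear_mem hai) hfd, add_zero] at hne
      rw [h00]
      exact hne
    -- Passing to the component of `b` complementary to degree `i` allows `a'` to be replaced by the
    -- original, possibly inhomogeneous, `a`.
    rw [φ.formDegree.apply_left A.isInternal b hai] at h1
    refine ⟨homComp A.isInternal (2 - e - i) b, ?_, ?_⟩
    · rw [← homComp_map A.isInternal A.isInternal fun i x hx => A.d_mem hx, hb, map_zero]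
    · change φ.family.form₀ _ _ ≠ 0
      rw [φ.formDegree.apply_right A.isInternal a (homComp_mem _ _ _),
        show 2 - e - (2 - e - i) = i by ring]
      exact h1

end AInfHom

/-! ### Contributions of long blocks to sums over decompositions -/

section Sums

variable {α β N : Type*} [AddCommMonoid N]

theorem length_le_of_blocks {L : List (List α)} (hL : ∀ b ∈ L, b ≠ []) :
    L.length ≤ L.flatten.length := by
  induction L with
  | nil => simp
  | cons b L ih =>
    have h1 := ih fun b' hb' => hL b' (by simp [hb'])
    have h2 := List.length_pos_iff.2 (hL b (by simp))
    simp only [List.length_cons, List.flatten_cons, List.length_append]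
    omega

theorem length_block_le {L : List (List α)} {b : List α} (hb : b ∈ L) :
    b.length ≤ L.flatten.length :=
  (List.sublist_flatten_of_mem hb).length_le

theorem hat_congr_left {f f' : List α → β} {w : List α} (F : List β → N)
    (h : ∀ b : List α, b.length ≤ w.length → f b = f' b) : hat f F w = hat f' F w := by
  refine sumBlocks_congr fun L hL _ => ?_
  congr 1
  refine List.map_congr_left fun b hb => h b ?_
  rw [← hL]
  exact length_block_le hb

/-- If `F` vanishes on short words, only the finest decomposition contributes. -/
theorem hat_eq_finest (f : List α → β) (w : List α) (F : List β → N)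
    (hF : ∀ l : List β, l.length < w.length → F l = 0) :
    hat f F w = F (w.map fun y => f [y]) := by
  classical
  induction w generalizing F with
  | nil => exact hat_nil f F
  | cons x w ih =>
    rw [hat_cons]
    refine Eq.trans (sumSplit_congr fun a b hab => ?_) ((sumSplit_ite_left w fun a b =>
      hat f (fun l => F (f [x] :: l)) b).trans (ih _ fun l hl => hF _ (by simpa using hl)))
    split_ifs with ha
    · rw [ha]
    · refine (hat_congr f (F := fun l => F (f (x :: a) :: l)) (G := fun _ => 0)
        fun L hL hL' => hF _ ?_).trans (hat_zero f b)
      have h1 := length_le_of_blocks hL'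
      have h2 := List.length_pos_iff.2 ha
      rw [hL] at h1
      simp only [List.length_cons, List.length_map, ← hab, List.length_append]
      omega

theorem sumSplit₃_ite_left (l : List α) (F : List α → List α → List α → N)
    [∀ a : List α, Decidable (a = [])] :
    (sumSplit₃ l fun a b c => if a = [] ∧ b = [] then F a b c else 0) = F [] [] l := by
  rw [← sumSplit_ite_left l fun b c => F [] b c, ← sumSplit_ite_left l fun a l' =>
    sumSplit l' fun b c => if b = [] then F [] b c else 0]
  refine sumSplit_congr fun a b _ => ?_
  split_ifs with ha
  · simp [ha]
  · simp [ha, sumSplit_zero]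

theorem sumSplit₃_ite_right (l : List α) (F : List α → List α → List α → N)
    [∀ a : List α, Decidable (a = [])] :
    (sumSplit₃ l fun a b c => if b = [] ∧ c = [] then F a b c else 0) = F l [] [] := by
  rw [← sumSplit_ite_right l fun a b => F a b []]
  refine sumSplit_congr fun a l' _ => ?_
  rw [← sumSplit_ite_right l' fun b c => if b = [] then F a b c else 0]
  refine sumSplit_congr fun b c _ => ?_
  by_cases hb : b = [] <;> by_cases hc : c = [] <;> simp [hb, hc]

theorem sumSplit₃_ite_outer (l : List α) (F : List α → List α → List α → N)
    [∀ a : List α, Decidable (a = [])] :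
    (sumSplit₃ l fun a b c => if a = [] ∧ c = [] then F a b c else 0) = F [] l [] := by
  rw [← sumSplit_ite_right l fun b c => F [] b c, ← sumSplit_ite_left l fun a l' =>
    sumSplit l' fun b c => if c = [] then F [] b c else 0]
  refine sumSplit_congr fun a b _ => ?_
  split_ifs with ha
  · simp [ha]
  · simp [ha, sumSplit_zero]

theorem sumSplit₃_eq_single {l : List α} {F : List α → List α → List α → N}
    (h : ∀ a b c, a ++ (b ++ c) = l → b.length < l.length → F a b c = 0) :
    sumSplit₃ l F = F [] l [] := by
  classical
  rw [← sumSplit₃_ite_outer l F]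
  refine sumSplit₃_congr fun a b c habc => ?_
  split_ifs with hac
  · rfl
  · refine h a b c habc ?_
    have : ¬(a.length = 0 ∧ c.length = 0) := by simpa [List.length_eq_zero_iff] using hac
    rw [← habc]
    simp only [List.length_append]
    omega

end Sums

/-! ### Dependence on operations up to a given word length -/

section Update

variable {k : Type*} [Field k] {V W U : Type*} [AddCommGroup V] [Module k V] [AddCommGroup W]
  [Module k W] [AddCommGroup U] [Module k U] {gr : ℤ → Submodule k V} {gr' : ℤ → Submodule k W}
  {gr'' : ℤ → Submodule k U} {s t : ℤ}

theorem Op.letter_congr {f g : Op gr gr' s} {l : List (Letter gr)} (h : f.toFun l = g.toFun l) :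
    f.letter l = g.letter l := by
  simp only [Op.letter, h]

theorem letter_eq {y z : Letter gr} (h₁ : y.1 = z.1) (h₂ : y.val = z.val) : y = z := by
  rcases y with ⟨i, y⟩
  rcases z with ⟨j, z⟩
  obtain rfl : i = j := h₁
  rw [Sigma.mk.injEq]
  exact ⟨rfl, heq_of_eq (Subtype.ext h₂)⟩

theorem Op.apply_letter_eq_zero (h : DirectSum.IsInternal gr) (F : Op gr gr' s) {m : Op gr gr t}
    {b : List (Letter gr)} (hb : m.toFun b = 0) (a c : List (Letter gr)) :
    F.toFun (a ++ m.letter b :: c) = 0 :=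
  F.multilin.eq_zero h (y := m.letter b) hb a c

/-- Two operations agree on all words of length at most `n`. -/
def Op.Agree (n : ℕ) (f g : Op gr gr' s) : Prop := ∀ l, l.length ≤ n → f.toFun l = g.toFun l

/-- An insertion lengthens the word only when the inserted output comes from the empty word, and
then `m [] = 0` removes the term. -/
theorem insOp_congr (h : DirectSum.IsInternal gr) {m m' : Op gr gr 2} {F F' : Op gr gr' s}
    {w : List (Letter gr)} (h0 : m.toFun [] = 0) (hm : m.Agree w.length m')
    (hF : F.Agree w.length F') :
    insOp sdeg m.letter F.toFun w = insOp sdeg m'.letter F'.toFun w := by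
  refine sumSplit₃_congr fun a b c habc => ?_
  have hb : b.length ≤ w.length := by simp only [← habc, List.length_append]; omega
  rw [← Op.letter_congr (hm b hb)]
  rcases b with _ | ⟨y, b⟩
  · rw [F.apply_letter_eq_zero h h0, F'.apply_letter_eq_zero h h0]
  · rw [hF]
    simp only [← habc, List.length_append, List.length_cons]
    omega

/-- The longest block contains every letter except `v` or except `x`, hence has `|a| + |c| + 1`
letters. -/
theorem pullForm₂_congr {f f' : Op gr gr' 1}
    (Ω : List (Letter gr') → Letter gr' → List (Letter gr') → Letter gr' → k)
    (a : List (Letter gr)) (v : Letter gr) (c : List (Letter gr)) (x : Letter gr)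
    (hf : f.Agree (a.length + c.length + 1) f') :
    pullForm₂ sdeg f.letter Ω a v c x = pullForm₂ sdeg f'.letter Ω a v c x := by
  refine sumSplit₃_congr fun a₁ a₂ a₃ ha => sumSplit₃_congr fun c₁ c₂ c₃ hc => ?_
  have hf' : ∀ l : List (Letter gr), l.length ≤ a.length + c.length + 1 →
      f.letter l = f'.letter l := fun l hl => Op.letter_congr (hf l hl)
  simp only [← ha, ← hc, List.length_append] at hf'
  rw [hf' (a₃ ++ v :: c₁) (by simp only [List.length_append, List.length_cons]; omega),
    hf' (c₃ ++ x :: a₁) (by simp only [List.length_append, List.length_cons]; omega),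
    hat_congr_left _ fun b hb => hf' b (by omega)]
  congr 2
  funext l
  exact hat_congr_left _ fun b hb => hf' b (by omega)

/-- Changing `m` and `F` on words of length `n + 1`. -/
theorem insOp_update (h : DirectSum.IsInternal gr) {m m' : Op gr gr 2} {F F' : Op gr gr' s}
    {n : ℕ} {w : List (Letter gr)} (hw : w.length = n + 1) (h0 : m.toFun [] = 0)
    (h1 : ∀ y, m.toFun [y] = 0) (hmw : m.toFun w = 0) (hm : m.Agree n m') (hF : F.Agree n F') :
    insOp sdeg m'.letter F'.toFun w = insOp sdeg m.letter F.toFun w + F'.toFun [m'.letter w] := by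
  classical
  rw [← sumSplit₃_ite_outer w fun _ _ _ => F'.toFun [m'.letter w], insOp, insOp, ← sumSplit₃_add]
  refine sumSplit₃_congr fun a b c habc => ?_
  split_ifs with hac
  · obtain ⟨rfl, rfl⟩ := hac
    obtain rfl : b = w := by simpa using habc
    rw [F.apply_letter_eq_zero h hmw, smul_zero, zero_add]
    exact one_smul ℤˣ _
  · have hac' : ¬(a.length = 0 ∧ c.length = 0) := by simpa [List.length_eq_zero_iff] using hac
    have hl : a.length + b.length + c.length = n + 1 := by
      rw [← hw, ← habc]
      simp only [List.length_append]
      omega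
    rw [add_zero, ← Op.letter_congr (hm b (by omega))]
    -- For a single letter the word fed to `F` still has length `n + 1`, where `F` and `F'` may
    -- differ; the vanishing of `m` on single letters removes this case.
    rcases b with _ | ⟨y, _ | ⟨z, b⟩⟩
    · rw [F.apply_letter_eq_zero h h0, F'.apply_letter_eq_zero h h0]
    · rw [F.apply_letter_eq_zero h (h1 y), F'.apply_letter_eq_zero h (h1 y)]
    · rw [hF]
      simp only [List.length_append, List.length_cons] at hl ⊢
      omega

/-- Changing `f` on words of length `n + 1`. -/
theorem hat_update {N : Type*} [AddCommGroup N] {f f' : Op gr gr' 1} {n : ℕ}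
    {w : List (Letter gr)} (hw : w.length = n + 1) (hf : f.Agree n f')
    (F : List (Letter gr') → N) :
    hat f'.letter F w = hat f.letter F w + (F [f'.letter w] - F [f.letter w]) := by
  classical
  rcases w with _ | ⟨x, w⟩
  · simp at hw
  · rw [hat_cons, hat_cons, ← sumSplit_ite_right w fun a _ =>
      (F [f'.letter (x :: a)] - F [f.letter (x :: a)]), ← sumSplit_add]
    refine sumSplit_congr fun a b hab => ?_
    split_ifs with hb
    · rw [hb, hat_nil, hat_nil, add_sub_cancel]
    · have hb' := List.length_pos_iff.2 hb
      simp only [← hab, List.length_cons, List.length_append] at hw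
      rw [add_zero, ← Op.letter_congr (hf (x :: a) (by simp only [List.length_cons]; omega))]
      exact hat_congr_left _ fun b' hb' => (Op.letter_congr (hf b' (by omega))).symm

/-- Only a block of `n + 1` letters feels the change, so it must contain everything except `x` or
everything except `v`. The change is thus linear in `δ` and involves only the constant part of `Ω`,
which makes the correction solvable. -/
theorem pullForm₂_update (h' : DirectSum.IsInternal gr')
    {Ω : List (Letter gr') → Letter gr' → List (Letter gr') → Letter gr' → k}
    (hΩ : IsForm₂ k Ω) {f f' δ : Op gr gr' 1} {n : ℕ} (hn : 1 ≤ n) (hf : f.Agree n f')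
    (hδ : ∀ w, w.length = n + 1 → f'.toFun w = f.toFun w + δ.toFun w)
    (a : List (Letter gr)) (v : Letter gr) (c : List (Letter gr)) (x : Letter gr)
    (hac : a.length + c.length = n) :
    pullForm₂ sdeg f'.letter Ω a v c x = pullForm₂ sdeg f.letter Ω a v c x +
      (Ω [] (δ.letter (a ++ v :: c)) [] (f.letter [x]) +
      ksign (wd sdeg a * (sdeg v + wd sdeg c + sdeg x)) •
        Ω [] (f.letter [v]) [] (δ.letter (c ++ x :: a))) := by
  classical
  have hf' : ∀ l : List (Letter gr), l.length ≤ n → f'.letter l = f.letter l :=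
    fun l hl => (Op.letter_congr (hf l hl)).symm
  have e1 : Ω [] (δ.letter (a ++ v :: c)) [] (f.letter [x]) =
      sumSplit₃ a fun a₁ a₂ a₃ => sumSplit₃ c fun c₁ c₂ c₃ =>
        if a₁ = [] ∧ a₂ = [] then if c₂ = [] ∧ c₃ = [] then
          Ω [] (δ.letter (a₃ ++ v :: c₁)) [] (f.letter (c₃ ++ x :: a₁)) else 0 else 0 := by
    refine Eq.trans ?_ (Eq.trans (sumSplit₃_ite_left a fun a₁ a₂ a₃ => sumSplit₃ c fun c₁ c₂ c₃ =>
        if c₂ = [] ∧ c₃ = [] then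
          Ω [] (δ.letter (a₃ ++ v :: c₁)) [] (f.letter (c₃ ++ x :: a₁)) else 0).symm ?_)
    · rw [sumSplit₃_ite_right]
      rfl
    · refine sumSplit₃_congr fun a₁ a₂ a₃ _ => ?_
      split_ifs
      · rfl
      · exact (sumSplit₃_eq_zero fun _ _ _ _ => rfl).symm
  have e2 : ksign (wd sdeg a * (sdeg v + wd sdeg c + sdeg x)) •
        Ω [] (f.letter [v]) [] (δ.letter (c ++ x :: a)) =
      sumSplit₃ a fun a₁ a₂ a₃ => sumSplit₃ c fun c₁ c₂ c₃ =>
        if a₂ = [] ∧ a₃ = [] then if c₁ = [] ∧ c₂ = [] then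
          ksign (wd sdeg a₁ * (sdeg v + wd sdeg c + sdeg x)) •
          Ω [] (f.letter (a₃ ++ v :: c₁)) [] (δ.letter (c₃ ++ x :: a₁)) else 0 else 0 := by
    refine Eq.trans ?_ (Eq.trans (sumSplit₃_ite_right a fun a₁ a₂ a₃ =>
      sumSplit₃ c fun c₁ c₂ c₃ => if c₁ = [] ∧ c₂ = [] then
          ksign (wd sdeg a₁ * (sdeg v + wd sdeg c + sdeg x)) •
          Ω [] (f.letter (a₃ ++ v :: c₁)) [] (δ.letter (c₃ ++ x :: a₁)) else 0).symm ?_)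
    · rw [sumSplit₃_ite_left]
      rfl
    · refine sumSplit₃_congr fun a₁ a₂ a₃ _ => ?_
      split_ifs
      · rfl
      · exact (sumSplit₃_eq_zero fun _ _ _ _ => rfl).symm
  rw [e1, e2, pullForm₂, pullForm₂, ← sumSplit₃_add, ← sumSplit₃_add]
  refine sumSplit₃_congr fun a₁ a₂ a₃ ha => ?_
  rw [← sumSplit₃_add, ← sumSplit₃_add]
  refine sumSplit₃_congr fun c₁ c₂ c₃ hc => ?_
  have hl : a₁.length + a₂.length + a₃.length + c₁.length + c₂.length + c₃.length = n := by
    rw [← hac, ← ha, ← hc]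
    simp only [List.length_append]
    omega
  by_cases hX : (a₁ = [] ∧ a₂ = []) ∧ c₂ = [] ∧ c₃ = []
  · obtain ⟨⟨rfl, rfl⟩, rfl, rfl⟩ := hX
    -- The condition `1 ≤ n` keeps the two exceptional decompositions apart.
    have hY : ¬(a₃ = [] ∧ c₁ = []) := by
      rintro ⟨rfl, rfl⟩
      simp at hl
      omega
    obtain ⟨L, hL⟩ := exists_linear_of_isLin h' (hΩ.mid [] [] (f.letter [x]))
    have h2 : (if (([] : List (Letter gr)) = [] ∧ a₃ = []) then
        if c₁ = [] ∧ ([] : List (Letter gr)) = [] then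
          ksign (wd sdeg ([] : List (Letter gr)) * (sdeg v + wd sdeg c + sdeg x)) •
          Ω [] (f.letter (a₃ ++ v :: c₁)) [] (δ.letter ([] ++ x :: [])) else 0 else 0) = 0 := by
      split_ifs with h3 h4
      · exact absurd ⟨h3.2, h4.1⟩ hY
      · rfl
      · rfl
    rw [h2, if_pos ⟨rfl, rfl⟩, if_pos ⟨rfl, rfl⟩]
    simp only [hat_nil, List.nil_append, wd_nil, zero_mul, add_zero]
    rw [hf' [x] (by simpa using hn), hL, hL, hL, Op.val_letter,
      hδ _ (by simp only [List.length_append, List.length_cons]; simp at hl; omega), map_add]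
    have h4 (z : k) : ksign 0 • z = z := one_smul ℤˣ z
    rw [h4, h4]
    rfl
  by_cases hY : (a₂ = [] ∧ a₃ = []) ∧ c₁ = [] ∧ c₂ = []
  · obtain ⟨⟨rfl, rfl⟩, rfl, rfl⟩ := hY
    obtain ⟨L, hL⟩ := exists_linear_of_isLin h' (hΩ.last [] (f.letter [v]) [])
    have h2 : (if a₁ = [] ∧ ([] : List (Letter gr)) = [] then
        if ([] : List (Letter gr)) = [] ∧ c₃ = [] then
          Ω [] (δ.letter ([] ++ v :: [])) [] (f.letter (c₃ ++ x :: a₁)) else 0 else 0) = 0 := by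
      split_ifs with h3 h4
      · exact absurd ⟨⟨h3.1, rfl⟩, rfl, h4.2⟩ hX
      · rfl
      · rfl
    rw [h2, if_pos ⟨rfl, rfl⟩, if_pos ⟨rfl, rfl⟩]
    simp only [hat_nil, List.nil_append, wd_nil, zero_add]
    rw [hf' [v] (by simpa using hn), hL, hL, hL, Op.val_letter,
      hδ _ (by simp only [List.length_append, List.length_cons]; simp at hl; omega), map_add,
      smul_add]
    rfl
  have hX' : ¬(a₁.length + a₂.length + c₂.length + c₃.length = 0) := by
    intro h0
    exact hX ⟨⟨List.length_eq_zero_iff.1 (by omega), List.length_eq_zero_iff.1 (by omega)⟩,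
      List.length_eq_zero_iff.1 (by omega), List.length_eq_zero_iff.1 (by omega)⟩
  have hY' : ¬(a₂.length + a₃.length + c₁.length + c₂.length = 0) := by
    intro h0
    exact hY ⟨⟨List.length_eq_zero_iff.1 (by omega), List.length_eq_zero_iff.1 (by omega)⟩,
      List.length_eq_zero_iff.1 (by omega), List.length_eq_zero_iff.1 (by omega)⟩
  rw [← ite_and, ← ite_and, if_neg hX, if_neg hY, add_zero, add_zero,
    hf' (a₃ ++ v :: c₁) (by simp only [List.length_append, List.length_cons]; omega),
    hf' (c₃ ++ x :: a₁) (by simp only [List.length_append, List.length_cons]; omega),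
    hat_congr_left _ fun b hb => hf' b (by omega)]
  congr 2
  funext l
  exact hat_congr_left _ fun b hb => hf' b (by omega)

end Update

/-! ### Constructing operations, limits, and the infinitesimal Darboux lemma -/

section Construct

variable {k : Type*} [Field k] {V W U : Type*} [AddCommGroup V] [Module k V] [AddCommGroup W]
  [Module k W] [AddCommGroup U] [Module k U] {gr : ℤ → Submodule k V} {gr' : ℤ → Submodule k W}
  {gr'' : ℤ → Submodule k U} {s t : ℤ}

theorem ksign_smul_mem (S : Submodule k V) (n : ℤ) {x : V} (hx : x ∈ S) : ksign n • x ∈ S := by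
  rw [Units.smul_def]
  exact zsmul_mem hx _

theorem sumSplit₃_mem {α : Type*} {S : Submodule k V} {l : List α}
    {F : List α → List α → List α → V} (h : ∀ a b c, a ++ (b ++ c) = l → F a b c ∈ S) :
    sumSplit₃ l F ∈ S := by
  unfold sumSplit₃ sumSplit
  exact Submodule.sum_mem _ fun i _ => Submodule.sum_mem _ fun j _ => h _ _ _
    (by rw [List.take_append_drop, List.take_append_drop])

theorem wd_map_letter (f : Op gr gr' 1) (L : List (List (Letter gr))) :
    wd sdeg (L.map f.letter) = wd sdeg L.flatten :=
  wd_map_blocks sdeg f.sdeg_letter_one L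

namespace Op

/-- The operation `∑ M(f(b₁), …, f(b_r))`. -/
def compHat (h' : DirectSum.IsInternal gr') (f : Op gr gr' 1) (M : Op gr' gr'' s) :
    Op gr gr'' s where
  toFun := hat f.letter M.toFun
  mem l := by
    change (∑ c : Composition l.length, M.toFun ((l.splitWrtComposition c).map f.letter)) ∈ _
    refine Submodule.sum_mem _ fun c _ => ?_
    have := M.mem ((l.splitWrtComposition c).map f.letter)
    rwa [wd_map_letter, List.flatten_splitWrtComposition] at this
  multilin := isMultilin_hat h' f.multilin M.multilin

/-- The operation `∑ (-1)^{|a|'} F(a, m(b), c)`. -/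
def compIns (h : DirectSum.IsInternal gr) (m : Op gr gr 2) (F : Op gr gr' s) (hs : s + 1 = t) :
    Op gr gr' t where
  toFun := insOp sdeg m.letter F.toFun
  mem l := by
    refine sumSplit₃_mem fun a b c hl => ksign_smul_mem _ _ ?_
    have := F.mem (a ++ m.letter b :: c)
    rwa [show wd sdeg (a ++ m.letter b :: c) + s = wd sdeg l + t by
      rw [← hl, ← hs]; simp only [wd_append, wd_cons, sdeg_letter_two]; ring] at this
  multilin := isMultilin_insOp (m := m.letter) h m.multilin F.multilin

/-- Composition with a homogeneous linear map. -/
def compLinear (L : W →ₗ[k] U) (f : Op gr gr' s) (hL : ∀ i, ∀ x ∈ gr' (i + s), L x ∈ gr'' (i + t)) :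
    Op gr gr'' t where
  toFun l := L (f.toFun l)
  mem l := hL _ _ (f.mem l)
  multilin a b i := (f.multilin a b i).comp_linear L

/-- A homogeneous linear map, as an operation with one argument. -/
def ofLinear (L : V →ₗ[k] W) (hL : ∀ i, ∀ x ∈ gr i, L x ∈ gr' i) : Op gr gr' 1 where
  toFun
    | [y] => L y.val
    | _ => 0
  mem l := by
    rcases l with _ | ⟨y, _ | ⟨z, l⟩⟩
    · exact zero_mem _
    · rw [show wd sdeg [y] + 1 = y.1 by simp [sdeg]]
      exact hL _ _ y.2.2
    · exact zero_mem _
  multilin a b := by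
    rcases a with _ | ⟨x, _ | ⟨x', a⟩⟩
    · rcases b with _ | ⟨z, b⟩
      · exact isLin_of_linear L
      · exact fun i => IsLinearMap.zero_fun
    · exact fun i => IsLinearMap.zero_fun
    · exact fun i => IsLinearMap.zero_fun

/-- The zero operation. -/
def zero : Op gr gr' s where
  toFun _ := 0
  mem _ := zero_mem _
  multilin _ _ _ := IsLinearMap.zero_fun

/-- The diagonal of a sequence of operations. -/
def diag (f : ℕ → Op gr gr' s) : Op gr gr' s where
  toFun l := (f l.length).toFun l
  mem l := (f l.length).mem l
  multilin a b i := by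
    simp only [List.length_append, List.length_cons]
    exact (f _).multilin a b i

theorem agree_diag {f : ℕ → Op gr gr' s} (hf : ∀ n, (f n).Agree n (f (n + 1))) (n : ℕ) :
    (diag f).Agree n (f n) := by
  intro l hl
  obtain ⟨j, rfl⟩ := Nat.exists_eq_add_of_le hl
  clear hl
  induction j with
  | zero => rfl
  | succ j ih => rw [ih]; exact hf _ l (by omega)

theorem Agree.refl (f : Op gr gr' s) (n : ℕ) : f.Agree n f := fun _ _ => rfl

theorem Agree.symm {f g : Op gr gr' s} {n : ℕ} (h : f.Agree n g) : g.Agree n f :=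
  fun l hl => (h l hl).symm

theorem Agree.trans {f g g' : Op gr gr' s} {n : ℕ} (h : f.Agree n g) (h' : g.Agree n g') :
    f.Agree n g' :=
  fun l hl => (h l hl).trans (h' l hl)

theorem Agree.mono {f g : Op gr gr' s} {n n' : ℕ} (h : f.Agree n g) (hn : n' ≤ n) :
    f.Agree n' g :=
  fun l hl => h l (hl.trans hn)

theorem agree_restrictLength (f : Op gr gr' s) (n : ℕ) :
    (f.restrictLength (· ≤ n)).Agree n f := by
  intro l hl
  rw [restrictLength_toFun, if_pos hl]

/-- Construction of pairs of operations by recursion on the length of words. -/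
theorem exists_limit {V' W' : Type*} [AddCommGroup V'] [Module k V'] [AddCommGroup W']
    [Module k W'] {gr₁ : ℤ → Submodule k V'} {gr₁' : ℤ → Submodule k W'}
    {P : ℕ → Op gr gr' s → Op gr₁ gr₁' t → Prop} (n₀ : ℕ) (h₀ : ∃ f g, P n₀ f g)
    (hstep : ∀ n ≥ n₀, ∀ f g, P n f g → ∃ f' g', P (n + 1) f' g' ∧ f.Agree n f' ∧ g.Agree n g') :
    ∃ (f : Op gr gr' s) (g : Op gr₁ gr₁' t), ∀ n ≥ n₀, ∃ f' g', P n f' g' ∧ f.Agree n f' ∧ g.Agree n g' := by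
  choose! F G hP hF hG using hstep
  obtain ⟨f₀, g₀, h₀⟩ := h₀
  let x : ℕ → Op gr gr' s × Op gr₁ gr₁' t := fun j =>
    Nat.rec (f₀, g₀) (fun j y => (F (n₀ + j) y.1 y.2, G (n₀ + j) y.1 y.2)) j
  have hx : ∀ j, P (n₀ + j) (x j).1 (x j).2 := by
    intro j
    induction j with
    | zero => exact h₀
    | succ j ih => exact hP (n₀ + j) (by omega) _ _ ih
  -- Truncated subtraction makes the sequence constant below `n₀`, so the diagonal is defined from
  -- length zero on.
  have h1 : ∀ n, (x (n - n₀)).1.Agree n (x (n + 1 - n₀)).1 ∧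
      (x (n - n₀)).2.Agree n (x (n + 1 - n₀)).2 := by
    intro n
    by_cases hn : n₀ ≤ n
    · obtain ⟨j, rfl⟩ := Nat.exists_eq_add_of_le hn
      rw [show n₀ + j - n₀ = j by omega, show n₀ + j + 1 - n₀ = j + 1 by omega]
      exact ⟨hF (n₀ + j) (by omega) _ _ (hx j), hG (n₀ + j) (by omega) _ _ (hx j)⟩
    · rw [show n + 1 - n₀ = 0 by omega, show n - n₀ = 0 by omega]
      exact ⟨Agree.refl _ _, Agree.refl _ _⟩
  refine ⟨diag fun n => (x (n - n₀)).1, diag fun n => (x (n - n₀)).2, fun n hn =>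
    ⟨(x (n - n₀)).1, (x (n - n₀)).2, ?_, agree_diag (fun n => (h1 n).1) n,
      agree_diag (fun n => (h1 n).2) n⟩⟩
  have := hx (n - n₀)
  rwa [show n₀ + (n - n₀) = n by omega] at this

end Op

/-- Nondegeneracy of a bilinear form on a graded vector space. -/
def FormNondeg (gr : ℤ → Submodule k V) (β : V →ₗ[k] Module.Dual k V) : Prop :=
  (∀ a : V, a ≠ 0 → ∃ b : V, β a b ≠ 0) ∧
  (∀ (j : ℤ) (ξ : Module.Dual k (gr j)), ∃ a : V, ∀ b : gr j, β a (b : V) = ξ b)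

/-- The form identifies degree `2 - e - j` with the dual of degree `j`. The inverse is taken on
functionals of the whole space so that no degree-dependent types appear. -/
theorem FormNondeg.exists_inverse (h : DirectSum.IsInternal gr) {e : ℤ}
    {β : V →ₗ[k] Module.Dual k V} (hd : FormDegree gr e β) (hβ : FormNondeg gr β) (j : ℤ) :
    ∃ S : Module.Dual k V →ₗ[k] V, ∀ ξ, S ξ ∈ gr (2 - e - j) ∧ ∀ y ∈ gr j, β (S ξ) y = ξ y := by
  let T : gr (2 - e - j) →ₗ[k] Module.Dual k (gr j) :=
    (gr j).subtype.dualMap ∘ₗ β ∘ₗ (gr (2 - e - j)).subtype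
  have hT : Function.Bijective T := by
    constructor
    · rw [injective_iff_map_eq_zero]
      intro z hz
      by_contra hne
      obtain ⟨b, hb⟩ := hβ.1 z (fun h0 => hne (Subtype.ext h0))
      rw [hd.apply_left h b z.2, show 2 - e - (2 - e - j) = j by ring] at hb
      exact hb (LinearMap.congr_fun hz ⟨_, homComp_mem h j b⟩)
    · intro ξ
      obtain ⟨a, ha⟩ := hβ.2 j ξ
      refine ⟨⟨_, homComp_mem h (2 - e - j) a⟩, ?_⟩
      ext y
      rw [← ha y, hd.apply_right h a y.2]
      rfl
  let E := LinearEquiv.ofBijective T hT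
  refine ⟨(gr (2 - e - j)).subtype ∘ₗ E.symm.toLinearMap ∘ₗ (gr j).subtype.dualMap, fun ξ =>
    ⟨Subtype.property _, fun y hy => ?_⟩⟩
  exact LinearMap.congr_fun (E.apply_symm_apply ((gr j).subtype.dualMap ξ)) ⟨y, hy⟩

/-- The infinitesimal Darboux lemma: a closed two-form is the Lie derivative of a constant
nondegenerate one. -/
theorem exists_op_of_closedForm [CharZero k] (h : DirectSum.IsInternal gr) {e : ℤ}
    {β : V →ₗ[k] Module.Dual k V} (hd : FormDegree gr e β) (hβ : FormNondeg gr β)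
    {Ω : List (Letter gr) → Letter gr → List (Letter gr) → Letter gr → k} (hΩ : IsForm₂ k Ω)
    (hs : SkewForm sdeg Ω) (hc : ClosedForm sdeg Ω)
    (hdΩ : ∀ a v c x, wd sdeg a + sdeg v + wd sdeg c + sdeg x + e ≠ 0 → Ω a v c x = 0) :
    ∃ g : Op gr gr 1, ∀ a v c x, Ω a v c x = β (g.toFun (a ++ v :: c)) x.val -
      ksign ((wd sdeg a + sdeg v) * (wd sdeg c + sdeg x)) • β (g.toFun (c ++ x :: a)) v.val := by
  have hG : IsForm k (potential Ω) := isForm_potential hΩ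
  have hdG : ∀ w x, wd sdeg w + sdeg x + e ≠ 0 → potential Ω w x = 0 := by
    intro w x hw
    rw [potential, sumPos_congr (G := fun _ _ _ => 0), sumPos_const, smul_zero, mul_zero]
    rintro a v c rfl
    refine hdΩ a v c x ?_
    rw [wd_append, wd_cons] at hw
    convert hw using 2
    ring
  choose L hL using fun w => exists_linear_of_isLin h (hG.last w)
  choose S hS using hβ.exists_inverse h hd
  -- For fixed `w` the potential is a functional concentrated on letters of degree `1 - e - |w|'`;
  -- contracting with the inverse of `β` yields a vector of degree `|w|' + 1`, as an operation of
  -- offset `1` requires.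
  have key : ∀ w (x : Letter gr),
      β (S (1 - e - wd sdeg w) (L w)) x.val = potential Ω w x := by
    intro w x
    by_cases hx : wd sdeg w + sdeg x + e = 0
    · rw [hL, (hS _ _).2]
      have : x.val ∈ gr x.1 := x.2.2
      rwa [show x.1 = 1 - e - wd sdeg w by simp only [sdeg] at hx; linarith] at this
    · rw [hdG w x hx]
      refine hd ⟨_, _, (hS (1 - e - wd sdeg w) (L w)).1⟩ x ?_
      simp only [sdeg_mk]
      intro h0
      apply hx
      linarith [h0]
  refine ⟨⟨fun w => S (1 - e - wd sdeg w) (L w), fun w => ?_, fun a b i => ?_⟩, fun a v c x => ?_⟩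
  · have := (hS (1 - e - wd sdeg w) (L w)).1
    rwa [show 2 - e - (1 - e - wd sdeg w) = wd sdeg w + 1 by ring] at this
  · simp only [wd_append, wd_cons, sdeg_mk]
    refine IsLinearMap.comp_linear _ ⟨fun y z => ?_, fun r y => ?_⟩
    · refine linear_ext_letter h fun x => ?_
      rw [LinearMap.add_apply, ← hL, ← hL, ← hL]
      exact (hG.word x a b i).map_add y z
    · refine linear_ext_letter h fun x => ?_
      rw [LinearMap.smul_apply, ← hL, ← hL]
      exact (hG.word x a b i).map_smul r y
  · rw [← dForm_potential sdeg hs hc, dForm]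
    simp only [key]

theorem skewForm_sub {X N : Type*} [AddCommGroup N] {d : X → ℤ}
    {Ω Ω' : List X → X → List X → X → N} (h : SkewForm d Ω) (h' : SkewForm d Ω') :
    SkewForm d fun a v c x => Ω a v c x - Ω' a v c x := by
  intro a v b w
  simp only [smul_sub]
  rw [h a, h' a]
  abel

theorem closedForm_sub {X N : Type*} [AddCommGroup N] {d : X → ℤ}
    {Ω Ω' : List X → X → List X → X → N} (h : ClosedForm d Ω) (h' : ClosedForm d Ω') :
    ClosedForm d fun a v c x => Ω a v c x - Ω' a v c x := by
  intro α β γ δ x y z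
  have h1 := h α β γ δ x y z
  have h2 := h' α β γ δ x y z
  simp only [smul_sub]
  rw [← sub_zero (0 : N)]
  nth_rw 1 [← h1]
  rw [← h2]
  abel

theorem IsForm₂.sub {Ω Ω' : List (Letter gr) → Letter gr → List (Letter gr) → Letter gr → k}
    (h : IsForm₂ k Ω) (h' : IsForm₂ k Ω') : IsForm₂ k fun a v c x => Ω a v c x - Ω' a v c x where
  left v c x a b i := (h.left v c x a b i).sub_fun (h'.left v c x a b i)
  mid a c x i := (h.mid a c x i).sub_fun (h'.mid a c x i)
  right a v x p q i := (h.right a v x p q i).sub_fun (h'.right a v x p q i)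
  last a v c i := (h.last a v c i).sub_fun (h'.last a v c i)

/-- By the Poincaré lemma the form is exact, and the pullback of an exact form is exact. -/
theorem pullForm₂_closed [CharZero k] (h' : DirectSum.IsInternal gr') (f : Op gr gr' 1)
    {Ω : List (Letter gr') → Letter gr' → List (Letter gr') → Letter gr' → k} (hΩ : IsForm₂ k Ω)
    (hs : SkewForm sdeg Ω) (hc : ClosedForm sdeg Ω) :
    IsForm₂ k (pullForm₂ sdeg f.letter Ω) ∧ SkewForm sdeg (pullForm₂ sdeg f.letter Ω) ∧
      ClosedForm sdeg (pullForm₂ sdeg f.letter Ω) := by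
  have h1 : Ω = dForm sdeg (potential Ω) := by
    funext a v c x
    exact (dForm_potential _ hs hc a v c x).symm
  have h2 : pullForm₂ sdeg f.letter Ω = dForm sdeg (pullForm sdeg f.letter (potential Ω)) := by
    funext a v c x
    rw [← pullForm₂_dForm sdeg f.sdeg_letter_one, ← h1]
  have h3 : SkewForm sdeg (pullForm₂ sdeg f.letter Ω) := h2 ▸ skewForm_dForm _ _
  exact ⟨isForm₂_pullForm₂ h' f.multilin hΩ h3, h3, h2 ▸ closedForm_dForm _ _⟩

theorem pullForm₂_degree {e : ℤ} (f : Op gr gr' 1)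
    {Ω : List (Letter gr') → Letter gr' → List (Letter gr') → Letter gr' → k}
    (hd : ∀ a v c x, wd sdeg a + sdeg v + wd sdeg c + sdeg x + e ≠ 0 → Ω a v c x = 0)
    (a : List (Letter gr)) (v : Letter gr) (c : List (Letter gr)) (x : Letter gr)
    (h : wd sdeg a + sdeg v + wd sdeg c + sdeg x + e ≠ 0) :
    pullForm₂ sdeg f.letter Ω a v c x = 0 := by
  refine sumSplit₃_eq_zero fun a₁ a₂ a₃ ha => sumSplit₃_eq_zero fun c₁ c₂ c₃ hc => ?_
  refine (congrArg _ (Eq.trans (hat_congr _ (G := fun _ => 0) fun L hL _ => ?_)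
    (hat_zero _ _))).trans (smul_zero _)
  refine Eq.trans (hat_congr _ (G := fun _ => 0) fun L' hL' _ => ?_) (hat_zero _ _)
  refine hd _ _ _ _ ?_
  rw [wd_map_letter, wd_map_letter, hL, hL', Op.sdeg_letter_one, Op.sdeg_letter_one]
  convert h using 2
  rw [← ha, ← hc]
  simp only [wd_append, wd_cons]
  ring

end Construct

/-! ### Invariance under morphisms, and cyclicity -/

section Transfer

variable {k : Type*} [Field k] {V W : Type*} [AddCommGroup V] [Module k V] [AddCommGroup W]
  [Module k W] {gr : ℤ → Submodule k V} {gr' : ℤ → Submodule k W} {s t : ℤ}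

theorem IsLin.hat_eq_insOp {N : Type*} [AddCommGroup N] [Module k N]
    (h' : DirectSum.IsInternal gr') {f : List (Letter gr) → Letter gr'}
    {m : List (Letter gr) → Letter gr} {mY : List (Letter gr') → Letter gr'}
    {w : List (Letter gr)} (hrel : hat f (fun u => (mY u).val) w = insOp sdeg m (fun u => (f u).val) w)
    {g : Letter gr' → N} (hg : IsLin k g) :
    hat f (fun u => g (mY u)) w = insOp sdeg m (fun u => g (f u)) w := by
  have h := hat_eq_insOp_of_val (E := ⟨0, 0⟩) h' (hrel.trans (add_zero _).symm) hg
  rwa [hg.eq_zero h' rfl, add_zero] at h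

theorem IsLin.insOp_eq_zero {N : Type*} [AddCommGroup N] [Module k N]
    (h' : DirectSum.IsInternal gr') {m : List (Letter gr) → Letter gr}
    {f : List (Letter gr) → Letter gr'} {w : List (Letter gr)}
    (hrel : insOp sdeg m (fun u => (f u).val) w = 0) {g : Letter gr' → N} (hg : IsLin k g) :
    insOp sdeg m (fun u => g (f u)) w = 0 := by
  obtain ⟨L, hL⟩ := exists_linear_of_isLin h' hg
  have : L (insOp sdeg m (fun u => (f u).val) w) = 0 := by rw [hrel, map_zero]
  simpa only [hL, insOp, map_sumSplit₃, map_ksign_smul] using this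

theorem hat_congr_length {α β N : Type*} [AddCommMonoid N] (f : List α → β) {F G : List β → N}
    {w : List α} (h : ∀ l : List β, l.length ≤ w.length → F l = G l) :
    hat f F w = hat f G w := by
  refine hat_congr f fun L hL hL' => h _ ?_
  rw [List.length_map, ← hL]
  exact length_le_of_blocks hL'

/-- The pullback along an A∞-morphism commutes with the Lie derivative of closed two-forms. -/
theorem pullForm₂_lieForm₂_of_closed [CharZero k] (h' : DirectSum.IsInternal gr')
    (f : Op gr gr' 1) (m : Op gr gr 2) (mY : Op gr' gr' 2)
    (hrel : ∀ w, hat f.letter mY.toFun w = insOp sdeg m.letter f.toFun w)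
    {Ω : List (Letter gr') → Letter gr' → List (Letter gr') → Letter gr' → k} (hΩ : IsForm₂ k Ω)
    (hs : SkewForm sdeg Ω) (hc : ClosedForm sdeg Ω)
    (a : List (Letter gr)) (v : Letter gr) (c : List (Letter gr)) (x : Letter gr) :
    pullForm₂ sdeg f.letter (lieForm₂ sdeg mY.letter Ω) a v c x =
      lieForm₂ sdeg m.letter (pullForm₂ sdeg f.letter Ω) a v c x := by
  have h1 : Ω = dForm sdeg (potential Ω) := by
    funext a v c x
    exact (dForm_potential _ hs hc a v c x).symm
  have hG := isForm_potential hΩ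
  rw [h1]
  exact lieForm₂_pullForm₂ sdeg f.sdeg_letter_one m.sdeg_letter_two mY.sdeg_letter_two _
    (fun w l l' y => (hG.word y l l').hat_eq_insOp h' (hrel w))
    (fun w l => (hG.last l).hat_eq_insOp h' (hrel w)) a v c x

open AInfAlgebra in
-- With an empty left word, a constant form sees only the two extreme terms: `m` absorbing all
-- letters except `y`, or all except `x`. Skew symmetry turns their cancellation into cyclicity.
theorem cyclic_of_lieForm₂_eq_zero {β : V →ₗ[k] Module.Dual k V} (m : Op gr gr 2)
    (hs : ∀ x y : Letter gr, β x.val y.val = -(ksign (sdeg x * sdeg y) • β y.val x.val))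
    (h : ∀ a v c x, lieForm₂ sdeg m.letter (constForm (gr := gr) β) a v c x = 0)
    (x : Letter gr) (l : List (Letter gr)) (y : Letter gr) :
    β (m.toFun (x :: l)) y.val =
      ksign (sdeg x * (wd sdeg l + sdeg y)) • β (m.toFun (l ++ [y])) x.val := by
  classical
  have h1 := h [] x l y
  have e1 : (sumSplit l fun c₁ c₂ => constForm β [] (m.letter (x :: c₁)) c₂ y) =
      β (m.toFun (x :: l)) y.val := by
    rw [← sumSplit_ite_right l fun c₁ _ => β (m.toFun (x :: c₁)) y.val]
    refine sumSplit_congr fun c₁ c₂ _ => ?_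
    rcases c₂ with _ | ⟨z, c₂⟩ <;> rfl
  have e2 : (sumSplit₃ l fun c₁ c₂ c₃ => ksign (sdeg x + wd sdeg c₁) •
      constForm β [] x (c₁ ++ m.letter c₂ :: c₃) y) = 0 := by
    refine sumSplit₃_eq_zero fun c₁ c₂ c₃ _ => ?_
    rcases c₁ with _ | ⟨z, c₁⟩ <;> exact smul_zero _
  have e3 : (sumSplit l fun c₁ c₂ => ksign (sdeg x + wd sdeg c₁) •
      constForm β [] x c₁ (m.letter (c₂ ++ [y]))) =
      ksign (sdeg x) • β x.val (m.toFun (l ++ [y])) := by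
    rw [← sumSplit_ite_left l fun _ c₂ => ksign (sdeg x) • β x.val (m.toFun (c₂ ++ [y]))]
    refine sumSplit_congr fun c₁ c₂ _ => ?_
    rcases c₁ with _ | ⟨z, c₁⟩
    · rw [wd_nil, add_zero]
      rfl
    · exact smul_zero _
  have h0 (z : k) : ksign 0 • z = z := one_smul ℤˣ z
  simp only [lieForm₂, sumSplit₃, sumSplit_nil, wd_nil, List.nil_append, h0, zero_add, zero_mul,
    add_zero] at h1
  simp only [sumSplit₃] at e2
  rw [e1, e2, e3] at h1
  have e5 := hs x (m.letter (l ++ [y]))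
  simp only [Op.val_letter, Op.sdeg_letter_two] at e5
  rw [e5, smul_neg, ksign_smul_smul] at h1
  have e6 : constForm β [m.letter []] x l y = 0 := rfl
  rw [e6, add_zero, add_zero, ← sub_eq_add_neg, sub_eq_zero] at h1
  rw [h1]
  refine ksign_smul_congr ?_ _
  simp only [wd_append, wd_cons, wd_nil]
  push_cast
  generalize (sdeg x : ZMod 2) = A
  generalize (sdeg y : ZMod 2) = B
  generalize (wd sdeg l : ZMod 2) = C
  decide +revert

theorem Op.letter_singleton {f : Op gr gr 1} (hf : ∀ y, f.toFun [y] = y.val) (y : Letter gr) :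
    f.letter [y] = y :=
  letter_eq (by simp [Op.letter, sdeg]) (hf y)

/-- If `Ω` vanishes on shorter words, then its pullback along a map with identity linear part is
`Ω` itself. -/
theorem pullForm₂_eq_self {f : Op gr gr 1} (hf : ∀ y, f.toFun [y] = y.val)
    {Ω : List (Letter gr) → Letter gr → List (Letter gr) → Letter gr → k}
    (a : List (Letter gr)) (v : Letter gr) (c : List (Letter gr)) (x : Letter gr)
    (hΩ : ∀ a' v' c' x', a'.length + c'.length < a.length + c.length → Ω a' v' c' x' = 0) :
    pullForm₂ sdeg f.letter Ω a v c x = Ω a v c x := by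
  classical
  have hid (w : List (Letter gr)) : (w.map fun y => f.letter [y]) = w := by
    simp [Op.letter_singleton hf]
  have hz : ∀ (a₂ c₂ : List (Letter gr)) (v' x' : Letter gr),
      a₂.length + c₂.length < a.length + c.length →
      hat f.letter (fun l => hat f.letter (fun l' => Ω l v' l' x') c₂) a₂ = 0 := by
    intro a₂ c₂ v' x' hlt
    refine (hat_congr_length _ (G := fun _ => 0) fun l hl => ?_).trans (hat_zero _ _)
    refine (hat_congr_length _ (G := fun _ => 0) fun l' hl' => ?_).trans (hat_zero _ _)
    exact hΩ _ _ _ _ (by omega)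
  have h1 : pullForm₂ sdeg f.letter Ω a v c x =
      hat f.letter (fun l => hat f.letter (fun l' => Ω l v l' x) c) a := by
    rw [pullForm₂, sumSplit₃_eq_single fun a₁ a₂ a₃ ha hlt => ?_]
    · rw [sumSplit₃_eq_single fun c₁ c₂ c₃ hc hlt => ?_]
      · simp only [List.nil_append, Op.letter_singleton hf, wd_nil, zero_mul]
        exact one_smul ℤˣ _
      · rw [hz _ _ _ _ (by omega), smul_zero]
    · refine sumSplit₃_eq_zero fun c₁ c₂ c₃ hc => ?_
      rw [hz _ _ _ _ ?_, smul_zero]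
      have : c₂.length ≤ c.length := by
        rw [← hc]
        simp only [List.length_append]
        omega
      omega
  rw [h1, hat_eq_finest, hid, hat_eq_finest, hid]
  · exact fun l hl => hΩ _ _ _ _ (by omega)
  · intro l hl
    refine (hat_congr_length _ (G := fun _ => 0) fun l' hl' => ?_).trans (hat_zero _ _)
    exact hΩ _ _ _ _ (by omega)

end Transfer

/-! ### The Darboux theorem and transport of structure -/

section Darboux

variable {k : Type*} [Field k] {V W : Type*} [AddCommGroup V] [Module k V] [AddCommGroup W]
  [Module k W] {gr : ℤ → Submodule k V} {gr' : ℤ → Submodule k W}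

/-- The inductive step of the Darboux theorem: a pullback which is correct on short words can be
corrected on the words of the next length. -/
theorem exists_darboux_correction [CharZero k] (h : DirectSum.IsInternal gr)
    (h' : DirectSum.IsInternal gr') {e : ℤ} {β : V →ₗ[k] Module.Dual k V}
    (hd : FormDegree gr e β)
    (hβs : ∀ x y : Letter gr, β x.val y.val = -(ksign (sdeg x * sdeg y) • β y.val x.val))
    (hβ : FormNondeg gr β)
    {Ω : List (Letter gr') → Letter gr' → List (Letter gr') → Letter gr' → k} (hΩ : IsForm₂ k Ω)
    (hs : SkewForm sdeg Ω) (hc : ClosedForm sdeg Ω)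
    (hdΩ : ∀ a v c x, wd sdeg a + sdeg v + wd sdeg c + sdeg x + e ≠ 0 → Ω a v c x = 0)
    {Θ : List (Letter gr) → Letter gr → List (Letter gr) → Letter gr → k} (hΘ : IsForm₂ k Θ)
    (hΘs : SkewForm sdeg Θ) (hΘc : ClosedForm sdeg Θ)
    (hdΘ : ∀ a v c x, wd sdeg a + sdeg v + wd sdeg c + sdeg x + e ≠ 0 → Θ a v c x = 0)
    {J : V →ₗ[k] W} (hJ : ∀ i, ∀ x ∈ gr i, J x ∈ gr' i)
    (hJΩ : ∀ (x y : Letter gr) (x' y' : Letter gr'), x'.val = J x.val → y'.val = J y.val →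
      Ω [] x' [] y' = β x.val y.val)
    {n : ℕ} (hn : 1 ≤ n) (f : Op gr gr' 1) (hf : ∀ y, f.toFun [y] = J y.val)
    (hfn : ∀ a v c x, a.length + c.length + 1 ≤ n →
      pullForm₂ sdeg f.letter Ω a v c x = Θ a v c x) :
    ∃ g : Op gr gr 1, ∀ f' : Op gr gr' 1, f.Agree n f' →
      (∀ w, w.length = n + 1 → f'.toFun w = f.toFun w + J (g.toFun w)) →
      ∀ a v c x, a.length + c.length + 1 ≤ n + 1 →
        pullForm₂ sdeg f'.letter Ω a v c x = Θ a v c x := by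
  obtain ⟨hp, hps, hpc⟩ := pullForm₂_closed h' f hΩ hs hc
  -- The error `Θ` minus the pullback is closed, so it is the Lie derivative of `β` along some `g`.
  -- Moving `f` by `J ∘ g` at length `n + 1` adds precisely this amount there and leaves the shorter
  -- words alone.
  obtain ⟨g, hg⟩ := exists_op_of_closedForm h hd hβ (hΘ.sub hp) (skewForm_sub hΘs hps)
    (closedForm_sub hΘc hpc) fun a v c x hne => by
      rw [hdΘ _ _ _ _ hne, pullForm₂_degree f hdΩ _ _ _ _ hne, sub_zero]
  refine ⟨g, fun f' hff' hf' a v c x hac => ?_⟩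
  rcases Nat.lt_or_ge (a.length + c.length + 1) (n + 1) with hlt | hge
  · rw [← hfn a v c x (by omega)]
    exact (pullForm₂_congr _ _ _ _ _ (hff'.mono (by omega))).symm
  · have h1 := hg a v c x
    rw [sub_eq_iff_eq_add'] at h1
    rw [h1, pullForm₂_update (δ := g.compLinear J fun i y hy => hJ _ _ hy) h' hΩ hn hff' hf'
      a v c x (by omega)]
    have e1 := hJΩ (g.letter (a ++ v :: c)) x
      ((g.compLinear J fun i y hy => hJ _ _ hy).letter (a ++ v :: c)) (f.letter [x]) rfl (hf x)
    have e2 := hJΩ v (g.letter (c ++ x :: a)) (f.letter [v])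
      ((g.compLinear J fun i y hy => hJ _ _ hy).letter (c ++ x :: a)) (hf v) rfl
    rw [e1, e2, hβs v, smul_neg, ksign_smul_smul,
      sub_eq_add_neg]
    refine congrArg _ (congrArg _ (congrArg _ (ksign_smul_congr ?_ _)))
    rw [Op.sdeg_letter_one]
    simp only [wd_append, wd_cons]
    push_cast
    generalize (wd sdeg a : ZMod 2) = A
    generalize (wd sdeg c : ZMod 2) = B
    generalize (sdeg v : ZMod 2) = C
    generalize (sdeg x : ZMod 2) = D
    decide +revert

theorem constForm_degree {β : V →ₗ[k] Module.Dual k V} {e : ℤ} (hd : FormDegree gr e β)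
    (a : List (Letter gr)) (v : Letter gr) (c : List (Letter gr)) (x : Letter gr)
    (h : wd sdeg a + sdeg v + wd sdeg c + sdeg x + e ≠ 0) :
    AInfAlgebra.constForm β a v c x = 0 := by
  rcases a with _ | ⟨_, a⟩ <;> rcases c with _ | ⟨_, c⟩
  · exact hd v x (by simpa using h)
  all_goals rfl

/-- The difference of two operations. -/
def Op.sub {s : ℤ} (f g : Op gr gr' s) : Op gr gr' s where
  toFun l := f.toFun l - g.toFun l
  mem l := sub_mem (f.mem l) (g.mem l)
  multilin a b i := (f.multilin a b i).sub_fun (g.multilin a b i)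

/-- The Darboux theorem: a closed two-form with nondegenerate constant part is the pullback of its
constant part along a formal diffeomorphism with identity linear part. -/
theorem exists_op_pullForm₂_constForm [CharZero k] (h : DirectSum.IsInternal gr) {e : ℤ}
    {β : V →ₗ[k] Module.Dual k V} (hd : FormDegree gr e β)
    (hβs : ∀ x y : Letter gr, β x.val y.val = -(ksign (sdeg x * sdeg y) • β y.val x.val))
    (hβ : FormNondeg gr β)
    {Θ : List (Letter gr) → Letter gr → List (Letter gr) → Letter gr → k} (hΘ : IsForm₂ k Θ)
    (hΘs : SkewForm sdeg Θ) (hΘc : ClosedForm sdeg Θ)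
    (hdΘ : ∀ a v c x, wd sdeg a + sdeg v + wd sdeg c + sdeg x + e ≠ 0 → Θ a v c x = 0)
    (hΘβ : ∀ x y, Θ [] x [] y = β x.val y.val) :
    ∃ f : Op gr gr 1, f.toFun [] = 0 ∧ (∀ y, f.toFun [y] = y.val) ∧
      ∀ a v c x, pullForm₂ sdeg f.letter (AInfAlgebra.constForm β) a v c x = Θ a v c x := by
  have hCs := AInfAlgebra.skewForm_constForm hβs
  obtain ⟨f, _, hf⟩ := Op.exists_limit (gr := gr) (gr' := gr) (gr₁ := gr) (gr₁' := gr) (s := 1)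
    (t := 1) (P := fun n f _ => f.toFun [] = 0 ∧ (∀ y, f.toFun [y] = y.val) ∧
      ∀ a v c x, a.length + c.length + 1 ≤ n →
        pullForm₂ sdeg f.letter (AInfAlgebra.constForm β) a v c x = Θ a v c x) 1
    ⟨Op.ofLinear LinearMap.id fun i x hx => hx, Op.zero, rfl, fun y => rfl, fun a v c x hac => by
      obtain rfl := List.length_eq_zero_iff.1 (show a.length = 0 by omega)
      obtain rfl := List.length_eq_zero_iff.1 (show c.length = 0 by omega)
      rw [AInfHom.pullForm₂_nil, hΘβ]
      rfl⟩ (by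
    rintro n hn f₀ g₀ ⟨h0, h1, h2⟩
    obtain ⟨g, hg⟩ := exists_darboux_correction h h hd hβs hβ
      (AInfAlgebra.isForm₂_constForm hCs) hCs (AInfAlgebra.closedForm_constForm β)
      (constForm_degree hd) hΘ hΘs hΘc hdΘ (J := LinearMap.id) (fun i x hx => hx)
      (fun x y x' y' hx hy => by
        change β x'.val y'.val = _
        rw [hx, hy]
        rfl) hn f₀ h1 h2
    let f' := f₀.add (g.restrictLength (· = n + 1))
    have hff : f₀.Agree n f' := fun l hl => by
      change _ = _ + ite _ _ _
      rw [if_neg (by omega), add_zero]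
    refine ⟨f', g₀, ⟨?_, fun y => ?_, hg f' hff fun w hw => ?_⟩, hff, Op.Agree.refl _ _⟩
    · rw [← hff [] (Nat.zero_le _), h0]
    · rw [← hff [y] hn, h1]
    · change _ + ite _ _ _ = _
      rw [if_pos hw]
      rfl)
  obtain ⟨f₁, _, ⟨h0, h1, -⟩, hff, -⟩ := hf 1 le_rfl
  refine ⟨f, (hff [] (Nat.zero_le _)).trans h0, fun y => (hff [y] le_rfl).trans (h1 y),
    fun a v c x => ?_⟩
  obtain ⟨f₁, _, ⟨-, -, h2⟩, hff, -⟩ := hf (a.length + c.length + 1) (by omega)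
  rw [pullForm₂_congr _ _ _ _ _ hff, h2 _ _ _ _ le_rfl]

/-- A bijective change of coordinates transports an A∞-structure. -/
theorem exists_op_hat_eq_insOp (h : DirectSum.IsInternal gr) {f : Op gr gr 1}
    (hf : ∀ y, f.toFun [y] = y.val) {M : Op gr gr 2} (hM : M.toFun [] = 0) :
    ∃ m : Op gr gr 2, m.toFun [] = 0 ∧
      ∀ w, hat f.letter m.toFun w = insOp sdeg M.letter f.toFun w := by
  have hid (w : List (Letter gr)) : (w.map fun y => f.letter [y]) = w := by
    simp [Op.letter_singleton hf]
  have hnil : insOp sdeg M.letter f.toFun [] = 0 := by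
    have : f.toFun ([] ++ M.letter [] :: []) = 0 := f.apply_letter_eq_zero h hM [] []
    simp only [insOp, sumSplit₃, sumSplit_nil, this, smul_zero]
  obtain ⟨m, _, hm⟩ := Op.exists_limit (gr := gr) (gr' := gr) (gr₁ := gr) (gr₁' := gr) (s := 2)
    (t := 1) (P := fun n m _ => m.toFun [] = 0 ∧
      ∀ w : List (Letter gr), w.length ≤ n →
        hat f.letter m.toFun w = insOp sdeg M.letter f.toFun w) 0
    ⟨Op.zero, Op.zero, rfl, fun w hw => by
      obtain rfl := List.length_eq_zero_iff.1 (show w.length = 0 by omega)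
      rw [hnil, hat_nil]
      rfl⟩ (by
    rintro n - m₀ g₀ ⟨h0, h1⟩
    -- The defect of the relation at length `n + 1`. Since `f` has identity linear part,
    -- substituting `f` into `E` gives back `E` at that length, so adding it to `m₀` repairs the
    -- relation.
    let E := ((M.compIns h f (by norm_num)).sub (f.compHat h m₀)).restrictLength (· = n + 1)
    let m' := m₀.add E
    have hE (l : List (Letter gr)) (hl : l.length ≠ n + 1) : E.toFun l = 0 := if_neg hl
    have hmm : m₀.Agree n m' := fun l hl => by
      change _ = _ + E.toFun l
      rw [hE l (by omega), add_zero]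
    refine ⟨m', g₀, ⟨(hmm [] (Nat.zero_le _)).symm.trans h0, fun w hw => ?_⟩, hmm,
      Op.Agree.refl _ _⟩
    have h2 : hat f.letter m'.toFun w = hat f.letter m₀.toFun w + E.toFun w := by
      rw [← hid w]
      conv_rhs => rw [← hat_eq_finest f.letter w E.toFun fun l hl => hE l (by omega), hid]
      rw [hid]
      exact hat_add _ _ _ _
    rcases Nat.lt_or_ge w.length (n + 1) with hlt | hge
    · rw [h2, hE w (by omega), add_zero, h1 w (by omega)]
    · have : E.toFun w = insOp sdeg M.letter f.toFun w - hat f.letter m₀.toFun w :=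
        if_pos (by omega)
      rw [h2, this, add_sub_cancel])
  obtain ⟨m₁, _, ⟨h0, -⟩, hmm, -⟩ := hm 0 le_rfl
  refine ⟨m, (hmm [] le_rfl).trans h0, fun w => ?_⟩
  obtain ⟨m₁, _, ⟨-, h1⟩, hmm, -⟩ := hm w.length (Nat.zero_le _)
  rw [← h1 w le_rfl]
  exact hat_congr_length _ hmm

/-- The transported structure satisfies the A∞-relations. -/
theorem insOp_eq_zero_of_hat_eq_insOp (h : DirectSum.IsInternal gr) {f : Op gr gr 1}
    (hf : ∀ y, f.toFun [y] = y.val) {M m : Op gr gr 2}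
    (hM : ∀ w, insOp sdeg M.letter M.toFun w = 0)
    (hrel : ∀ w, hat f.letter m.toFun w = insOp sdeg M.letter f.toFun w) (w : List (Letter gr)) :
    insOp sdeg m.letter m.toFun w = 0 := by
  have hid (w : List (Letter gr)) : (w.map fun y => f.letter [y]) = w := by
    simp [Op.letter_singleton hf]
  -- The square of `m` pulls back along `f` to the square of `M`, which is zero. Substitution along
  -- a map with identity linear part is unitriangular in the word length, so the square of `m`
  -- vanishes by induction.
  have h1 (w : List (Letter gr)) : hat f.letter (insOp sdeg m.letter m.toFun) w = 0 := by
    rw [hat_insOp sdeg f.sdeg_letter_one M.letter m.letter m.toFun (fun _ _ _ => 0) w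
      fun a b c _ l l' => by
        rw [add_zero]
        exact (m.multilin l l').hat_eq_insOp h (hrel b)]
    simp only [hat_zero, smul_zero]
    rw [sumSplit₃_eq_zero fun _ _ _ _ => rfl, add_zero, funext hrel,
      insOp_insOp _ M.sdeg_letter_two]
    exact sumSplit₃_eq_zero fun a b c _ => (f.multilin a c).insOp_eq_zero h (hM b)
  induction hw : w.length using Nat.strong_induction_on generalizing w with
  | _ n ih =>
    have h2 := h1 w
    rwa [hat_eq_finest _ _ _ fun l hl => ih l.length (hw ▸ hl) l rfl, hid] at h2

end Darboux

/-! ### The chain-level nondegenerate case (statement 3) -/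

namespace AInfAlgebra.DualBimoduleMap

variable {k : Type uk} [Field k] [CharZero k] {A : AInfAlgebra.{uk, u} k} {e : ℤ}

/-- Chain level nondegenerate strong homotopy inner products come from cyclic inner products. -/
theorem IsStrongHomotopyInnerProduct.isOld {φ : A.DualBimoduleMap e}
    (hφ : φ.IsStrongHomotopyInnerProduct) (hn : φ.ChainNondegenerate) :
    φ.IsOldStrongHomotopyInnerProduct := by
  have hs : SkewForm sdeg φ.family.form := hφ.1
  have hc : ClosedForm sdeg φ.family.form := hφ.2.1
  have hβs (x y : Letter A.gr) : φ.family.form₀ x.val y.val =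
      -(ksign (sdeg x * sdeg y) • φ.family.form₀ y.val x.val) := by
    have := hs [] x [] y
    rwa [wd_nil, zero_add, zero_add] at this
  have hCs := skewForm_constForm hβs
  obtain ⟨f, hf0, hf1, hf⟩ := exists_op_pullForm₂_constForm A.isInternal φ.formDegree hβs hn
    φ.family.isForm₂_form hs hc (fun a v c x h => φ.degree a v c x h) fun x y => rfl
  obtain ⟨m, hm0, hfm⟩ := exists_op_hat_eq_insOp A.isInternal hf1 A.op_nil
  have hmm := insOp_eq_zero_of_hat_eq_insOp A.isInternal hf1 A.insOp_op hfm
  -- The pullback of this Lie derivative along `f` is the Lie derivative of `φ`, hence zero; by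
  -- induction on length, the pullback of a form vanishing on shorter words is the form itself.
  have hL (a : List (Letter A.gr)) (v : Letter A.gr) (c : List (Letter A.gr)) (x : Letter A.gr) :
      lieForm₂ sdeg m.letter (constForm φ.family.form₀) a v c x = 0 := by
    induction hw : a.length + c.length using Nat.strong_induction_on generalizing a v c x with
    | _ n ih =>
      rw [← pullForm₂_eq_self hf1 (Ω := lieForm₂ sdeg m.letter (constForm φ.family.form₀)) a v c x
        fun a' v' c' x' hlt => ih _ (hw ▸ hlt) a' v' c' x' rfl,
        pullForm₂_lieForm₂_of_closed A.isInternal f A.op m hfm (isForm₂_constForm hCs) hCs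
          (closedForm_constForm _), show pullForm₂ sdeg f.letter (constForm φ.family.form₀) =
          φ.family.form by funext a v c x; exact hf a v c x]
      exact φ.lieForm₂_eq_zero a v c x
  obtain ⟨g, hg, hg0, hgd, hgr⟩ := exists_of_op A.isInternal m hm0 hmm
  let B : AInfAlgebra.{uk, u} k := ⟨A.carrier, A.gr, A.isInternal, g, hg0, hgd, hgr⟩
  have hB : B.op = m := Op.ext (funext hg)
  let ψ : B.CyclicInnerProduct e := ⟨φ.family.form₀, φ.formDegree, hβs, hn, fun x l y => by
    have := cyclic_of_lieForm₂_eq_zero m hβs hL x l y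
    rw [← hB] at this
    simp only [op, vals_append, vals_cons] at this
    exact this⟩
  obtain ⟨F, hF⟩ := AInfHom.exists_of_op (A := A) (B := B) A.isInternal f hf0 fun w => by
    rw [hB]
    exact hfm w
  -- The linear part is the identity and the differentials agree, so the quasi-isomorphism
  -- conditions are immediate.
  have hlin (x : A) : F.linear x = x := by
    have : F.linear = LinearMap.id := by
      refine linear_ext_letter A.isInternal fun x => ?_
      refine Eq.trans ?_ (hf1 x)
      rw [← hF]
      rfl
    rw [this]
    rfl
  have hd (x : A) : B.d x = A.d x := by
    have := F.linear_d x
    rw [hlin, hlin] at this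
    exact this.symm
  refine ⟨B, ψ, F, ⟨fun a _ hb => ?_, fun b hb => ⟨b, 0, ?_, ?_⟩⟩, fun a v c x => ?_⟩
  · obtain ⟨b, hb⟩ := hb
    rw [← F.linear_apply, hlin] at hb
    exact ⟨b, (hd b).symm.trans hb⟩
  · rw [← hd]
    exact hb
  · rw [← F.linear_apply, hlin, map_zero, add_zero]
  · rw [F.pullback_eq, ψ.form_family, hF]
    exact (hf a v c x).symm

end AInfAlgebra.DualBimoduleMap

/-! ### Splitting off the cohomology -/

section Graded

variable {k : Type*} [Field k] {V W : Type*} [AddCommGroup V] [Module k V] [AddCommGroup W]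
  [Module k W] {gr : ℤ → Submodule k V} {gr' : ℤ → Submodule k W}

theorem mem_iSup_inf_of_homComp_mem (h : DirectSum.IsInternal gr) (x : V) {S : Submodule k V}
    (hS : ∀ i, homComp h i x ∈ S) : x ∈ ⨆ i, S ⊓ gr i :=
  mem_of_homComp_mem h fun i => Submodule.mem_iSup_of_mem i ⟨hS i, homComp_mem h i x⟩

/-- The grading of the image of a homogeneous idempotent. -/
theorem isInternal_range (h : DirectSum.IsInternal gr) {P : V →ₗ[k] V}
    (hP : ∀ i, ∀ x ∈ gr i, P x ∈ gr i) (hPP : ∀ x, P (P x) = P x) :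
    DirectSum.IsInternal fun i => (gr i).comap (LinearMap.range P).subtype := by
  have hinj : Function.Injective (LinearMap.range P).subtype := Subtype.val_injective
  refine (DirectSum.isInternal_submodule_iff_iSupIndep_and_iSup_eq_top _).2 ⟨?_, ?_⟩
  · have h1 := (DirectSum.isInternal_submodule_iff_iSupIndep_and_iSup_eq_top _).1 h
    intro i
    rw [disjoint_iff_inf_le]
    intro x hx
    have h2 := (h1.1 i).le_bot (show x.val ∈ _ from ⟨hx.1, ?_⟩)
    · exact (Submodule.mem_bot k).2 (Subtype.ext ((Submodule.mem_bot k).1 h2))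
    · have h3 := Submodule.mem_map_of_mem (f := (LinearMap.range P).subtype) hx.2
      simp only [Submodule.map_iSup] at h3
      exact iSup₂_mono (fun j _ => Submodule.map_comap_le _ _) h3
  · rw [eq_top_iff]
    rintro ⟨x, hx⟩ -
    have hPx : P x = x := by
      obtain ⟨y, rfl⟩ := hx
      exact hPP y
    have h1 : x ∈ ⨆ i, (LinearMap.range P) ⊓ gr i := mem_iSup_inf_of_homComp_mem h x fun i => by
      have := homComp_map h h (L := P) (s := 0) (fun i x hx => by simpa using hP i x hx) i x
      rw [hPx, add_zero] at this
      exact ⟨_, this.symm⟩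
    have h2 : (⨆ i, (LinearMap.range P) ⊓ gr i) =
        (⨆ i, (gr i).comap (LinearMap.range P).subtype).map (LinearMap.range P).subtype := by
      rw [Submodule.map_iSup]
      refine iSup_congr fun i => ?_
      rw [Submodule.map_comap_subtype]
    rw [h2] at h1
    obtain ⟨y, hy, hxy⟩ := h1
    rwa [show (⟨x, hx⟩ : LinearMap.range P) = y from Subtype.ext hxy.symm]

/-- A homogeneous map has a homogeneous generalized inverse. -/
theorem exists_homogeneous_pseudoinverse (h : DirectSum.IsInternal gr) {d : V →ₗ[k] V}
    (hd : ∀ i, ∀ x ∈ gr i, d x ∈ gr (i + 1)) :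
    ∃ g : V →ₗ[k] V, (∀ i, ∀ x ∈ gr (i + 1), g x ∈ gr i) ∧ ∀ x, d (g (d x)) = d x := by
  obtain ⟨r, hr⟩ := d.rangeRestrict.exists_rightInverse_of_surjective
    (LinearMap.range_rangeRestrict d)
  obtain ⟨g₀, hg₀⟩ := r.exists_extend
  have hg₀' (x : V) : d (g₀ (d x)) = d x := by
    have h1 := LinearMap.congr_fun hg₀ ⟨d x, x, rfl⟩
    have h2 := LinearMap.congr_fun hr ⟨d x, x, rfl⟩
    have h3 := congrArg Subtype.val h2
    exact (congrArg d h1).trans h3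
  -- The generalized inverse `g₀` need not be homogeneous. Keeping only its degree `-1` part
  -- preserves `d g d = d`, because `d` is homogeneous.
  let g : V →ₗ[k] V := DirectSum.toModule k ℤ V
    (fun j => homComp h (j - 1) ∘ₗ g₀ ∘ₗ (gr j).subtype) ∘ₗ (decomp h).toLinearMap
  have hg {j : ℤ} {x : V} (hx : x ∈ gr j) : g x = homComp h (j - 1) (g₀ x) := by
    have := decomp_coe h ⟨x, hx⟩
    simp only at this
    simp [g, this]
  refine ⟨g, fun i x hx => ?_, fun x => ?_⟩
  · rw [hg hx, add_sub_cancel_right]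
    exact homComp_mem _ _ _
  · have : d ∘ₗ g ∘ₗ d = d := by
      refine linear_ext_letter h fun y => ?_
      have hy : d y.val ∈ gr (y.1 + 1) := hd _ _ y.2.2
      rw [LinearMap.comp_apply, LinearMap.comp_apply, hg hy, add_sub_cancel_right,
        ← homComp_map h h hd, hg₀', homComp_of_mem h hy]
    exact LinearMap.congr_fun this x

end Graded

namespace AInfAlgebra

variable {k : Type uk} [Field k]

/-- A homotopy retraction of the complex `(A, m₁)` onto a graded vector space with zero
differential. -/
structure Retract (A : AInfAlgebra.{uk, u} k) {V : Type*} [AddCommGroup V] [Module k V]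
    (gr : ℤ → Submodule k V) where
  isInternal : DirectSum.IsInternal gr
  incl : V →ₗ[k] A
  proj : A →ₗ[k] V
  homotopy : A →ₗ[k] A
  incl_mem : ∀ i, ∀ x ∈ gr i, incl x ∈ A.gr i
  proj_mem : ∀ i, ∀ x ∈ A.gr i, proj x ∈ gr i
  homotopy_mem : ∀ i, ∀ x ∈ A.gr (i + 1), homotopy x ∈ A.gr i
  d_incl : ∀ y, A.d (incl y) = 0
  proj_d : ∀ x, proj (A.d x) = 0
  proj_incl : ∀ y, proj (incl y) = y
  eq_of_d_eq_zero : ∀ x, A.d x = 0 → x = incl (proj x) + A.d (homotopy x)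

/-- The cohomology as a homotopy retract. -/
theorem exists_retract (A : AInfAlgebra.{uk, u} k) :
    ∃ (H : Submodule k A) (gr : ℤ → Submodule k H), Nonempty (A.Retract gr) := by
  obtain ⟨g, hg, hdg⟩ := exists_homogeneous_pseudoinverse A.isInternal fun i x hx => A.d_mem hx
  -- With `d g d = d`, the operator `(1 - d g)(1 - g d)` takes values in cocycles, kills
  -- coboundaries and changes a cocycle `x` by `d (g x)`. It is therefore a projector onto
  -- representatives of the cohomology, with homotopy `g` on cocycles.
  let P : A →ₗ[k] A := (LinearMap.id - A.d ∘ₗ g) ∘ₗ (LinearMap.id - g ∘ₗ A.d)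
  have hP (x : A) : P x = x - g (A.d x) - A.d (g (x - g (A.d x))) := rfl
  have hdP (x : A) : A.d (P x) = 0 := by
    rw [hP, map_sub, map_sub, hdg, A.d_d, sub_self, sub_self]
  have hPd (x : A) : P (A.d x) = 0 := by
    rw [hP, A.d_d, map_zero, sub_zero, hdg, sub_self]
  have hPz (x : A) (hx : A.d x = 0) : P x = x - A.d (g x) := by
    rw [hP, hx, map_zero, sub_zero]
  have hPP (x : A) : P (P x) = P x := by
    rw [hPz _ (hdP x), sub_eq_self]
    rw [hP x, map_sub g, map_sub A.d, hdg, sub_self]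
  have hPm (i : ℤ) (x : A) (hx : x ∈ A.gr i) : P x ∈ A.gr i := by
    have h1 : x - g (A.d x) ∈ A.gr i := sub_mem hx (hg _ _ (A.d_mem hx))
    have h2 : A.d (g (x - g (A.d x))) ∈ A.gr i := by
      have h3 : x - g (A.d x) ∈ A.gr (i - 1 + 1) := by rwa [sub_add_cancel]
      have := A.d_mem (hg _ _ h3)
      rwa [sub_add_cancel] at this
    exact sub_mem h1 h2
  refine ⟨LinearMap.range P, fun i => (A.gr i).comap (LinearMap.range P).subtype,
    ⟨⟨isInternal_range A.isInternal hPm hPP, (LinearMap.range P).subtype, P.rangeRestrict, g,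
      fun i x hx => hx, hPm, hg, ?_, fun x => Subtype.ext (hPd x), ?_, fun x hx => ?_⟩⟩⟩
  · rintro ⟨_, x, rfl⟩
    exact hdP x
  · rintro ⟨_, x, rfl⟩
    exact Subtype.ext (hPP x)
  · change x = P x + A.d (g x)
    rw [hPz x hx, sub_add_cancel]

namespace Retract

variable {A : AInfAlgebra.{uk, u} k} {V : Type*} [AddCommGroup V] [Module k V]
  {gr : ℤ → Submodule k V} (R : A.Retract gr)

/-- The projection descends to cohomology and stays surjective, as every element of `V` has a
cocycle representative. -/
theorem finite (R : A.Retract gr) (hfin : Module.Finite k A.Cohomology) : Module.Finite k V := by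
  let L : A.Cohomology →ₗ[k] V := Submodule.liftQ _ (R.proj ∘ₗ (LinearMap.ker A.d).subtype) (by
    rintro ⟨x, hx⟩ ⟨y, hy⟩
    rw [LinearMap.mem_ker]
    change R.proj x = 0
    rw [← show A.d y = x from hy, R.proj_d])
  refine Module.Finite.of_surjective L fun y =>
    ⟨Submodule.Quotient.mk ⟨R.incl y, R.d_incl y⟩, R.proj_incl y⟩

theorem incl_eq_zero {y : V} (h : R.incl y ∈ LinearMap.range A.d) : y = 0 := by
  obtain ⟨b, hb⟩ := h
  rw [← R.proj_incl y, ← hb, R.proj_d]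

/-- The form induced by `φ_{0,0}` on the retract. -/
def form {e : ℤ} (φ : A.DualBimoduleMap e) : V →ₗ[k] Module.Dual k V :=
  φ.family.form₀.compl₁₂ R.incl R.incl

/-- The image of a letter. -/
def letter (x : Letter gr) : Letter A.gr := ⟨x.1, R.incl x.val, R.incl_mem _ _ x.2.2⟩

theorem formDegree {e : ℤ} (φ : A.DualBimoduleMap e) : FormDegree gr e (R.form φ) :=
  fun x y h => φ.formDegree (R.letter x) (R.letter y) h

theorem form_skew {e : ℤ} {φ : A.DualBimoduleMap e} (hφ : φ.SkewSymmetric) (x y : Letter gr) :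
    R.form φ x.val y.val = -(ksign (sdeg x * sdeg y) • R.form φ y.val x.val) := by
  have := hφ [] (R.letter x) [] (R.letter y)
  rw [wdeg_eq, wd_nil, zero_add, zero_add] at this
  exact this

/-- The bimodule equation on a single pair of letters says that `φ_{0,0}` is compatible with the
differential; the term with `d (R.incl x)` vanishes. -/
theorem form₀_incl_d {e : ℤ} (φ : A.DualBimoduleMap e) (x : V) (y : A) :
    φ.family.form₀ (R.incl x) (A.d y) = 0 := by
  have : φ.family.form₀.compl₁₂ R.incl A.d = 0 := by
    refine linear_ext_letter R.isInternal fun x => linear_ext_letter A.isInternal fun y => ?_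
    have h := φ.lieForm₂_eq_zero [] (R.letter x) [] y
    have h1 : φ.family.form [] (A.op.letter [R.letter x]) [] y = 0 := by
      change φ.family.form₀ (A.op.toFun [R.letter x]) _ = 0
      rw [← A.d_val, show A.d (R.letter x).val = 0 from R.d_incl _, map_zero]
      rfl
    have h2 : φ.family.form [A.op.letter []] (R.letter x) [] y = 0 :=
      (φ.family.isForm₂_form.left (R.letter x) [] y).eq_zero A.isInternal
        (y := A.op.letter []) A.op_nil [] []
    have h3 : φ.family.form [] (R.letter x) [A.op.letter []] y = 0 :=
      (φ.family.isForm₂_form.right [] (R.letter x) y).eq_zero A.isInternal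
        (y := A.op.letter []) A.op_nil [] []
    simp only [lieForm₂, sumSplit₃, sumSplit_nil, List.nil_append, h1, h2, h3, smul_zero,
      zero_add, smul_eq_zero_iff_eq] at h
    rw [LinearMap.compl₁₂_apply, A.d_val]
    exact h
  exact LinearMap.congr_fun (LinearMap.congr_fun this x) y

/-- A cocycle pairing nontrivially with a representative may be replaced by its own representative,
the difference being exact. Finite dimension then upgrades injectivity to surjectivity onto the
dual. -/
theorem form_nondeg (hfin : Module.Finite k A.Cohomology) {e : ℤ} {φ : A.DualBimoduleMap e}
    (hφ : φ.HomologicallyNondegenerate) : FormNondeg gr (R.form φ) := by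
  have h1 (x : V) (hx : x ≠ 0) : ∃ y, R.form φ x y ≠ 0 := by
    obtain ⟨b, hb, hne⟩ := hφ (R.incl x) (R.d_incl x) fun h => hx (R.incl_eq_zero h)
    refine ⟨R.proj b, fun h0 => hne ?_⟩
    rw [← Family.form₀_apply, R.eq_of_d_eq_zero b hb, map_add, R.form₀_incl_d, add_zero]
    exact h0
  have := R.finite hfin
  have hinj : Function.Injective (R.form φ) := by
    rw [injective_iff_map_eq_zero]
    intro x hx
    by_contra hne
    obtain ⟨y, hy⟩ := h1 x hne
    exact hy (LinearMap.congr_fun hx y)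
  have hsurj : Function.Surjective (R.form φ) :=
    (LinearMap.injective_iff_surjective_of_finrank_eq_finrank
      Subspace.dual_finrank_eq.symm).1 hinj
  refine ⟨h1, fun j ξ => ?_⟩
  obtain ⟨ξ', hξ'⟩ := LinearMap.exists_extend ξ
  obtain ⟨a, ha⟩ := hsurj ξ'
  refine ⟨a, fun b => ?_⟩
  rw [ha, ← hξ']
  rfl

end Retract

end AInfAlgebra

/-! ### Minimal models adapted to a closed two-form (statement 1) -/

namespace AInfAlgebra

variable {k : Type uk} [Field k]

namespace Retract

variable {A : AInfAlgebra.{uk, u} k} {V : Type*} [AddCommGroup V] [Module k V]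
  {gr : ℤ → Submodule k V} (R : A.Retract gr)

/-- A minimal model up to words of length `n`: operations `m` on the retract and a morphism `f` to
`A` extending the inclusion, such that the relations hold on words of length at most `n`. -/
structure IsModel (n : ℕ) (f : Op gr A.gr 1) (m : Op gr gr 2) : Prop where
  morphism_nil : f.toFun [] = 0
  morphism_singleton : ∀ y, f.toFun [y] = R.incl y.val
  nil : m.toFun [] = 0
  singleton : ∀ y, m.toFun [y] = 0
  hat_eq : ∀ w : List (Letter gr), w.length ≤ n →
    hat f.letter A.op.toFun w = insOp sdeg m.letter f.toFun w
  insOp_eq : ∀ w : List (Letter gr), w.length ≤ n → insOp sdeg m.letter m.toFun w = 0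

/-- The obstruction to the morphism relation. -/
def defect (f : Op gr A.gr 1) (m : Op gr gr 2) : Op gr A.gr 2 :=
  (f.compHat A.isInternal A.op).sub (m.compIns R.isInternal f (by norm_num))

variable {R}

theorem defect_eq_zero {n : ℕ} {f : Op gr A.gr 1} {m : Op gr gr 2} (h : R.IsModel n f m)
    {w : List (Letter gr)} (hw : w.length ≤ n) : (R.defect f m).toFun w = 0 :=
  sub_eq_zero.2 (h.hat_eq w hw)

/-- The obstruction to extending a truncated minimal model is closed, and the next relation for
`m` is automatic. -/
theorem IsModel.obstruction {n : ℕ} {f : Op gr A.gr 1} {m : Op gr gr 2} (h : R.IsModel n f m)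
    (hm : ∀ w, w.length = n + 1 → m.toFun w = 0) {w : List (Letter gr)} (hw : w.length = n + 1) :
    insOp sdeg m.letter m.toFun w = 0 ∧ A.d ((R.defect f m).toFun w) = 0 := by
  set E := R.defect f m with hE
  -- The failed relation, with error `E`, is propagated to words and evaluated on the A∞-relation of
  -- `A`, which makes the left-hand side zero.
  have h1 := hat_insOp sdeg f.sdeg_letter_one m.letter A.op.letter A.op.toFun
    (fun l b l' => A.op.toFun (l ++ E.letter b :: l')) w fun a b c _ l l' =>
      hat_eq_insOp_of_val A.isInternal (E := E.letter b) (add_sub_cancel _ _).symm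
        (A.op.multilin l l')
  rw [show insOp sdeg A.op.letter A.op.toFun = fun _ => 0 from funext A.insOp_op, hat_zero] at h1
  -- Below length `n + 1` the morphism relation holds, so this is a double insertion into `f`. Only
  -- the insertion of the square of `m` on the whole word survives, and there `f` acts by its linear
  -- part `R.incl`.
  have h2 : insOp sdeg m.letter (hat f.letter A.op.toFun) w =
      R.incl (insOp sdeg m.letter m.toFun w) := by
    have h3 := insOp_update (m := m) (m' := m) (F := m.compIns R.isInternal f (by norm_num))
      (F' := f.compHat A.isInternal A.op) R.isInternal hw h.nil h.singleton (hm w hw)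
      (Op.Agree.refl _ _) fun l hl => (h.hat_eq l hl).symm
    rw [show (f.compHat A.isInternal A.op).toFun [m.letter w] = 0 from
      (f.compHat A.isInternal A.op).apply_letter_eq_zero R.isInternal (hm w hw) [] [],
      add_zero] at h3
    refine h3.trans ((insOp_insOp _ m.sdeg_letter_two f.toFun w).trans ?_)
    rw [sumSplit₃_eq_single fun a b c _ hb =>
      (f.multilin a c).insOp_eq_zero R.isInternal (h.insOp_eq b (by omega))]
    simp only [List.nil_append, h.morphism_singleton, Op.val_letter, insOp, map_sumSplit₃,
      map_ksign_smul]
  -- The defect vanishes on shorter words, so only the subword `w` itself contributes.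
  have h4 : (sumSplit₃ w fun a b c => ksign (wd sdeg a) • hat f.letter (fun l =>
      hat f.letter (fun l' => A.op.toFun (l ++ E.letter b :: l')) c) a) = A.d (E.toFun w) := by
    rw [sumSplit₃_eq_single fun a b c _ hb => ?_]
    · rw [hat_nil, hat_nil, wd_nil]
      have h0 (z : A) : ksign 0 • z = z := one_smul ℤˣ z
      rw [h0]
      exact (A.d_val (E.letter w)).symm
    · have h5 (l l' : List (Letter A.gr)) : A.op.toFun (l ++ E.letter b :: l') = 0 :=
        A.op.multilin.eq_zero A.isInternal (y := E.letter b) (defect_eq_zero h (by omega)) l l'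
      simp only [h5, hat_zero, smul_zero]
  rw [h2, h4] at h1
  -- Now `0 = incl (m ∘ m) + d E`: the first summand is an exact representative, hence zero, and
  -- both conclusions follow.
  have h5 : insOp sdeg m.letter m.toFun w = 0 := by
    refine R.incl_eq_zero ⟨-(E.toFun w), ?_⟩
    rw [map_neg]
    exact neg_eq_of_add_eq_zero_left h1.symm
  rw [h5, map_zero, zero_add] at h1
  exact ⟨h5, h1.symm⟩

/-- Extension of a truncated minimal model by one step. The morphism may be changed by any
map to the retract. -/
theorem IsModel.extend {n : ℕ} (hn : 1 ≤ n) {f : Op gr A.gr 1} {m : Op gr gr 2}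
    (h : R.IsModel n f m) (hf : ∀ w, w.length = n + 1 → f.toFun w = 0)
    (hm : ∀ w, w.length = n + 1 → m.toFun w = 0) {f' : Op gr A.gr 1} {m' : Op gr gr 2}
    (hff : f.Agree n f') (hmm : m.Agree n m')
    (hm' : ∀ w, w.length = n + 1 → m'.toFun w = R.proj ((R.defect f m).toFun w))
    (hf' : ∀ w, w.length = n + 1 → ∃ y, f'.toFun w =
      -R.homotopy ((R.defect f m).toFun w) + R.incl y) : R.IsModel (n + 1) f' m' := by
  have hs (y : Letter gr) : f'.toFun [y] = R.incl y.val :=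
    (hff [y] hn).symm.trans (h.morphism_singleton y)
  have hs' (y : Letter gr) : m'.toFun [y] = 0 := (hmm [y] hn).symm.trans (h.singleton y)
  refine ⟨(hff [] (Nat.zero_le _)).symm.trans h.morphism_nil, hs,
    (hmm [] (Nat.zero_le _)).symm.trans h.nil, hs', fun w hw => ?_, fun w hw => ?_⟩
  · rcases Nat.lt_or_ge w.length (n + 1) with hlt | hge
    · rw [← insOp_congr R.isInternal h.nil (hmm.mono (by omega)) (hff.mono (by omega)),
        ← h.hat_eq w (by omega)]
      exact (hat_congr_left _ fun b hb => Op.letter_congr (hff b (by omega))).symm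
    · have hw' : w.length = n + 1 := by omega
      obtain ⟨y, hy⟩ := hf' w hw'
      have h1 := (h.obstruction hm hw').2
      have h2 := R.eq_of_d_eq_zero _ h1
      have h3 : hat f.letter A.op.toFun w - insOp sdeg m.letter f.toFun w =
        (R.defect f m).toFun w := rfl
      -- At length `n + 1` the relation reads `E + d (f' w) = incl (m' w)`. With the prescribed
      -- values it is the homotopy decomposition `h2` of the cocycle `E`; the summand `R.incl y`
      -- drops out because `d` kills it.
      rw [hat_update hw' hff, insOp_update R.isInternal hw' h.nil h.singleton (hm w hw') hmm hff,
        ← A.d_val, ← A.d_val, Op.val_letter, Op.val_letter, hf w hw', hy, hs, Op.val_letter,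
        hm' w hw', map_zero, sub_zero, map_add, map_neg, R.d_incl, add_zero,
        ← sub_eq_zero, add_sub_add_comm, h3]
      nth_rw 1 [h2]
      abel
  · rcases Nat.lt_or_ge w.length (n + 1) with hlt | hge
    · rw [← insOp_congr R.isInternal h.nil (hmm.mono (by omega)) (hmm.mono (by omega)),
        h.insOp_eq w (by omega)]
    · have hw' : w.length = n + 1 := by omega
      rw [insOp_update R.isInternal hw' h.nil h.singleton (hm w hw') hmm hmm, hs', add_zero]
      exact (h.obstruction hm hw').1

theorem IsModel.congr {n : ℕ} (hn : 1 ≤ n) {f f' : Op gr A.gr 1} {m m' : Op gr gr 2}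
    (h : R.IsModel n f m) (hff : f.Agree n f') (hmm : m.Agree n m') : R.IsModel n f' m' where
  morphism_nil := (hff [] (Nat.zero_le _)).symm.trans h.morphism_nil
  morphism_singleton y := (hff [y] hn).symm.trans (h.morphism_singleton y)
  nil := (hmm [] (Nat.zero_le _)).symm.trans h.nil
  singleton y := (hmm [y] hn).symm.trans (h.singleton y)
  hat_eq w hw := by
    rw [← insOp_congr R.isInternal h.nil (hmm.mono hw) (hff.mono hw), ← h.hat_eq w hw]
    exact (hat_congr_left _ fun b hb => Op.letter_congr (hff b (hb.trans hw))).symm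
  insOp_eq w hw := by
    rw [← insOp_congr R.isInternal h.nil (hmm.mono hw) (hmm.mono hw), h.insOp_eq w hw]

variable (R)

theorem isModel_one : R.IsModel 1 (Op.ofLinear R.incl R.incl_mem) Op.zero where
  morphism_nil := rfl
  morphism_singleton _ := rfl
  nil := rfl
  singleton _ := rfl
  hat_eq w hw := by
    have h1 : insOp sdeg (Op.zero (gr := gr) (gr' := gr) (s := 2)).letter
        (Op.ofLinear R.incl R.incl_mem).toFun w = 0 :=
      sumSplit₃_eq_zero fun a b c _ => by
        rw [Op.apply_letter_eq_zero R.isInternal _ (m := Op.zero) (b := b) rfl, smul_zero]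
    rw [h1]
    rcases w with _ | ⟨y, _ | ⟨z, w⟩⟩
    · rw [hat_nil, A.op_nil]
    · rw [hat_singleton, ← A.d_val]
      exact R.d_incl _
    · simp at hw
  insOp_eq w hw := sumSplit₃_eq_zero fun a b c _ => smul_zero _

/-- Simultaneous construction of a minimal model and of Darboux coordinates. -/
theorem exists_model [CharZero k] {e : ℤ} {φ : A.DualBimoduleMap e}
    (hs : φ.SkewSymmetric) (hc : φ.Closed) (hnd : FormNondeg gr (R.form φ)) :
    ∃ (f : Op gr A.gr 1) (m : Op gr gr 2), (∀ n, 1 ≤ n → R.IsModel n f m) ∧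
      ∀ a v c x, pullForm₂ sdeg f.letter φ.family.form a v c x = constForm (R.form φ) a v c x := by
  have hβs := R.form_skew hs
  have hCs := skewForm_constForm hβs
  obtain ⟨f, m, hfm⟩ := Op.exists_limit (gr := gr) (gr' := A.gr) (gr₁ := gr) (gr₁' := gr) (s := 1)
    (t := 2) (P := fun n f m => R.IsModel n f m ∧ ∀ a v c x, a.length + c.length + 1 ≤ n →
      pullForm₂ sdeg f.letter φ.family.form a v c x = constForm (R.form φ) a v c x) 1
    ⟨_, _, R.isModel_one, fun a v c x hac => by
      obtain rfl := List.length_eq_zero_iff.1 (show a.length = 0 by omega)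
      obtain rfl := List.length_eq_zero_iff.1 (show c.length = 0 by omega)
      rw [AInfHom.pullForm₂_nil]
      rfl⟩ (by
    rintro n hn f₀ m₀ ⟨h1, h2⟩
    -- Truncation provides the vanishing at length `n + 1` that `IsModel.extend` requires.
    let f := f₀.restrictLength (· ≤ n)
    let m := m₀.restrictLength (· ≤ n)
    have hff : f.Agree n f₀ := Op.agree_restrictLength _ _
    have hmm : m.Agree n m₀ := Op.agree_restrictLength _ _
    have h3 : R.IsModel n f m := h1.congr hn hff.symm hmm.symm
    have hf (w : List (Letter gr)) (hw : w.length = n + 1) : f.toFun w = 0 := if_neg (by omega)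
    have hm (w : List (Letter gr)) (hw : w.length = n + 1) : m.toFun w = 0 := if_neg (by omega)
    let E := R.defect f m
    let m' := m.add ((E.compLinear R.proj fun i x hx => R.proj_mem _ _ hx).restrictLength
      (· = n + 1))
    let f₁ := f.sub ((E.compLinear (t := 1) R.homotopy fun i x hx =>
      R.homotopy_mem _ _ (by rwa [add_assoc])).restrictLength (· = n + 1))
    have hff₁ : f.Agree n f₁ := fun l hl => by
      change _ = _ - ite _ _ _
      rw [if_neg (by omega), sub_zero]
    -- The Darboux correction is made after the homotopy correction `f₁`. Its values lie in the
    -- image of `R.incl`, the freedom allowed by `IsModel.extend`, so it does not disturb the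
    -- morphism relation.
    obtain ⟨g, hg⟩ := exists_darboux_correction R.isInternal A.isInternal (R.formDegree φ) hβs hnd
      φ.family.isForm₂_form hs hc (fun a v c x h => φ.degree a v c x h) (isForm₂_constForm hCs)
      hCs (closedForm_constForm _) (constForm_degree (R.formDegree φ)) (J := R.incl) R.incl_mem
      (fun x y x' y' hx hy => by
        change φ.family.form₀ x'.val y'.val = _
        rw [hx, hy]
        rfl) hn f₁ (fun y => (hff₁ [y] hn).symm.trans (h3.morphism_singleton y))
      (fun a v c x hac => by
        rw [← h2 a v c x hac]
        exact pullForm₂_congr _ _ _ _ _ ((hff₁.symm.trans hff).mono (by omega)))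
    let f' := f₁.add ((g.compLinear R.incl fun i x hx => R.incl_mem _ _ hx).restrictLength
      (· = n + 1))
    have hff' : f₁.Agree n f' := fun l hl => by
      change _ = _ + ite _ _ _
      rw [if_neg (by omega), add_zero]
    have hmm' : m.Agree n m' := fun l hl => by
      change _ = _ + ite _ _ _
      rw [if_neg (by omega), add_zero]
    have hf' (w : List (Letter gr)) (hw : w.length = n + 1) :
        f'.toFun w = f₁.toFun w + R.incl (g.toFun w) := by
      change _ + ite _ _ _ = _
      rw [if_pos hw]
      rfl
    refine ⟨f', m', ⟨h3.extend hn hf hm (hff₁.trans hff') hmm' (fun w hw => ?_) fun w hw => ?_,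
      hg f' hff' hf'⟩, hff.symm.trans (hff₁.trans hff'), hmm.symm.trans hmm'⟩
    · change _ + ite _ _ _ = _
      rw [if_pos hw, hm w hw, zero_add]
      rfl
    · refine ⟨g.toFun w, ?_⟩
      rw [hf' w hw]
      congr 1
      change _ - ite _ _ _ = _
      rw [if_pos hw, hf w hw, zero_sub]
      rfl)
  refine ⟨f, m, fun n hn => ?_, fun a v c x => ?_⟩
  · obtain ⟨f', m', ⟨h1, -⟩, hff, hmm⟩ := hfm n hn
    exact h1.congr hn hff.symm hmm.symm
  · obtain ⟨f', m', ⟨-, h2⟩, hff, hmm⟩ := hfm (a.length + c.length + 1) (by omega)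
    rw [pullForm₂_congr _ _ _ _ _ hff, h2 _ _ _ _ le_rfl]

end Retract

/-- Strong homotopy inner products pull back to cyclic inner products on a minimal model. -/
theorem DualBimoduleMap.IsStrongHomotopyInnerProduct.exists_cyclicInnerProduct [CharZero k]
    {A : AInfAlgebra.{uk, u} k} (hfin : Module.Finite k A.Cohomology) {e : ℤ}
    {φ : A.DualBimoduleMap e} (hφ : φ.IsStrongHomotopyInnerProduct) :
    ∃ (B : AInfAlgebra.{uk, u} k) (ψ : B.CyclicInnerProduct e) (ι : AInfHom B A),
      ι.IsQuasiIso ∧ ι.DiagramCommutes e ψ.family φ.family := by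
  obtain ⟨H, gr, ⟨R⟩⟩ := A.exists_retract
  have hnd := R.form_nondeg hfin hφ.2.2
  have hβs := R.form_skew hφ.1
  obtain ⟨f, m, hfm, hf⟩ := R.exists_model hφ.1 hφ.2.1 hnd
  have hrel (w : List (Letter gr)) :
      hat f.letter A.op.toFun w = insOp sdeg m.letter f.toFun w :=
    (hfm (w.length + 1) (by omega)).hat_eq w (by omega)
  have h1 := hfm 1 le_rfl
  -- The constant form is the pullback of the invariant form `φ` along an A∞-morphism, hence
  -- invariant.
  have hL (a : List (Letter gr)) (v : Letter gr) (c : List (Letter gr)) (x : Letter gr) :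
      lieForm₂ sdeg m.letter (constForm (R.form φ)) a v c x = 0 := by
    rw [← show pullForm₂ sdeg f.letter φ.family.form = constForm (R.form φ) by
      funext a v c x; exact hf a v c x, ← pullForm₂_lieForm₂_of_closed A.isInternal f m A.op hrel
      φ.family.isForm₂_form hφ.1 hφ.2.1, show lieForm₂ sdeg A.op.letter φ.family.form =
      fun _ _ _ _ => 0 by funext a v c x; exact φ.lieForm₂_eq_zero a v c x]
    simp [pullForm₂, hat_zero, sumSplit₃, sumSplit_zero]
  obtain ⟨g, hg, hg0, hgd, hgr⟩ := exists_of_op R.isInternal m h1.nil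
    fun w => (hfm (w.length + 1) (by omega)).insOp_eq w (by omega)
  let B : AInfAlgebra.{uk, u} k := ⟨H, gr, R.isInternal, g, hg0, hgd, hgr⟩
  have hB : B.op = m := Op.ext (funext hg)
  let ψ : B.CyclicInnerProduct e := ⟨R.form φ, R.formDegree φ, hβs, hnd, fun x l y => by
    have := cyclic_of_lieForm₂_eq_zero m hβs hL x l y
    rw [← hB] at this
    simp only [op, vals_append, vals_cons] at this
    exact this⟩
  obtain ⟨F, hF⟩ := AInfHom.exists_of_op (A := B) (B := A) R.isInternal f h1.morphism_nil
    fun w => by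
      rw [hB]
      exact hrel w
  have hlin (x : B) : F.linear x = R.incl x := by
    have : F.linear = R.incl := by
      refine linear_ext_letter R.isInternal fun x => ?_
      refine Eq.trans ?_ (h1.morphism_singleton x)
      rw [← hF]
      rfl
    rw [this]
  -- The model is minimal, so its cohomology is the whole space and `ι` is a quasi-isomorphism by
  -- the retract identities.
  have hd (x : B) : B.d x = 0 := by
    have : B.d = 0 := by
      refine linear_ext_letter B.isInternal fun x => ?_
      rw [B.d_val, hB, h1.singleton]
      rfl
    rw [this]
    rfl
  refine ⟨B, ψ, F, ⟨fun a _ hb => ⟨0, ?_⟩, fun b hb => ⟨R.proj b, R.homotopy b, hd _, ?_⟩⟩,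
    fun a v c x => ?_⟩
  · rw [← F.linear_apply, hlin] at hb
    rw [map_zero]
    exact (R.incl_eq_zero hb).symm
  · rw [← F.linear_apply, hlin]
    exact R.eq_of_d_eq_zero b hb
  · rw [F.pullback_eq, hF]
    refine Eq.trans ?_ (hf a v c x).symm
    exact congrFun (congrFun (congrFun (congrFun ψ.form_family a) v) c) x

end AInfAlgebra

/-! ### The main theorem -/

theorem mainTheorem4 {k : Type uk} [Field k] [CharZero k] (A : AInfAlgebra.{uk, u} k)
    (hfin : Module.Finite k A.Cohomology) (e : ℤ) (φ : A.DualBimoduleMap e) :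
    (φ.IsStrongHomotopyInnerProduct →
      ∃ (B : AInfAlgebra.{uk, u} k) (ψ : B.CyclicInnerProduct e) (ι : AInfHom B A),
        ι.IsQuasiIso ∧ ι.DiagramCommutes e ψ.family φ.family) ∧
    (∀ (B : AInfAlgebra.{uk, v} k) (ψ : B.CyclicInnerProduct e) (f : AInfHom A B),
      f.IsQuasiIso → f.DiagramCommutes e φ.family ψ.family →
        φ.IsStrongHomotopyInnerProduct) ∧
    (φ.ChainNondegenerate →
      (φ.IsOldStrongHomotopyInnerProduct ↔ φ.IsStrongHomotopyInnerProduct)) :=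
  ⟨fun hφ => hφ.exists_cyclicInnerProduct hfin,
    fun _ ψ f hf hd => f.isStrongHomotopyInnerProduct_of_diagramCommutes φ ψ hf hd,
    fun hn => ⟨fun ⟨_, ψ, f, hf, hd⟩ =>
      f.isStrongHomotopyInnerProduct_of_diagramCommutes φ ψ hf hd, fun hφ => hφ.isOld hn⟩⟩
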